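/- **Theorem.** Let $(M_i,g_i)$, $1\le i\le N$, be simply connected Riemannian spin manifolds (smooth, without boundary) of dimension $D_i$, each with a spin structure, and let $S_i$ be the spinor bundle of $M_i$, i.e. the complex vector bundle associated to the principal $Spin(D_i)$-bundle by an irreducible complex module $V_i$ of the Clifford algebra of $\mathbb R^{D_i}$ (with $v\cdot v=-|v|^2$). Let $M=M_1\times\cdots\times M_N$, so that $TM=\bigoplus_i TM_i$ (pullbacks along the projections being omitted), and let $g$ be a Riemannian metric on $M$ of the form $$g_x(X,Y)=\sum_{i=1}^N g_i\big(A_i(x)X_i,A_i(x)Y_i\big),\qquad X=\sum_i X_i,\ Y=\sum_i Y_i,\quad X_i,Y_i\in T_{x_i}M_i,$$ where $A_i(x)$ is an endomorphism of $T_{x_i}M_i$ depending smoothly on $x\in M$. If $D_i$ is even, let $S_i^{\pm}\subset S_i$ be the $\pm1$-eigenbundles of the complex volume element $\mathrm i^{D_i/2}e_1\cdots e_{D_i}$, so $S_i=S_i^+\oplus S_i^-$. If $D_i$ is odd, let $S_i^+$ and $S_i^-$ be two copies of $S_i$ and let $\Delta(S_i^+\oplus S_i^-)=\{(\xi,\xi)\}$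 be the diagonal. Put $W=\bigotimes_{i=1}^N(S_i^+\oplus S_i^-)$, a bundle over $M$, with the multiplication by $X\in TM$ given on $\Xi=\xi_1\otimes\cdots\otimes\xi_N$, $\xi_i\in S_i^{\epsilon_i}$, by $$X\cdot\Xi=\sum_{i=1}^N(-1)^{\epsilon_1+\cdots+\epsilon_{i-1}}\,\xi_1\otimes\cdots\otimes (A_iX_i)\xi_i\otimes\cdots\otimes\xi_N ,$$ where a vector of $TM_i$ acts on $S_i^+\oplus S_i^-$ by $(\xi^+,\xi^-)\mapsto(X_i\xi^-,X_i\xi^+)$. Let $N_o$ be the number of odd $D_i$, choose a set $K$ of $N_o-[N_o/2]$ indices $i$ with $D_i$ odd, and let $S\subset W$ be the subbundle $$S=\bigotimes_{i\notin K}(S_i^+\oplus S_i^-)\otimes\bigotimes_{k\in K}\Delta(S_k^+\oplus S_k^-)$$ (the tensor factors being kept in their order $1,\dots,N$). Then $(M,g)$ is spin, and for every spin structure on $(M,g)$ the spinor bundle of $M$ (associated by any irreducible complex module of the Clifford algebra of $\mathbb R^{D}$, $D=\sum_i D_i$) is isomorphic to $S$ as a smooth complex vector bundle. The isomorphism $\Phi$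 can be chosen compatible with the reduction of the structure group to $Spin(D_1)\times\cdots\times Spin(D_N)$, in the sense that $\Phi(X\cdot Y\cdot\psi)=X\cdot Y\cdot\Phi(\psi)$ whenever $X,Y\in TM_i$ for the same $i$, the products on the right being taken in $W$. -/

import Mathlib

open scoped Manifold ContDiff Bundle Topology TensorProduct
open Bundle

universe u v w

noncomputable section

/-! ### The product of finitely many manifolds -/

/-- A finite product of manifolds without boundary is a manifold (for the product charts). -/
instance piIsManifold {ι : Type*} [Fintype ι] {E : ι → Type*} [∀ i, NormedAddCommGroup (E i)]
    [∀ i, NormedSpace ℝ (E i)] (n : ℕ∞ω) (M : ι → Type*)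
    [∀ i, TopologicalSpace (M i)] [∀ i, ChartedSpace (E i) (M i)]
    [∀ i, IsManifold (𝓘(ℝ, E i)) n (M i)] :
    IsManifold (ModelWithCorners.pi fun i => 𝓘(ℝ, E i)) n (∀ i, M i) := by
  apply isManifold_of_contDiffOn
  rintro _ _ ⟨e, he, rfl⟩ ⟨e', he', rfl⟩
  rw [contDiffOn_pi]
  intro i
  have h := ((contDiffGroupoid n 𝓘(ℝ, E i)).compatible (he i trivial) (he' i trivial)).1
  refine ContDiffOn.comp (g := fun y : E i => ((e i).symm ≫ₕ e' i) y)
    (f := fun f : (∀ i, E i) => f i) h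
    (ContinuousLinearMap.proj (R := ℝ) (φ := E) i).contDiff.contDiffOn ?_
  rintro x ⟨hx, -⟩
  refine ⟨?_, ⟨x i, rfl⟩⟩
  have hx' : x ∈ ((OpenPartialHomeomorph.pi e).symm ≫ₕ OpenPartialHomeomorph.pi e').source := hx
  rw [OpenPartialHomeomorph.trans_source] at hx'
  change x i ∈ ((e i).symm ≫ₕ e' i).source
  rw [OpenPartialHomeomorph.trans_source]
  exact ⟨hx'.1 i trivial, hx'.2 i trivial⟩

/-- The model of the product manifold `∏ i, M i` with `dim (M i) = D i`. -/
abbrev prodModel {N : ℕ} (D : Fin N → ℕ) :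
    ModelWithCorners ℝ (∀ i, EuclideanSpace ℝ (Fin (D i)))
      (ModelPi fun i => EuclideanSpace ℝ (Fin (D i))) :=
  ModelWithCorners.pi fun i => 𝓡 (D i)

/-- A smooth Riemannian metric on a manifold. -/
abbrev SmoothMetric {E : Type*} [NormedAddCommGroup E] [NormedSpace ℝ E] {H : Type*}
    [TopologicalSpace H] (I : ModelWithCorners ℝ E H) (M : Type*) [TopologicalSpace M]
    [ChartedSpace H M] [IsManifold I ∞ M] :=
  ContMDiffRiemannianMetric I ∞ E (fun x : M => TangentSpace I x)

/-! ### Clifford algebra, spin group, spinor modules -/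

/-- The form `-(x₁² + ⋯ + xₙ²)` on `ℝⁿ`. -/
def negEuclid (n : ℕ) : QuadraticForm ℝ (Fin n → ℝ) :=
  QuadraticMap.weightedSumSquares ℝ fun _ : Fin n => (-1 : ℝ)

/-- The Clifford algebra of Euclidean `ℝⁿ`, with the convention `v * v = -|v|²`. -/
abbrev Cl (n : ℕ) : Type := CliffordAlgebra (negEuclid n)

/-- `Spin(n)`, inside the Clifford algebra. -/
abbrev Spin (n : ℕ) : Submonoid (Cl n) := spinGroup (negEuclid n)

/-- Euclidean vectors as elements of the Clifford algebra. -/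
abbrev clVec {n : ℕ} (v : Fin n → ℝ) : Cl n := CliffordAlgebra.ι (negEuclid n) v

/-- The standard basis vector `e a` as an element of the Clifford algebra. -/
abbrev clE {n : ℕ} (a : Fin n) : Cl n := clVec (Pi.single a 1)

/-- Complex modules over the Clifford algebra. -/
abbrev ClRep (n : ℕ) (V : Type v) [NormedAddCommGroup V] [NormedSpace ℂ V] :=
  Cl n →ₐ[ℝ] Module.End ℂ V

/-- A complex module over the Clifford algebra is a *spinor module* if it is irreducible:
it is nonzero and has no invariant complex subspaces besides `0` and itself. -/
def ClRep.IsSpinorModule {n : ℕ} {V : Type v} [NormedAddCommGroup V] [NormedSpace ℂ V]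
    (ρ : ClRep n V) : Prop :=
  Nontrivial V ∧
    ∀ U : Submodule ℂ V, (∀ a : Cl n, ∀ ξ ∈ U, ρ a ξ ∈ U) → U = ⊥ ∨ U = ⊤

/-! ### Spin structures -/

section SpinStructure

variable {E : Type*} [NormedAddCommGroup E] [NormedSpace ℝ E] {H : Type*}
  [TopologicalSpace H] (I : ModelWithCorners ℝ E H) {M : Type u} [TopologicalSpace M]
  [ChartedSpace H M] [IsManifold I ∞ M]

/-- A spin structure on the Riemannian manifold `(M, g)` of dimension `n`, given through local
sections and transition functions: a covering of `M` by open sets `baseSet α`, with smooth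
`g`-orthonormal frames `frame α` on them, and smooth maps `lift α β` from the overlaps into
`Spin(n)`, which satisfy the cocycle condition (so they define a principal `Spin(n)`-bundle)
and which are mapped by the two-fold covering `Spin(n) → SO(n)`, `s ↦ (v ↦ s v s⁻¹)`, to the
transition functions of the frames (so that this principal bundle doubly covers the bundle of
oriented orthonormal frames, for the orientation given by the frames). A function into the finite
dimensional space `Cl n` is smooth if its composites with all linear functionals are. -/
structure SpinStructure (g : SmoothMetric I M) (n : ℕ) where
  Index : Type u
  baseSet : Index → Set M
  isOpen_baseSet : ∀ α, IsOpen (baseSet α)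
  indexAt : M → Index
  mem_baseSet_at : ∀ x, x ∈ baseSet (indexAt x)
  frame : Index → Fin n → (x : M) → TangentSpace I x
  isLocalFrameOn : ∀ α, IsLocalFrameOn I E ∞ (frame α) (baseSet α)
  orthonormal : ∀ α, ∀ x ∈ baseSet α, ∀ a b,
    g.inner x (frame α a x) (frame α b x) = if a = b then 1 else 0
  lift : Index → Index → M → Spin n
  lift_smooth : ∀ α β, ∀ φ : Cl n →ₗ[ℝ] ℝ,
    ContMDiffOn I 𝓘(ℝ, ℝ) ∞ (fun x => φ (lift α β x)) (baseSet α ∩ baseSet β)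
  lift_cocycle : ∀ α β γ, ∀ x ∈ baseSet α ∩ baseSet β ∩ baseSet γ,
    lift α β x * lift β γ x = lift α γ x
  lift_covers : ∀ α β, ∀ x ∈ baseSet α ∩ baseSet β, ∀ b,
    (lift α β x : Cl n) * clE b * ((lift α β x)⁻¹ : Spin n) =
      ∑ a, g.inner x (frame α a x) (frame β b x) • clE a

namespace SpinStructure

variable {I} {g : SmoothMetric I M} {n : ℕ} (σ : SpinStructure I g n)
  {V : Type v} [NormedAddCommGroup V] [NormedSpace ℂ V] [FiniteDimensional ℂ V] (ρ : ClRep n V)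

theorem lift_self (α : σ.Index) (x : M) (hx : x ∈ σ.baseSet α) : σ.lift α α x = 1 :=
  mul_eq_left.1 (σ.lift_cocycle α α α x ⟨⟨hx, hx⟩, hx⟩)

theorem continuousOn_rep (α β : σ.Index) :
    ContinuousOn (fun x => LinearMap.toContinuousLinearMap (ρ (σ.lift α β x : Cl n)))
      (σ.baseSet α ∩ σ.baseSet β) := by
  have : FiniteDimensional ℝ (V →L[ℂ] V) := FiniteDimensional.complexToReal _
  let b := Module.finBasis ℝ (V →L[ℂ] V)
  let L : Cl n →ₗ[ℝ] (V →L[ℂ] V) :=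
    ((LinearMap.toContinuousLinearMap : (V →ₗ[ℂ] V) ≃ₗ[ℂ] _).toLinearMap.restrictScalars ℝ).comp
      ρ.toLinearMap
  have h : ContinuousOn (fun x => b.equivFun (L (σ.lift α β x : Cl n)))
      (σ.baseSet α ∩ σ.baseSet β) := by
    rw [continuousOn_pi]
    intro j
    exact (σ.lift_smooth α β ((LinearMap.proj j).comp (b.equivFun.toLinearMap.comp L))).continuousOn
  have h' := (LinearMap.continuous_of_finiteDimensional b.equivFun.symm.toLinearMap).comp_continuousOn h
  refine h'.congr fun x _ => ?_
  simp [L]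

/-- The spinor bundle: the vector bundle associated to the principal `Spin(n)`-bundle of the spin
structure by the representation of `Spin(n)` on a Clifford module. The coordinates `ξ_α`, `ξ_β`
of a spinor for the sections number `α` and `β` are related by `ξ_β = ρ (lift β α) ξ_α`. -/
def spinorBundle : VectorBundleCore ℂ M V σ.Index where
  baseSet := σ.baseSet
  isOpen_baseSet := σ.isOpen_baseSet
  indexAt := σ.indexAt
  mem_baseSet_at := σ.mem_baseSet_at
  coordChange α β x := LinearMap.toContinuousLinearMap (ρ (σ.lift β α x : Cl n))
  coordChange_self α x hx ξ := by simp [σ.lift_self α x hx]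
  continuousOn_coordChange α β := by
    rw [Set.inter_comm]
    exact σ.continuousOn_rep ρ β α
  coordChange_comp α β γ x hx ξ := by
    have h := σ.lift_cocycle γ β α x ⟨⟨hx.2, hx.1.2⟩, hx.1.1⟩
    simp [← h]

/-- The coordinates of a tangent vector in the preferred orthonormal frame at `x`. -/
def frameCoord (x : M) (X : TangentSpace I x) : Fin n → ℝ :=
  fun a => g.inner x (σ.frame (σ.indexAt x) a x) X

/-- Clifford multiplication of tangent vectors and spinors. The fibre of the spinor bundle at `x`
is the spinor module itself, through the preferred section at `x`. -/
def cliffordMul (x : M) (X : TangentSpace I x) :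
    (σ.spinorBundle ρ).Fiber x →ₗ[ℂ] (σ.spinorBundle ρ).Fiber x :=
  (ρ (clVec (σ.frameCoord x X)) : V →ₗ[ℂ] V)

end SpinStructure

end SpinStructure

/-! ### Operations on vector bundles given by coordinate changes -/

namespace VectorBundleCore

variable {B : Type*} [TopologicalSpace B] {F F' : Type*} [NormedAddCommGroup F] [NormedSpace ℂ F]
  [NormedAddCommGroup F'] [NormedSpace ℂ F'] {ι : Type*}

/-- The subbundle with standard fibre `U`, for a subspace `U` of the standard fibre that is
invariant under all coordinate changes. -/
def sub (Z : VectorBundleCore ℂ B F ι) (U : Submodule ℂ F)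
    (hU : ∀ i j x, ∀ ξ ∈ U, Z.coordChange i j x ξ ∈ U) : VectorBundleCore ℂ B U ι where
  baseSet := Z.baseSet
  isOpen_baseSet := Z.isOpen_baseSet
  indexAt := Z.indexAt
  mem_baseSet_at := Z.mem_baseSet_at
  coordChange i j x := (Z.coordChange i j x).restrict (hU i j x)
  coordChange_self i x hx ξ := Subtype.ext (Z.coordChange_self i x hx ξ)
  continuousOn_coordChange i j := by
    have hi : Isometry fun f : U →L[ℂ] U => U.subtypeL.comp f :=
      AddMonoidHomClass.isometry_of_norm (ContinuousLinearMap.compL ℂ U U F U.subtypeL)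
        fun f => U.subtypeₗᵢ.norm_toContinuousLinearMap_comp
    rw [hi.isEmbedding.isInducing.continuousOn_iff]
    exact ((ContinuousLinearMap.compL ℂ U F F).flip U.subtypeL).continuous.comp_continuousOn
      (Z.continuousOn_coordChange i j)
  coordChange_comp i j k x hx ξ := Subtype.ext (Z.coordChange_comp i j k x hx ξ)

theorem sub_baseSet (Z : VectorBundleCore ℂ B F ι) (U : Submodule ℂ F)
    (hU : ∀ i j x, ∀ ξ ∈ U, Z.coordChange i j x ξ ∈ U) : (Z.sub U hU).baseSet = Z.baseSet :=
  rfl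

/-- The direct sum of two bundles given over the same covering. -/
def directSum (Z : VectorBundleCore ℂ B F ι) (Z' : VectorBundleCore ℂ B F' ι)
    (h : Z'.baseSet = Z.baseSet) : VectorBundleCore ℂ B (F × F') ι where
  baseSet := Z.baseSet
  isOpen_baseSet := Z.isOpen_baseSet
  indexAt := Z.indexAt
  mem_baseSet_at := Z.mem_baseSet_at
  coordChange i j x := (Z.coordChange i j x).prodMap (Z'.coordChange i j x)
  coordChange_self i x hx ξ :=
    Prod.ext (Z.coordChange_self i x hx ξ.1) (Z'.coordChange_self i x (h ▸ hx) ξ.2)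
  continuousOn_coordChange i j :=
    (Z.continuousOn_coordChange i j).prod_mapL ℂ (h ▸ Z'.continuousOn_coordChange i j)
  coordChange_comp i j k x hx ξ :=
    Prod.ext (Z.coordChange_comp i j k x hx ξ.1) (Z'.coordChange_comp i j k x (h ▸ hx) ξ.2)


end VectorBundleCore

/-- The projective norm on a tensor product of finite dimensional spaces is a norm. -/
theorem piTensor_eq_zero {κ : Type*} [Fintype κ] {F : κ → Type*} [∀ i, NormedAddCommGroup (F i)]
    [∀ i, NormedSpace ℂ (F i)] [∀ i, FiniteDimensional ℂ (F i)] (t : ⨂[ℂ] i, F i)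
    (ht : ‖t‖ = 0) : t = 0 := by
  let b := fun i => Module.finBasis ℂ (F i)
  refine (Basis.piTensorProduct b).ext_elem fun p => ?_
  let f : ContinuousMultilinearMap ℂ F ℂ :=
    (ContinuousMultilinearMap.mkPiAlgebra ℂ κ ℂ).compContinuousLinearMap
      fun i => LinearMap.toContinuousLinearMap ((b i).coord (p i))
  have h1 : PiTensorProduct.lift f.toMultilinearMap t = 0 := by
    have := PiTensorProduct.norm_eval_le_projectiveSeminorm f t
    rw [ht, mul_zero] at this
    exact norm_le_zero_iff.1 this
  have h2 : (Basis.piTensorProduct b).coord p = PiTensorProduct.lift f.toMultilinearMap := by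
    ext x
    simp [f]
  have h3 := LinearMap.congr_fun h2 t
  rw [h1] at h3
  simpa using h3

instance piTensorNormed {κ : Type*} [Fintype κ] {F : κ → Type*} [∀ i, NormedAddCommGroup (F i)]
    [∀ i, NormedSpace ℂ (F i)] [∀ i, FiniteDimensional ℂ (F i)] :
    NormedAddCommGroup (⨂[ℂ] i, F i) :=
  fast_instance% NormedAddCommGroup.ofSeparation piTensor_eq_zero

/-- The tensor product `⨂ i, pᵢ^* Zᵢ` over a finite product `∏ i, B i` of the pullbacks of vector
bundles `Zᵢ` over the factors along the projections `pᵢ`. -/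
def VectorBundleCore.tensor {κ : Type*} [Fintype κ] {B : κ → Type*} [∀ i, TopologicalSpace (B i)]
    {F : κ → Type*} [∀ i, NormedAddCommGroup (F i)] [∀ i, NormedSpace ℂ (F i)]
    [∀ i, FiniteDimensional ℂ (F i)] {ι : κ → Type*}
    (Z : ∀ i, VectorBundleCore ℂ (B i) (F i) (ι i)) :
    VectorBundleCore ℂ (∀ i, B i) (⨂[ℂ] i, F i) (∀ i, ι i) where
  baseSet α := Set.univ.pi fun i => (Z i).baseSet (α i)
  isOpen_baseSet α := isOpen_set_pi Set.finite_univ fun i _ => (Z i).isOpen_baseSet (α i)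
  indexAt x := fun i => (Z i).indexAt (x i)
  mem_baseSet_at x := fun i _ => (Z i).mem_baseSet_at (x i)
  coordChange α β x := PiTensorProduct.mapL fun i => (Z i).coordChange (α i) (β i) (x i)
  coordChange_self α x hx ξ := by
    have h : (fun i => (Z i).coordChange (α i) (α i) (x i)) =
        fun i => ContinuousLinearMap.id ℂ (F i) := by
      funext i
      ext v
      exact (Z i).coordChange_self (α i) (x i) (hx i trivial) v
    rw [h, PiTensorProduct.mapL_id]
    rfl
  continuousOn_coordChange α β := by
    refine (PiTensorProduct.mapLMultilinear ℂ F F).cont.comp_continuousOn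
      (continuousOn_pi.2 fun i => ?_)
    refine ((Z i).continuousOn_coordChange (α i) (β i)).comp (continuous_apply i).continuousOn ?_
    exact fun x hx => ⟨hx.1 i trivial, hx.2 i trivial⟩
  coordChange_comp α β γ x hx ξ := by
    have h : (fun i => (Z i).coordChange (α i) (γ i) (x i)) =
        fun i => ((Z i).coordChange (β i) (γ i) (x i)).comp
          ((Z i).coordChange (α i) (β i) (x i)) := by
      funext i
      ext v
      exact ((Z i).coordChange_comp (α i) (β i) (γ i) (x i)
        ⟨⟨hx.1.1 i trivial, hx.1.2 i trivial⟩, hx.2 i trivial⟩ v).symm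
    rw [h, PiTensorProduct.mapL_comp]
    rfl

/-- A smooth isomorphism of complex vector bundles over a real manifold: a family of complex linear
isomorphisms of the fibres, smooth together with its inverse as a map of the total spaces. -/
structure SmoothBundleIso {E : Type*} [NormedAddCommGroup E] [NormedSpace ℝ E] {H : Type*}
    [TopologicalSpace H] (I : ModelWithCorners ℝ E H) {B : Type*} [TopologicalSpace B]
    [ChartedSpace H B] {F F' : Type*} [NormedAddCommGroup F] [NormedSpace ℂ F]
    [NormedAddCommGroup F'] [NormedSpace ℂ F'] {ι ι' : Type*}
    (Z : VectorBundleCore ℂ B F ι) (Z' : VectorBundleCore ℂ B F' ι') where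
  fiberEquiv : ∀ x, Z.Fiber x ≃ₗ[ℂ] Z'.Fiber x
  smooth : ContMDiff (I.prod 𝓘(ℝ, F)) (I.prod 𝓘(ℝ, F')) ∞
    fun p : TotalSpace F Z.Fiber => TotalSpace.mk' F' (E := Z'.Fiber) p.1 (fiberEquiv p.1 p.2)
  smooth_symm : ContMDiff (I.prod 𝓘(ℝ, F')) (I.prod 𝓘(ℝ, F)) ∞
    fun p : TotalSpace F' Z'.Fiber =>
      TotalSpace.mk' F (E := Z.Fiber) p.1 ((fiberEquiv p.1).symm p.2)

/-! ### The grading of spinors -/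

namespace ClRep

variable {n : ℕ} {V : Type v} [NormedAddCommGroup V] [NormedSpace ℂ V] (ρ : ClRep n V)

/-- The product of the standard basis vectors. -/
def volumeElement (n : ℕ) : Cl n := (List.ofFn fun a : Fin n => clE a).prod

theorem clE_sq_swap (a b : Fin n) (h : a ≠ b) : clE a * clE b = -(clE b * clE a) := by
  refine CliffordAlgebra.ι_mul_ι_comm_of_isOrtho ?_
  rw [QuadraticMap.isOrtho_def]
  simp only [negEuclid, QuadraticMap.weightedSumSquares_apply, Pi.add_apply, smul_eq_mul,
    ← Finset.sum_add_distrib]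
  refine Finset.sum_congr rfl fun c _ => ?_
  by_cases hc : c = a
  · subst hc
    simp [h]
  · simp [Pi.single_apply, hc]

theorem clE_mul_prod (a : Fin n) (l : List (Fin n)) (hl : l.Nodup) :
    clE a * (l.map clE).prod =
      ((-1 : ℝ) ^ l.length * if a ∈ l then -1 else 1) • ((l.map clE).prod * clE a) := by
  induction l with
  | nil => simp
  | cons b t ih =>
    have ht := ih (List.nodup_cons.1 hl).2
    by_cases hab : a = b
    · subst hab
      have hn : a ∉ t := (List.nodup_cons.1 hl).1
      simp only [hn, if_false, mul_one] at ht
      simp only [List.map_cons, List.prod_cons, List.length_cons, List.mem_cons, true_or, if_true]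
      rw [mul_assoc (clE a) _ (clE a)]
      conv_lhs => rw [ht, mul_smul_comm]
      congr 1
      ring
    · simp only [List.map_cons, List.prod_cons, List.length_cons, List.mem_cons, hab, false_or]
      rw [← mul_assoc, clE_sq_swap a b hab, neg_mul, mul_assoc, ht, mul_smul_comm, mul_assoc,
        ← neg_smul]
      congr 1
      ring

/-- In even dimension the volume element anticommutes with vectors. -/
theorem volume_anticomm (hn : Even n) (v : Fin n → ℝ) :
    volumeElement n * clVec v = -(clVec v * volumeElement n) := by
  have h : ∀ a, clE a * volumeElement n = -(volumeElement n * clE a) := by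
    intro a
    have := clE_mul_prod a (List.finRange n) (List.nodup_finRange n)
    simp only [List.length_finRange, hn.neg_one_pow, List.mem_finRange, if_true, one_mul,
      neg_smul, one_smul] at this
    rwa [volumeElement, List.ofFn_eq_map]
  have hv : clVec v = ∑ a, v a • clE a := by
    conv_lhs => rw [pi_eq_sum_univ' v]
    simp [clVec, map_sum]
  rw [hv, Finset.mul_sum, Finset.sum_mul, ← Finset.sum_neg_distrib]
  refine Finset.sum_congr rfl fun a _ => ?_
  rw [smul_mul_assoc, h, mul_smul_comm, smul_neg, neg_neg]

theorem volume_comm_even (hn : Even n) (s : Cl n) (hs : s ∈ CliffordAlgebra.even (negEuclid n)) :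
    volumeElement n * s = s * volumeElement n := by
  refine CliffordAlgebra.even_induction (Q := negEuclid n)
    (motive := fun s _ => volumeElement n * s = s * volumeElement n) ?_ ?_ ?_ s hs
  · exact fun r => (Algebra.commutes r _).symm
  · intro x y _ _ hx hy
    rw [mul_add, add_mul, hx, hy]
  · intro v w x _ hx
    calc volumeElement n * (clVec v * clVec w * x)
        = volumeElement n * clVec v * clVec w * x := by noncomm_ring
      _ = -(clVec v * (volumeElement n * clVec w) * x) := by
          rw [volume_anticomm hn]; noncomm_ring
      _ = clVec v * clVec w * (volumeElement n * x) := by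
          rw [volume_anticomm hn]; noncomm_ring
      _ = clVec v * clVec w * x * volumeElement n := by rw [hx]; noncomm_ring

/-- The complex volume element `i^(n/2) e₁ ⋯ eₙ`; for even `n` its square is `1`. -/
def chirality : Module.End ℂ V := (Complex.I ^ (n / 2)) • ρ (volumeElement n)

/-- The halves `V⁺` (for `s = 1`) and `V⁻` (for `s = -1`) of a spinor module `V`. In even dimension
they are the eigenspaces of the complex volume element. In odd dimension the spinor module is
doubled, and both halves are copies of `V` itself. -/
def half (s : ℂ) : Submodule ℂ V :=
  if Even n then Module.End.eigenspace ρ.chirality s else ⊤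

theorem spin_mem_half (s : ℂ) (a : Spin n) (ξ : V) (hξ : ξ ∈ ρ.half s) :
    ρ (a : Cl n) ξ ∈ ρ.half s := by
  unfold half at *
  split_ifs with hn
  · rw [if_pos hn, Module.End.mem_eigenspace_iff] at hξ
    rw [Module.End.mem_eigenspace_iff]
    have h := congrArg ρ (volume_comm_even hn a (spinGroup.mem_even a.2))
    rw [map_mul, map_mul] at h
    have h' := LinearMap.congr_fun h ξ
    simp only [Module.End.mul_apply] at h'
    simp only [chirality, LinearMap.smul_apply] at hξ ⊢
    rw [h', ← map_smul, hξ, map_smul]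
  · trivial

theorem vec_mem_half (s t : ℂ) (hst : t = -s) (v : Fin n → ℝ) (ξ : V) (hξ : ξ ∈ ρ.half s) :
    ρ (clVec v) ξ ∈ ρ.half t := by
  subst hst
  unfold half at *
  split_ifs with hn
  · rw [if_pos hn, Module.End.mem_eigenspace_iff] at hξ
    rw [Module.End.mem_eigenspace_iff]
    have h := congrArg ρ (volume_anticomm hn v)
    rw [map_neg, map_mul, map_mul] at h
    have h' := LinearMap.congr_fun h ξ
    simp only [Module.End.mul_apply, LinearMap.neg_apply] at h'
    simp only [chirality, LinearMap.smul_apply] at hξ ⊢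
    rw [h', smul_neg, ← map_smul, hξ, map_smul, neg_smul]
  · trivial

/-- The standard fibre `V⁺ ⊕ V⁻` of `S⁺ ⊕ S⁻`. -/
def Graded : Type v := ρ.half 1 × ρ.half (-1)

instance : NormedAddCommGroup ρ.Graded :=
  inferInstanceAs (NormedAddCommGroup (ρ.half 1 × ρ.half (-1)))

instance : NormedSpace ℂ ρ.Graded :=
  inferInstanceAs (NormedSpace ℂ (ρ.half 1 × ρ.half (-1)))

instance [FiniteDimensional ℂ V] : FiniteDimensional ℂ ρ.Graded :=
  inferInstanceAs (FiniteDimensional ℂ (ρ.half 1 × ρ.half (-1)))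

/-- The components of an element of `V⁺ ⊕ V⁻`. -/
def toProd : ρ.Graded ≃ₗ[ℂ] ρ.half 1 × ρ.half (-1) :=
  LinearEquiv.refl ℂ (ρ.half 1 × ρ.half (-1))

/-- The action of a vector on `V⁺ ⊕ V⁻`, namely `(ξ⁺, ξ⁻) ↦ (v ξ⁻, v ξ⁺)`. -/
def gradedVec (v : Fin n → ℝ) : ρ.Graded →ₗ[ℂ] ρ.Graded :=
  ρ.toProd.symm.conj <| LinearMap.prod
    (((ρ (clVec v)).restrict (ρ.vec_mem_half (-1) 1 (neg_neg 1).symm v)).comp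
      (LinearMap.snd ℂ _ _))
    (((ρ (clVec v)).restrict (ρ.vec_mem_half 1 (-1) rfl v)).comp (LinearMap.fst ℂ _ _))

/-- The parity `(ξ⁺, ξ⁻) ↦ (ξ⁺, -ξ⁻)`. -/
def parity : ρ.Graded →ₗ[ℂ] ρ.Graded :=
  ρ.toProd.symm.conj <| LinearMap.prodMap LinearMap.id (-LinearMap.id)

/-- The diagonal of `V⁺ ⊕ V⁻` (where both are copies of `V`). -/
def diagonal : Submodule ℂ ρ.Graded where
  carrier := {ξ | ((ρ.toProd ξ).1 : V) = (ρ.toProd ξ).2}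
  add_mem' {ξ η} h h' := by simp_all
  zero_mem' := by simp
  smul_mem' c ξ h := by simp_all

end ClRep

/-! ### The bundles `W` and `S` over the product -/

section GradedSpinors

variable {E : Type*} [NormedAddCommGroup E] [NormedSpace ℝ E] {H : Type*} [TopologicalSpace H]
  {I : ModelWithCorners ℝ E H} {M : Type u} [TopologicalSpace M] [ChartedSpace H M]
  [IsManifold I ∞ M] {g : SmoothMetric I M} {n : ℕ} (σ : SpinStructure I g n)
  {V : Type v} [NormedAddCommGroup V] [NormedSpace ℂ V] [FiniteDimensional ℂ V] (ρ : ClRep n V)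

/-- The bundle `S⁺` (for `s = 1`) or `S⁻` (for `s = -1`), where `S` is the spinor bundle. -/
def SpinStructure.halfSpinorBundle (s : ℂ) : VectorBundleCore ℂ M (ρ.half s) σ.Index :=
  (σ.spinorBundle ρ).sub (ρ.half s) fun α β x => ρ.spin_mem_half s (σ.lift β α x)

/-- The bundle `S⁺ ⊕ S⁻`. -/
def SpinStructure.gradedSpinorBundle : VectorBundleCore ℂ M ρ.Graded σ.Index :=
  VectorBundleCore.directSum (σ.halfSpinorBundle ρ 1) (σ.halfSpinorBundle ρ (-1))
    ((VectorBundleCore.sub_baseSet _ _ _).trans (VectorBundleCore.sub_baseSet _ _ _).symm)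

end GradedSpinors

section Product

variable {N : ℕ} {D : Fin N → ℕ} {M : Fin N → Type u} [∀ i, TopologicalSpace (M i)]
  [∀ i, ChartedSpace (EuclideanSpace ℝ (Fin (D i))) (M i)]

/-- The differential of the projection onto the factor number `i`. It is the projection onto the
summand number `i` of the tangent space of the product. -/
def tangentProj (x : ∀ i, M i) (i : Fin N) :
    TangentSpace (prodModel D) x →L[ℝ] TangentSpace (𝓡 (D i)) (x i) :=
  mfderiv (prodModel D) (𝓡 (D i)) (fun y : ∀ i, M i => y i) x

variable [∀ i, IsManifold (𝓡 (D i)) ∞ (M i)] {g : ∀ i, SmoothMetric (𝓡 (D i)) (M i)}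
  (σ : ∀ i, SpinStructure (𝓡 (D i)) (g i) (D i))
  {V : Fin N → Type v} [∀ i, NormedAddCommGroup (V i)] [∀ i, NormedSpace ℂ (V i)]
  [∀ i, FiniteDimensional ℂ (V i)] (ρ : ∀ i, ClRep (D i) (V i))

/-- The bundle `W = (S₁⁺ ⊕ S₁⁻) ⊗ ⋯ ⊗ (S_N⁺ ⊕ S_N⁻)` over the product. -/
def bundleW : VectorBundleCore ℂ (∀ i, M i) (⨂[ℂ] i, (ρ i).Graded) (∀ i, (σ i).Index) :=
  VectorBundleCore.tensor fun i => (σ i).gradedSpinorBundle (ρ i)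

/-- The standard fibre of `S`: inside the standard fibre of `W`, the tensor product of the diagonals
of the factors with number in `K` and of all the other factors `Sᵢ⁺ ⊕ Sᵢ⁻`. -/
def fiberS (K : Finset (Fin N)) : Submodule ℂ (⨂[ℂ] i, (ρ i).Graded) :=
  Submodule.span ℂ {t | ∃ ξ : ∀ i, (ρ i).Graded,
    (∀ k ∈ K, ξ k ∈ (ρ k).diagonal) ∧ PiTensorProduct.tprod ℂ ξ = t}

theorem coordChange_mem_fiberS (K : Finset (Fin N)) (α β : ∀ i, (σ i).Index) (x : ∀ i, M i)
    (t : ⨂[ℂ] i, (ρ i).Graded) (ht : t ∈ fiberS ρ K) :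
    (bundleW σ ρ).coordChange α β x t ∈ fiberS ρ K := by
  suffices h : fiberS ρ K ≤
      (fiberS ρ K).comap ((bundleW σ ρ).coordChange α β x).toLinearMap from h ht
  refine Submodule.span_le.2 ?_
  rintro _ ⟨ξ, hξ, rfl⟩
  refine Submodule.subset_span ⟨fun i => ((σ i).gradedSpinorBundle (ρ i)).coordChange
    (α i) (β i) (x i) (ξ i), fun k hk => ?_, ?_⟩
  · exact congrArg (ρ k ((σ k).lift (β k) (α k) (x k) : Cl (D k))) (hξ k hk)
  · exact (PiTensorProduct.map_tprod _ _).symm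

/-- The subbundle `S` of `W` in which the factors with number in `K` are diagonalized. -/
def bundleS (K : Finset (Fin N)) :
    VectorBundleCore ℂ (∀ i, M i) (fiberS ρ K) (∀ i, (σ i).Index) :=
  (bundleW σ ρ).sub (fiberS ρ K) (coordChange_mem_fiberS σ ρ K)

/-- The inclusion of `S` into `W`. -/
def inclS (K : Finset (Fin N)) (x : ∀ i, M i) :
    (bundleS σ ρ K).Fiber x →ₗ[ℂ] (bundleW σ ρ).Fiber x :=
  (fiberS ρ K).subtype

/-- Clifford multiplication on `W`: the tangent vector `X = X₁ + ⋯ + X_N` maps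
`ξ₁ ⊗ ⋯ ⊗ ξ_N` with `ξⱼ` of degree `εⱼ` to
`∑ i, (-1)^(ε₁ + ⋯ + ε_{i-1}) ξ₁ ⊗ ⋯ ⊗ (Aᵢ Xᵢ) ξᵢ ⊗ ⋯ ⊗ ξ_N`. -/
def cliffordMulW
    (A : ∀ i, ∀ x : (∀ i, M i), TangentSpace (𝓡 (D i)) (x i) →L[ℝ] TangentSpace (𝓡 (D i)) (x i))
    (x : ∀ i, M i) (X : TangentSpace (prodModel D) x) :
    (bundleW σ ρ).Fiber x →ₗ[ℂ] (bundleW σ ρ).Fiber x :=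
  (∑ i, PiTensorProduct.map fun j =>
      if j < i then (ρ j).parity
      else if j = i then
        (ρ j).gradedVec ((σ j).frameCoord (x j) (A j x (tangentProj x j X)))
      else LinearMap.id : (⨂[ℂ] i, (ρ i).Graded) →ₗ[ℂ] ⨂[ℂ] i, (ρ i).Graded)

end Product

end

/-!
The even products `X · Y` of vectors tangent to the same factor generate, up to scalars, a system of
pairwise commuting or anticommuting square roots of `-1`. The modules over such a system are
determined by their dimension, and for `|K| = N_o - ⌊N_o / 2⌋` the fibre of `S` has the dimension of
a spinor module of `ℝ ^ D`; so there is an isomorphism `Ψ` of the spinor module with the fibre of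
`S` that is equivariant under the even Clifford algebras of all the factors, hence under
`Spin(D₁) × ⋯ × Spin(D_N)`. The products of local sections of the spin structures of the factors
form a spin structure on the product, and `Ψ` identifies its spinor bundle with `S`.

Any other spin structure on the product has an isomorphic spinor bundle. Two orthonormal frames
differ by an orthogonal map, whose lifts to `Pin(D)` are the fixed points of unit norm of an
averaging operator; this operator depends smoothly on the frames, so that smooth lifts exist locally
and are unique up to a sign. The signs on the overlaps form a cocycle, which is trivial because the
product is simply connected, and the adjusted lifts act by the isomorphism.
-/

noncomputable section

/-! ### Systems of commuting and anticommuting square roots of `-1` -/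

section SignAverage

variable (𝕜 : Type*) [Field 𝕜] {A Gen : Type*} [AddCommGroup A] [Module 𝕜 A]

/-- The composite of the operators `(1 + T t) / 2`. If the `T t` are commuting involutions, this is
the average over the group that they generate. -/
def signAverage (T : Gen → Module.End 𝕜 A) (l : List Gen) : Module.End 𝕜 A :=
  (l.map fun t => (2⁻¹ : 𝕜) • (1 + T t)).prod

variable {𝕜} {T : Gen → Module.End 𝕜 A}

theorem signAverage_cons (t : Gen) (l : List Gen) (y : A) :
    signAverage 𝕜 T (t :: l) y =
      (2⁻¹ : 𝕜) • (signAverage 𝕜 T l y + T t (signAverage 𝕜 T l y)) := by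
  simp [signAverage]

theorem signAverage_eq_self [NeZero (2 : 𝕜)] {l : List Gen} {y : A} (h : ∀ t ∈ l, T t y = y) :
    signAverage 𝕜 T l y = y := by
  induction l with
  | nil => simp [signAverage]
  | cons t l ih =>
    rw [List.forall_mem_cons] at h
    rw [signAverage_cons, ih h.2, h.1, ← two_smul 𝕜, inv_smul_smul₀ (NeZero.ne _)]

theorem signAverage_eq_zero [NeZero (2 : 𝕜)] {l : List Gen} {y : A}
    (h : ∀ t ∈ l, T t y = y ∨ T t y = -y) (hneg : ∃ t ∈ l, T t y = -y) :
    signAverage 𝕜 T l y = 0 := by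
  induction l with
  | nil => simp at hneg
  | cons t l ih =>
    rw [List.forall_mem_cons] at h
    rw [signAverage_cons]
    by_cases hl : ∃ s ∈ l, T s y = -y
    · simp [ih h.2 hl]
    · have hfix : signAverage 𝕜 T l y = y :=
        signAverage_eq_self fun s hs => (h.2 s hs).resolve_right fun hs' => hl ⟨s, hs, hs'⟩
      have ht : T t y = -y := by
        obtain ⟨s, hs, hs'⟩ := hneg
        rcases List.mem_cons.1 hs with rfl | hs
        exacts [hs', absurd ⟨s, hs, hs'⟩ hl]
      rw [hfix, ht, add_neg_cancel, smul_zero]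

end SignAverage

/-- Square roots `x s` of `-1` in a ring, which commute up to the signs `b s t`. -/
structure IsPauliSystem {Gen A : Type*} [Ring A] (x : Gen → A) (b : Gen → Gen → ℤˣ) : Prop where
  mul_self : ∀ s, x s * x s = -1
  mul_swap : ∀ s t, x s * x t = b s t • (x t * x s)

/-- The signs `b` are nondegenerate if no nontrivial product of generators commutes with all the
generators. -/
def IsNondegenerateSign {Gen : Type*} (b : Gen → Gen → ℤˣ) : Prop :=
  ∀ I : Finset Gen, I.Nonempty → ∃ t, ∏ s ∈ I, b t s = -1

/-- The product of the `x s`, `s ∈ I`, in an arbitrarily chosen order. -/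
def finsetWord {Gen A : Type*} [Ring A] (x : Gen → A) (I : Finset Gen) : A :=
  (I.toList.map x).prod

@[simp]
theorem finsetWord_empty {Gen A : Type*} [Ring A] (x : Gen → A) : finsetWord x ∅ = 1 := by
  simp [finsetWord]

namespace IsPauliSystem

variable {Gen A : Type*} [Ring A] {x : Gen → A} {b : Gen → Gen → ℤˣ}

theorem map {B : Type*} [Ring B] (h : IsPauliSystem x b) (f : A →+* B) :
    IsPauliSystem (fun s => f (x s)) b where
  mul_self s := by rw [← map_mul, h.mul_self, map_neg, map_one]
  mul_swap s t := by
    rw [← map_mul, ← map_mul, h.mul_swap s t]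
    rcases Int.units_eq_one_or (b s t) with hb | hb <;> simp [hb]

theorem mul_prod (h : IsPauliSystem x b) (t : Gen) (l : List Gen) :
    x t * (l.map x).prod = (l.map (b t)).prod • ((l.map x).prod * x t) := by
  induction l with
  | nil => simp
  | cons s l ih =>
    simp only [List.map_cons, List.prod_cons]
    rw [← mul_assoc, h.mul_swap t s, smul_mul_assoc, mul_assoc, ih, mul_smul_comm, mul_assoc,
      mul_smul]

theorem exists_prod_eq_of_perm (h : IsPauliSystem x b) {l l' : List Gen} (hl : l.Perm l') :
    ∃ u : ℤˣ, (l.map x).prod = u • (l'.map x).prod := by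
  induction hl with
  | nil => exact ⟨1, by simp⟩
  | cons s _ ih =>
    obtain ⟨u, hu⟩ := ih
    exact ⟨u, by simp [hu, mul_smul_comm]⟩
  | swap s t l =>
    refine ⟨b t s, ?_⟩
    simp only [List.map_cons, List.prod_cons, ← mul_assoc]
    rw [h.mul_swap t s, smul_mul_assoc]
  | trans _ _ ih ih' =>
    obtain ⟨u, hu⟩ := ih
    obtain ⟨u', hu'⟩ := ih'
    exact ⟨u * u', by rw [hu, hu', mul_smul]⟩

theorem mul_finsetWord (h : IsPauliSystem x b) (t : Gen) (I : Finset Gen) :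
    x t * finsetWord x I = (∏ s ∈ I, b t s) • (finsetWord x I * x t) := by
  rw [finsetWord, h.mul_prod, Finset.prod_map_toList]

section DecidableEq

variable [DecidableEq Gen]

theorem exists_finsetWord_insert (h : IsPauliSystem x b) {t : Gen} {I : Finset Gen} (ht : t ∉ I) :
    ∃ u : ℤˣ, finsetWord x (insert t I) = u • (x t * finsetWord x I) :=
  h.exists_prod_eq_of_perm (Finset.toList_insert ht)

theorem exists_mul_finsetWord (h : IsPauliSystem x b) (t : Gen) (I : Finset Gen) :
    ∃ u : ℤˣ, x t * finsetWord x I = u • finsetWord x (symmDiff {t} I) := by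
  by_cases ht : t ∈ I
  · obtain ⟨u, hu⟩ := h.exists_finsetWord_insert (Finset.notMem_erase t I)
    rw [Finset.insert_erase ht] at hu
    refine ⟨-u, ?_⟩
    have hI : symmDiff {t} I = I.erase t := by ext s; simp [Finset.mem_symmDiff]; grind
    rw [hu, mul_smul_comm, ← mul_assoc, h.mul_self, hI, neg_one_mul, smul_neg, Units.neg_smul]
  · obtain ⟨u, hu⟩ := h.exists_finsetWord_insert ht
    refine ⟨u⁻¹, ?_⟩
    have hI : symmDiff {t} I = insert t I := by ext s; simp [Finset.mem_symmDiff]; grind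
    rw [hI, hu, inv_smul_smul]

theorem exists_finsetWord_mul_finsetWord (h : IsPauliSystem x b) (I J : Finset Gen) :
    ∃ u : ℤˣ, finsetWord x I * finsetWord x J = u • finsetWord x (symmDiff I J) := by
  induction I using Finset.induction_on with
  | empty => exact ⟨1, by rw [finsetWord_empty, one_mul, one_smul, ← Finset.bot_eq_empty,
      bot_symmDiff]⟩
  | insert t I ht ih =>
    obtain ⟨u, hu⟩ := ih
    obtain ⟨u₁, hu₁⟩ := h.exists_finsetWord_insert ht
    obtain ⟨u₂, hu₂⟩ := h.exists_mul_finsetWord t (symmDiff I J)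
    have hI : symmDiff (insert t I) J = symmDiff {t} (symmDiff I J) := by
      ext s; simp [Finset.mem_symmDiff]; grind
    refine ⟨u₁ * u * u₂, ?_⟩
    rw [hu₁, smul_mul_assoc, mul_assoc, hu, mul_smul_comm, hu₂, hI, mul_smul, mul_smul]

end DecidableEq

section Span

variable {𝕜 : Type*} [Field 𝕜] [Algebra 𝕜 A]

theorem mem_span_finsetWord (h : IsPauliSystem x b) {y : A}
    (hy : y ∈ Algebra.adjoin 𝕜 (Set.range x)) :
    y ∈ Submodule.span 𝕜 (Set.range (finsetWord x)) := by
  classical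
  suffices hmul : ∀ z ∈ Submodule.span 𝕜 (Set.range (finsetWord x)),
      y * z ∈ Submodule.span 𝕜 (Set.range (finsetWord x)) by
    simpa using hmul 1 (Submodule.subset_span ⟨∅, finsetWord_empty x⟩)
  induction hy using Algebra.adjoin_induction with
  | mem y hy =>
    obtain ⟨t, rfl⟩ := hy
    refine fun z hz => Submodule.span_induction ?_ (by simp) (fun z w _ _ hz hw => ?_)
      (fun a z _ hz => ?_) hz
    · rintro _ ⟨I, rfl⟩
      obtain ⟨u, hu⟩ := h.exists_mul_finsetWord t I
      have hmem : finsetWord x (symmDiff {t} I) ∈ Submodule.span 𝕜 (Set.range (finsetWord x)) :=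
        Submodule.subset_span ⟨_, rfl⟩
      rcases Int.units_eq_one_or u with rfl | rfl <;> simpa [hu] using hmem
    · rw [mul_add]; exact add_mem hz hw
    · rw [mul_smul_comm]; exact Submodule.smul_mem _ _ hz
  | algebraMap a =>
    intro z hz
    rw [← Algebra.smul_def]
    exact Submodule.smul_mem _ _ hz
  | add y y' _ _ hy hy' =>
    intro z hz
    rw [add_mul]
    exact add_mem (hy z hz) (hy' z hz)
  | mul y y' _ _ hy hy' =>
    intro z hz
    rw [mul_assoc]
    exact hy _ (hy' z hz)

theorem span_finsetWord_eq_top (h : IsPauliSystem x b)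
    (htop : Algebra.adjoin 𝕜 (Set.range x) = ⊤) :
    Submodule.span 𝕜 (Set.range (finsetWord x)) = ⊤ :=
  eq_top_iff.2 fun _ _ => h.mem_span_finsetWord (htop ▸ trivial)

theorem finite_of_adjoin_eq_top [Finite Gen] (h : IsPauliSystem x b)
    (htop : Algebra.adjoin 𝕜 (Set.range x) = ⊤) : Module.Finite 𝕜 A :=
  ⟨Submodule.fg_def.2 ⟨_, Set.finite_range _, h.span_finsetWord_eq_top htop⟩⟩

end Span

section Nondegenerate

variable (𝕜 : Type*) [Field 𝕜] [Algebra 𝕜 A]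

/-- The average over the conjugations `y ↦ x t * y * (x t)⁻¹`. -/
def conjAverage [Fintype Gen] (x : Gen → A) : Module.End 𝕜 A :=
  signAverage 𝕜 (fun t => -LinearMap.mulLeftRight 𝕜 (x t, x t)) Finset.univ.toList

variable {𝕜} [Fintype Gen]

theorem conjAverage_mem (J : TwoSidedIdeal A) {y : A} (hy : y ∈ J) : conjAverage 𝕜 x y ∈ J := by
  rw [conjAverage]
  induction (Finset.univ : Finset Gen).toList with
  | nil => simpa [signAverage] using hy
  | cons t l ih =>
    rw [signAverage_cons, Algebra.smul_def]
    refine J.mul_mem_left _ _ (J.add_mem ih (J.neg_mem ?_))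
    exact J.mul_mem_right _ _ (J.mul_mem_left _ _ ih)

variable [NeZero (2 : 𝕜)]

theorem conjAverage_one (h : IsPauliSystem x b) : conjAverage 𝕜 x 1 = 1 := by
  refine signAverage_eq_self fun t _ => ?_
  simp [LinearMap.mulLeftRight_apply, h.mul_self]

theorem conjAverage_finsetWord (h : IsPauliSystem x b) (hb : IsNondegenerateSign b)
    {I : Finset Gen} (hI : I.Nonempty) : conjAverage 𝕜 x (finsetWord x I) = 0 := by
  have hconj : ∀ t, (-LinearMap.mulLeftRight 𝕜 (x t, x t)) (finsetWord x I) =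
      (∏ s ∈ I, b t s) • finsetWord x I := fun t => by
    rw [LinearMap.neg_apply, LinearMap.mulLeftRight_apply, h.mul_finsetWord, smul_mul_assoc,
      mul_assoc, h.mul_self, mul_neg_one, smul_neg, neg_neg]
  refine signAverage_eq_zero (fun t _ => ?_) ?_
  · rw [hconj]
    exact (Int.units_eq_one_or (∏ s ∈ I, b t s)).imp (by simp +contextual) (by simp +contextual)
  · obtain ⟨t, ht⟩ := hb I hI
    exact ⟨t, by simp, by simp [hconj, ht]⟩

-- Up to sign, this reads off the coefficient of the word of `J`.
theorem exists_conjAverage_sum_mul_finsetWord (h : IsPauliSystem x b)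
    (hb : IsNondegenerateSign b) (a : Finset Gen → 𝕜) (J : Finset Gen) :
    ∃ u : ℤˣ, conjAverage 𝕜 x ((∑ I, a I • finsetWord x I) * finsetWord x J) =
      u • algebraMap 𝕜 A (a J) := by
  classical
  obtain ⟨u, hu⟩ := h.exists_finsetWord_mul_finsetWord J J
  refine ⟨u, ?_⟩
  rw [Finset.sum_mul, map_sum, Finset.sum_eq_single J _ (by simp)]
  · rw [smul_mul_assoc, hu, symmDiff_self, Finset.bot_eq_empty, finsetWord_empty, map_smul]
    rcases Int.units_eq_one_or u with rfl | rfl <;>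
      simp [h.conjAverage_one, Algebra.algebraMap_eq_smul_one]
  · intro I _ hIJ
    obtain ⟨u', hu'⟩ := h.exists_finsetWord_mul_finsetWord I J
    have hzero := h.conjAverage_finsetWord (𝕜 := 𝕜) hb
      (Finset.nonempty_iff_ne_empty.2 fun he => hIJ (symmDiff_eq_bot.1 he))
    rw [smul_mul_assoc, hu', map_smul]
    rcases Int.units_eq_one_or u' with rfl | rfl <;> simp [hzero]

omit [Fintype Gen] in
theorem linearIndependent_finsetWord [Finite Gen] [Nontrivial A] (h : IsPauliSystem x b)
    (hb : IsNondegenerateSign b) : LinearIndependent 𝕜 (finsetWord x) := by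
  cases nonempty_fintype Gen
  refine Fintype.linearIndependent_iff.2 fun a ha J => ?_
  obtain ⟨u, hu⟩ := h.exists_conjAverage_sum_mul_finsetWord hb a J
  rw [ha, zero_mul, map_zero, eq_comm, smul_eq_zero_iff_eq] at hu
  exact (map_eq_zero (algebraMap 𝕜 A)).1 hu

theorem finrank_eq [Nontrivial A] (h : IsPauliSystem x b) (hb : IsNondegenerateSign b)
    (htop : Algebra.adjoin 𝕜 (Set.range x) = ⊤) :
    Module.finrank 𝕜 A = 2 ^ Fintype.card Gen := by
  rw [Module.finrank_eq_card_basis (Module.Basis.mk (h.linearIndependent_finsetWord hb)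
    (h.span_finsetWord_eq_top htop).ge), Fintype.card_finset]

omit [Fintype Gen] in
theorem isSimpleRing [Finite Gen] [Nontrivial A] (h : IsPauliSystem x b)
    (hb : IsNondegenerateSign b) (htop : Algebra.adjoin 𝕜 (Set.range x) = ⊤) :
    IsSimpleRing A := by
  cases nonempty_fintype Gen
  refine ⟨⟨fun J => or_iff_not_imp_left.2 fun hJ => ?_⟩⟩
  obtain ⟨y, hy, hy0⟩ : ∃ y ∈ J, y ≠ 0 := by
    by_contra! hcon
    exact hJ (le_bot_iff.1 fun y hy => by simpa using hcon y hy)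
  obtain ⟨a, rfl⟩ := (Submodule.mem_span_range_iff_exists_fun 𝕜).1
    (h.mem_span_finsetWord (htop ▸ trivial : y ∈ Algebra.adjoin 𝕜 (Set.range x)))
  obtain ⟨I, hI⟩ : ∃ I, a I ≠ 0 := by
    by_contra! hcon
    exact hy0 (by simp [hcon])
  obtain ⟨u, hu⟩ := h.exists_conjAverage_sum_mul_finsetWord hb a I
  have hmem := conjAverage_mem (𝕜 := 𝕜) (x := x) J (J.mul_mem_right _ (finsetWord x I) hy)
  have hunit : IsUnit (u • algebraMap 𝕜 A (a I)) :=
    ((isUnit_iff_ne_zero.2 hI).map (algebraMap 𝕜 A)).smul u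
  rw [hu] at hmem
  obtain ⟨v, hv⟩ := hunit.exists_left_inv
  exact (TwoSidedIdeal.one_mem_iff J).1 (hv ▸ J.mul_mem_left v _ hmem)

end Nondegenerate

end IsPauliSystem

/-- The signs for which two different generators anticommute if they are in the same class, and
commute otherwise. -/
def classSign {Gen C : Type*} [DecidableEq Gen] [DecidableEq C] (c : Gen → C) (s t : Gen) : ℤˣ :=
  if c s = c t ∧ s ≠ t then -1 else 1

theorem isNondegenerateSign_classSign {Gen C : Type*} [Fintype Gen] [DecidableEq Gen]
    [DecidableEq C] {c : Gen → C} (hc : ∀ a, Even (Finset.univ.filter fun s => c s = a).card) :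
    IsNondegenerateSign (classSign c) := by
  rintro I ⟨s₀, hs₀⟩
  suffices h : ∃ t, Odd (I.filter fun s => c t = c s ∧ t ≠ s).card by
    obtain ⟨t, ht⟩ := h
    exact ⟨t, by simp [classSign, Finset.prod_ite, ht.neg_one_pow]⟩
  rcases Nat.even_or_odd (I.filter fun s => c s = c s₀).card with heven | hodd
  · refine ⟨s₀, ?_⟩
    have hfilter : (I.filter fun s => c s₀ = c s ∧ s₀ ≠ s) =
        (I.filter fun s => c s = c s₀).erase s₀ := by
      ext s; simp only [Finset.mem_filter, Finset.mem_erase]; grind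
    have hmem : s₀ ∈ I.filter fun s => c s = c s₀ := by simpa using hs₀
    rw [hfilter, Finset.card_erase_of_mem hmem]
    exact Nat.Even.sub_odd (Finset.card_pos.2 ⟨s₀, hmem⟩) heven odd_one
  · obtain ⟨t, htc, htI⟩ : ∃ t, c t = c s₀ ∧ t ∉ I := by
      by_contra! hcon
      refine Nat.not_even_iff_odd.2 hodd ?_
      convert hc (c s₀) using 2
      ext s; simp only [Finset.mem_filter, Finset.mem_univ, true_and]; grind
    refine ⟨t, ?_⟩
    convert hodd using 2
    ext s; simp only [Finset.mem_filter]; grind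

/-! ### Modules over the algebra generated by a Pauli system -/

theorem isIsotypicOfType_of_isSimpleRing {R : Type*} [Ring R] [IsSimpleRing R] [IsArtinianRing R]
    (S Z : Type*) [AddCommGroup S] [Module R S] [IsSimpleModule R S] [AddCommGroup Z]
    [Module R Z] : IsIsotypicOfType R Z S := by
  intro m hm
  obtain ⟨I, ⟨e⟩⟩ := IsSemisimpleRing.exists_linearEquiv_ideal_of_isSimpleModule R S
  obtain ⟨J, ⟨f⟩⟩ := IsSemisimpleRing.exists_linearEquiv_ideal_of_isSimpleModule R m
  have := IsSimpleModule.congr e.symm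
  have := IsSimpleModule.congr f.symm
  obtain ⟨g⟩ := IsSimpleRing.isIsotypic R R I J
  exact ⟨f.trans (g.trans e.symm)⟩

section

variable {𝕜 : Type*} [Field 𝕜]

theorem nonempty_linearEquiv_of_isSimpleRing {R : Type*} [Ring R] [Algebra 𝕜 R]
    [Module.Finite 𝕜 R] [IsSimpleRing R] {Z Z' : Type*} [AddCommGroup Z] [AddCommGroup Z']
    [Module 𝕜 Z] [Module 𝕜 Z'] [Module R Z] [Module R Z'] [IsScalarTower 𝕜 R Z]
    [IsScalarTower 𝕜 R Z'] [FiniteDimensional 𝕜 Z] [FiniteDimensional 𝕜 Z']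
    (hd : Module.finrank 𝕜 Z = Module.finrank 𝕜 Z') : Nonempty (Z ≃ₗ[R] Z') := by
  have : IsArtinianRing R := IsArtinianRing.of_finite 𝕜 R
  have : Module.Finite R Z := Module.Finite.of_restrictScalars_finite 𝕜 R Z
  have : Module.Finite R Z' := Module.Finite.of_restrictScalars_finite 𝕜 R Z'
  obtain ⟨-, -, S, hS, -⟩ := (IsSimpleRing.isIsotypic R R).linearEquiv_fun
  obtain ⟨n, ⟨e⟩⟩ := (isIsotypicOfType_of_isSimpleRing (R := R) S Z).linearEquiv_fun
  obtain ⟨n', ⟨e'⟩⟩ := (isIsotypicOfType_of_isSimpleRing (R := R) S Z').linearEquiv_fun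
  have : FiniteDimensional 𝕜 S :=
    Module.Finite.of_injective (S.subtype.restrictScalars 𝕜) S.subtype_injective
  have : Nontrivial S := IsSimpleModule.nontrivial R S
  have hn : n * Module.finrank 𝕜 S = n' * Module.finrank 𝕜 S := by
    have h := (e.restrictScalars 𝕜).finrank_eq
    have h' := (e'.restrictScalars 𝕜).finrank_eq
    rw [Module.finrank_pi_fintype, Fin.sum_const, smul_eq_mul] at h h'
    rw [← h, ← h', hd]
  obtain rfl : n = n' := Nat.eq_of_mul_eq_mul_right Module.finrank_pos hn
  exact ⟨e.trans e'.symm⟩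

theorem exists_intertwiner_of_isSimpleRing_adjoin {Gen Z Z' : Type*} [AddCommGroup Z]
    [AddCommGroup Z'] [Module 𝕜 Z] [Module 𝕜 Z'] [FiniteDimensional 𝕜 Z] [FiniteDimensional 𝕜 Z']
    (x : Gen → Module.End 𝕜 Z) (x' : Gen → Module.End 𝕜 Z')
    (hR : IsSimpleRing (Algebra.adjoin 𝕜 (Set.range fun s => (x s, x' s))))
    (hd : Module.finrank 𝕜 Z = Module.finrank 𝕜 Z') :
    ∃ Ψ : Z ≃ₗ[𝕜] Z', ∀ s ξ, Ψ (x s ξ) = x' s (Ψ ξ) := by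
  let R := Algebra.adjoin 𝕜 (Set.range fun s => (x s, x' s))
  let f : R →ₐ[𝕜] Module.End 𝕜 Z := (AlgHom.fst 𝕜 _ _).comp R.val
  let f' : R →ₐ[𝕜] Module.End 𝕜 Z' := (AlgHom.snd 𝕜 _ _).comp R.val
  let : Module R Z := Module.compHom Z f.toRingHom
  let : Module R Z' := Module.compHom Z' f'.toRingHom
  have : IsScalarTower 𝕜 R Z := ⟨fun a r ξ => LinearMap.congr_fun (map_smul f a r) ξ⟩
  have : IsScalarTower 𝕜 R Z' := ⟨fun a r ξ => LinearMap.congr_fun (map_smul f' a r) ξ⟩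
  obtain ⟨e⟩ := nonempty_linearEquiv_of_isSimpleRing (R := R) hd
  exact ⟨e.restrictScalars 𝕜, fun s ξ => e.map_smul ⟨(x s, x' s), Algebra.subset_adjoin ⟨s, rfl⟩⟩ ξ⟩

end

namespace IsPauliSystem

variable {Gen : Type*} {b : Gen → Gen → ℤˣ}

theorem prod {A B : Type*} [Ring A] [Ring B] {x : Gen → A} {y : Gen → B} (hx : IsPauliSystem x b)
    (hy : IsPauliSystem y b) : IsPauliSystem (fun s => (x s, y s)) b :=
  ⟨fun s => Prod.ext (hx.mul_self s) (hy.mul_self s),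
    fun s t => Prod.ext (hx.mul_swap s t) (hy.mul_swap s t)⟩

variable {𝕜 : Type*} [Field 𝕜] [NeZero (2 : 𝕜)] [Finite Gen]

theorem isSimpleRing_adjoin {A : Type*} [Ring A] [Algebra 𝕜 A] [Nontrivial A] {x : Gen → A}
    (h : IsPauliSystem x b) (hb : IsNondegenerateSign b) :
    IsSimpleRing (Algebra.adjoin 𝕜 (Set.range x)) := by
  let R := Algebra.adjoin 𝕜 (Set.range x)
  let z : Gen → R := fun s => ⟨x s, Algebra.subset_adjoin ⟨s, rfl⟩⟩
  have hz : IsPauliSystem z b := by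
    refine ⟨fun s => Subtype.ext (h.mul_self s), fun s t => Subtype.ext ?_⟩
    have := h.mul_swap s t
    rcases Int.units_eq_one_or (b s t) with hst | hst <;> simpa [hst] using this
  refine hz.isSimpleRing (𝕜 := 𝕜) hb ?_
  have hrange : Set.range z = (Subtype.val : R → A) ⁻¹' Set.range x := by
    ext w
    simp [z, Subtype.ext_iff]
  rw [hrange, Algebra.adjoin_adjoin_coe_preimage]

theorem exists_intertwiner {Z Z' : Type*} [AddCommGroup Z] [AddCommGroup Z'] [Module 𝕜 Z]
    [Module 𝕜 Z'] [FiniteDimensional 𝕜 Z] [FiniteDimensional 𝕜 Z'] {x : Gen → Module.End 𝕜 Z}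
    {x' : Gen → Module.End 𝕜 Z'} (h : IsPauliSystem x b) (h' : IsPauliSystem x' b)
    (hb : IsNondegenerateSign b) (hd : Module.finrank 𝕜 Z = Module.finrank 𝕜 Z') :
    ∃ Ψ : Z ≃ₗ[𝕜] Z', ∀ s ξ, Ψ (x s ξ) = x' s (Ψ ξ) := by
  rcases subsingleton_or_nontrivial Z with hZ | hZ
  · have : Subsingleton Z' := by
      rwa [← Module.finrank_zero_iff (R := 𝕜), ← hd, Module.finrank_zero_iff]
    exact ⟨0, fun s ξ => Subsingleton.elim _ _⟩
  · exact exists_intertwiner_of_isSimpleRing_adjoin x x' ((h.prod h').isSimpleRing_adjoin hb) hd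

end IsPauliSystem

section Burnside

variable {𝕜 V : Type*} [Field 𝕜] [AddCommGroup V] [Module 𝕜 V]

/-- The operators in `s` act irreducibly: the space is nonzero, and it has no common invariant
subspace besides `0` and itself. -/
def IsIrreducibleSet (s : Set (Module.End 𝕜 V)) : Prop :=
  Nontrivial V ∧ ∀ U : Submodule 𝕜 V, (∀ f ∈ s, ∀ ξ ∈ U, f ξ ∈ U) → U = ⊥ ∨ U = ⊤

namespace IsIrreducibleSet

variable {s : Set (Module.End 𝕜 V)}

theorem isSimpleModule (hs : IsIrreducibleSet s) : IsSimpleModule (Algebra.adjoin 𝕜 s) V := by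
  have := hs.1
  refine (isSimpleModule_iff _ V).2 { eq_bot_or_eq_top := fun U => ?_ }
  have hU := hs.2 (U.restrictScalars 𝕜) fun f hf ξ hξ =>
    U.smul_mem (⟨f, Algebra.subset_adjoin hf⟩ : Algebra.adjoin 𝕜 s) hξ
  exact hU.imp (fun h => Submodule.restrictScalars_injective 𝕜 _ V (h.trans rfl))
    fun h => Submodule.restrictScalars_injective 𝕜 _ V (h.trans rfl)

variable [FiniteDimensional 𝕜 V] [IsAlgClosed 𝕜]

/-- **Schur's lemma**. -/
theorem exists_eq_smul_of_commute (hs : IsIrreducibleSet s) {f : Module.End 𝕜 V}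
    (hf : ∀ g ∈ s, Commute f g) : ∃ μ : 𝕜, ∀ ξ, f ξ = μ • ξ := by
  have := hs.isSimpleModule
  let F : Module.End (Algebra.adjoin 𝕜 s) V :=
    { toFun := f
      map_add' := map_add f
      map_smul' := fun r ξ => LinearMap.congr_fun
        (Algebra.commute_of_mem_adjoin_of_forall_mem_commute r.2 hf).eq ξ }
  obtain ⟨μ, hμ⟩ := (IsSimpleModule.algebraMap_end_bijective_of_isAlgClosed
    (A := Algebra.adjoin 𝕜 s) (V := V) 𝕜).2 F
  exact ⟨μ, fun ξ => (LinearMap.congr_fun hμ ξ).symm⟩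

/-- **Burnside's theorem**. -/
theorem adjoin_eq_top (hs : IsIrreducibleSet s) : Algebra.adjoin 𝕜 s = ⊤ := by
  have := hs.isSimpleModule
  have hschur := (IsSimpleModule.algebraMap_end_bijective_of_isAlgClosed
    (A := Algebra.adjoin 𝕜 s) (V := V) 𝕜).2
  have : Module.Finite (Module.End (Algebra.adjoin 𝕜 s) V) V :=
    Module.Finite.of_restrictScalars_finite 𝕜 _ V
  refine eq_top_iff.2 fun f _ => ?_
  let F : Module.End (Module.End (Algebra.adjoin 𝕜 s) V) V :=
    { toFun := f
      map_add' := map_add f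
      map_smul' := fun φ ξ => by
        obtain ⟨μ, rfl⟩ := hschur φ
        exact map_smul f μ ξ }
  obtain ⟨r, hr⟩ := Module.Finite.toModuleEnd_moduleEnd_surjective F
  have hfr : f = r := LinearMap.ext fun ξ => (LinearMap.congr_fun hr ξ).symm
  exact hfr ▸ r.2

end IsIrreducibleSet

theorem IsPauliSystem.finrank_sq [NeZero (2 : 𝕜)] [IsAlgClosed 𝕜] [FiniteDimensional 𝕜 V]
    {Gen : Type*} [Fintype Gen] {b : Gen → Gen → ℤˣ} {x : Gen → Module.End 𝕜 V}
    (h : IsPauliSystem x b) (hb : IsNondegenerateSign b) (hirr : IsIrreducibleSet (Set.range x)) :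
    Module.finrank 𝕜 V ^ 2 = 2 ^ Fintype.card Gen := by
  have := hirr.1
  rw [pow_two, ← Module.finrank_linearMap, h.finrank_eq hb hirr.adjoin_eq_top]

end Burnside

/-! ### The Clifford algebra of Euclidean space -/

section CliffordBasics

variable {n : ℕ}

theorem negEuclid_apply (v : Fin n → ℝ) : negEuclid n v = -∑ a, v a * v a := by
  simp [negEuclid, QuadraticMap.weightedSumSquares_apply]

theorem clVec_mul_self (v : Fin n → ℝ) :
    clVec v * clVec v = algebraMap ℝ (Cl n) (-∑ a, v a * v a) := by
  rw [CliffordAlgebra.ι_sq_scalar, negEuclid_apply]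

theorem clVec_eq_sum (v : Fin n → ℝ) : clVec v = ∑ a, v a • clE a := by
  conv_lhs => rw [pi_eq_sum_univ' v]
  simp [clVec, map_sum]

theorem clE_mul_self (a : Fin n) : clE a * clE a = -1 := by
  rw [clVec_mul_self]
  simp [Pi.single_apply]

theorem isPauliSystem_clE :
    IsPauliSystem (clE : Fin n → Cl n) (classSign fun _ => ()) where
  mul_self := clE_mul_self
  mul_swap a b := by
    by_cases hab : a = b
    · simp [classSign, hab]
    · simp [classSign, hab, ClRep.clE_sq_swap a b hab]

theorem adjoin_range_clE : Algebra.adjoin ℝ (Set.range (clE : Fin n → Cl n)) = ⊤ := by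
  rw [eq_top_iff, ← CliffordAlgebra.adjoin_range_ι (Q := negEuclid n)]
  refine Algebra.adjoin_le ?_
  rintro _ ⟨v, rfl⟩
  rw [show CliffordAlgebra.ι (negEuclid n) v = clVec v from rfl, clVec_eq_sum]
  exact sum_mem fun a _ => Subalgebra.smul_mem _ (Algebra.subset_adjoin (Set.mem_range_self a)) _

instance finite_cl : Module.Finite ℝ (Cl n) :=
  isPauliSystem_clE.finite_of_adjoin_eq_top adjoin_range_clE

theorem clE_mul_clE_mem_even (a b : Fin n) :
    clE a * clE b ∈ CliffordAlgebra.even (negEuclid n) :=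
  CliffordAlgebra.ι_mul_ι_mem_evenOdd_zero _ _ _

end CliffordBasics

/-! ### Generators of even number -/

section PauliGenerators

/-- An even number of generators, of the Clifford algebra if `n` is even and of its even part if
`n` is odd: the vectors `e a` in the first case, the products `e a * e (n - 1)` of the other basis
vectors with the last one in the second. -/
def pauliGen (n : ℕ) (a : Fin (2 * (n / 2))) : Cl n :=
  if h : Even n then clE (a.castLE (by omega))
  else clE (a.castLE (by omega)) * clE ⟨n - 1, by have := (Nat.not_even_iff_odd.1 h).pos; omega⟩

variable {n : ℕ}

theorem pauliGen_of_even (hn : Even n) (a : Fin (2 * (n / 2))) :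
    pauliGen n a = clE (a.castLE (by omega)) :=
  dif_pos hn

theorem pauliGen_of_odd (hn : Odd n) (a : Fin (2 * (n / 2))) :
    pauliGen n a =
      clE (a.castLE (by omega)) * clE ⟨n - 1, Nat.sub_lt hn.pos one_pos⟩ :=
  dif_neg (Nat.not_even_iff_odd.2 hn)

theorem pauliGen_mem_even (hn : Odd n) (a : Fin (2 * (n / 2))) :
    pauliGen n a ∈ CliffordAlgebra.even (negEuclid n) := by
  rw [pauliGen_of_odd hn]
  exact clE_mul_clE_mem_even _ _

theorem pauliGen_mul_pauliGen (a b : Fin (2 * (n / 2))) :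
    pauliGen n a * pauliGen n b = clE (a.castLE (by omega)) * clE (b.castLE (by omega)) := by
  rcases Nat.even_or_odd n with hn | hn
  · rw [pauliGen_of_even hn, pauliGen_of_even hn]
  · have hb : b.castLE (by omega) ≠ (⟨n - 1, Nat.sub_lt hn.pos one_pos⟩ : Fin n) := fun h => by
      have hval : b.1 = n - 1 := congrArg Fin.val h
      have := Nat.odd_iff.1 hn
      omega
    rw [pauliGen_of_odd hn, pauliGen_of_odd hn, ClRep.clE_sq_swap _ _ hb, mul_neg, mul_assoc,
      ← mul_assoc (clE _) (clE _) (clE (b.castLE _)), clE_mul_self, neg_one_mul, mul_neg, neg_neg]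

theorem isPauliSystem_pauliGen (n : ℕ) :
    IsPauliSystem (pauliGen n) (classSign fun _ => ()) where
  mul_self a := by rw [pauliGen_mul_pauliGen, clE_mul_self]
  mul_swap a b := by
    rw [pauliGen_mul_pauliGen, pauliGen_mul_pauliGen, isPauliSystem_clE.mul_swap]
    simp only [classSign, ne_eq, (Fin.castLE_injective _).eq_iff]

theorem clE_mem_adjoin_pauliGen (hn : Even n) (a : Fin n) :
    clE a ∈ Algebra.adjoin ℝ (Set.range (pauliGen n)) := by
  have ha : a.1 < 2 * (n / 2) := by
    have := Nat.even_iff.1 hn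
    omega
  exact Algebra.subset_adjoin ⟨⟨a, ha⟩, pauliGen_of_even hn _⟩

theorem clE_mul_clE_last_mem_adjoin_pauliGen (hn : Odd n) (a : Fin n) :
    clE a * clE ⟨n - 1, Nat.sub_lt hn.pos one_pos⟩ ∈
      Algebra.adjoin ℝ (Set.range (pauliGen n)) := by
  by_cases ha : a.1 = n - 1
  · rw [show a = ⟨n - 1, Nat.sub_lt hn.pos one_pos⟩ from Fin.ext ha, clE_mul_self]
    exact neg_mem (one_mem _)
  · have hlt : a.1 < 2 * (n / 2) := by
      have := Nat.odd_iff.1 hn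
      omega
    exact Algebra.subset_adjoin ⟨⟨a, hlt⟩, pauliGen_of_odd hn _⟩

theorem clE_mul_clE_mem_adjoin_pauliGen (a b : Fin n) :
    clE a * clE b ∈ Algebra.adjoin ℝ (Set.range (pauliGen n)) := by
  rcases Nat.even_or_odd n with hn | hn
  · exact mul_mem (clE_mem_adjoin_pauliGen hn a) (clE_mem_adjoin_pauliGen hn b)
  · let o : Fin n := ⟨n - 1, Nat.sub_lt hn.pos one_pos⟩
    by_cases hb : b = o
    · exact hb ▸ clE_mul_clE_last_mem_adjoin_pauliGen hn a
    · have hab : clE a * clE b = clE a * clE o * (clE b * clE o) := by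
        rw [ClRep.clE_sq_swap b o hb, mul_neg, mul_assoc, ← mul_assoc (clE o), clE_mul_self,
          neg_one_mul, mul_neg, neg_neg]
      rw [hab]
      exact mul_mem (clE_mul_clE_last_mem_adjoin_pauliGen hn a)
        (clE_mul_clE_last_mem_adjoin_pauliGen hn b)

theorem mem_adjoin_pauliGen_of_mem_even {x : Cl n}
    (hx : x ∈ CliffordAlgebra.even (negEuclid n)) :
    x ∈ Algebra.adjoin ℝ (Set.range (pauliGen n)) := by
  refine CliffordAlgebra.even_induction (Q := negEuclid n)
    (motive := fun x _ => x ∈ Algebra.adjoin ℝ (Set.range (pauliGen n)))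
    (Subalgebra.algebraMap_mem _) (fun _ _ _ _ => add_mem) (fun v w x _ ih => mul_mem ?_ ih) x hx
  change clVec v * clVec w ∈ _
  rw [clVec_eq_sum v, clVec_eq_sum w, Finset.sum_mul_sum]
  refine sum_mem fun a _ => sum_mem fun b _ => ?_
  rw [smul_mul_smul_comm]
  exact Subalgebra.smul_mem _ (clE_mul_clE_mem_adjoin_pauliGen a b) _

end PauliGenerators

/-! ### Spinor modules and their halves -/

theorem isCompl_eigenspace_one_neg_one {𝕜 V : Type*} [Field 𝕜] [NeZero (2 : 𝕜)] [AddCommGroup V]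
    [Module 𝕜 V] {f : Module.End 𝕜 V} (hf : f * f = 1) :
    IsCompl (f.eigenspace 1) (f.eigenspace (-1)) := by
  have hsq : ∀ ξ, f (f ξ) = ξ := LinearMap.congr_fun hf
  refine ⟨Submodule.disjoint_def.2 fun ξ hpos hneg => ?_,
    codisjoint_iff.2 (eq_top_iff.2 fun ξ _ => ?_)⟩
  · rw [Module.End.mem_eigenspace_iff] at hpos hneg
    have hξ : (2 : 𝕜) • ξ = 0 := by
      rw [two_smul]
      nth_rewrite 1 [← one_smul 𝕜 ξ]
      rw [← hpos, hneg, neg_one_smul, neg_add_cancel]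
    exact (smul_eq_zero.1 hξ).resolve_left two_ne_zero
  · refine Submodule.mem_sup.2 ⟨(2⁻¹ : 𝕜) • (ξ + f ξ), ?_, (2⁻¹ : 𝕜) • (ξ - f ξ), ?_, ?_⟩
    · rw [Module.End.mem_eigenspace_iff, map_smul, map_add, hsq, one_smul, add_comm]
    · rw [Module.End.mem_eigenspace_iff, map_smul, map_sub, hsq, neg_one_smul, ← smul_neg,
        neg_sub]
    · rw [← smul_add, add_add_sub_cancel, ← two_smul 𝕜 ξ, smul_smul,
        inv_mul_cancel₀ two_ne_zero, one_smul]

namespace ClRep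

variable {n : ℕ}

theorem commute_volume_of_odd (hn : Odd n) (x : Cl n) : Commute (volumeElement n) x := by
  refine Algebra.commute_of_mem_adjoin_of_forall_mem_commute (s := Set.range clE)
    (adjoin_range_clE ▸ Algebra.mem_top : x ∈ Algebra.adjoin ℝ (Set.range clE)) ?_
  rintro _ ⟨a, rfl⟩
  have h := clE_mul_prod a (List.finRange n) (List.nodup_finRange n)
  rw [List.length_finRange, hn.neg_one_pow, if_pos (List.mem_finRange a), neg_one_mul, neg_neg,
    one_smul, ← List.ofFn_eq_map] at h
  exact h.symm

theorem volumeElement_mem_evenOdd (n : ℕ) :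
    volumeElement n ∈ CliffordAlgebra.evenOdd (negEuclid n) n := by
  have h := SetLike.list_prod_ofFn_mem_graded (A := CliffordAlgebra.evenOdd (negEuclid n))
    (fun _ : Fin n => 1) (fun a => clE a) fun a => CliffordAlgebra.ι_mem_evenOdd_one _ _
  rwa [List.ofFn_const, List.sum_replicate, nsmul_one] at h

theorem clE_mul_volumeElement_mem_even (hn : Odd n) (a : Fin n) :
    clE a * volumeElement n ∈ CliffordAlgebra.even (negEuclid n) := by
  have h := SetLike.mul_mem_graded (CliffordAlgebra.ι_mem_evenOdd_one (negEuclid n)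
    (Pi.single a 1)) (volumeElement_mem_evenOdd n)
  rwa [(ZMod.natCast_eq_one_iff_odd).2 hn, show (1 + 1 : ZMod 2) = 0 from rfl] at h

theorem prod_map_clE_mul_self (l : List (Fin n)) (hl : l.Nodup) :
    (l.map clE).prod * (l.map clE).prod =
      ((-1 : ℝ) ^ (l.length * (l.length + 1) / 2)) • (1 : Cl n) := by
  induction l with
  | nil => simp
  | cons a l ih =>
    obtain ⟨ha, hl⟩ := List.nodup_cons.1 hl
    have hswap : (l.map clE).prod * clE a =
        (-1 : ℝ) ^ l.length • (clE a * (l.map clE).prod) := by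
      rw [clE_mul_prod a l hl, if_neg ha, mul_one, smul_smul, ← mul_pow, neg_one_mul, neg_neg,
        one_pow, one_smul]
    have htri : (l.length + 1) * (l.length + 1 + 1) / 2 =
        l.length * (l.length + 1) / 2 + (l.length + 1) := by
      rw [← Nat.add_mul_div_left _ _ two_pos]
      congr 1
      ring
    rw [List.map_cons, List.prod_cons, List.length_cons, htri]
    calc clE a * (l.map clE).prod * (clE a * (l.map clE).prod)
        = clE a * ((l.map clE).prod * clE a) * (l.map clE).prod := by simp only [mul_assoc]
      _ = (-1 : ℝ) ^ l.length • (clE a * clE a * ((l.map clE).prod * (l.map clE).prod)) := by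
          rw [hswap, mul_smul_comm, smul_mul_assoc]
          simp only [mul_assoc]
      _ = _ := by
          rw [ih hl, clE_mul_self, neg_one_mul, ← neg_smul, smul_smul]
          congr 1
          ring

theorem volumeElement_mul_self (n : ℕ) :
    volumeElement n * volumeElement n = ((-1 : ℝ) ^ (n * (n + 1) / 2)) • (1 : Cl n) := by
  have h := prod_map_clE_mul_self (List.finRange n) (List.nodup_finRange _)
  rwa [← List.ofFn_eq_map, List.length_finRange] at h

variable {V : Type v} [NormedAddCommGroup V] [NormedSpace ℂ V]

theorem chirality_mul_self (ρ : ClRep n V) (hn : Even n) : ρ.chirality * ρ.chirality = 1 := by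
  obtain ⟨m, rfl⟩ := hn
  have hexp : (m + m) * (m + m + 1) / 2 = m + 2 * (m * m) := by
    rw [show (m + m) * (m + m + 1) = 2 * (m + 2 * (m * m)) by ring,
      Nat.mul_div_cancel_left _ two_pos]
  have hvol : ρ (volumeElement (m + m)) * ρ (volumeElement (m + m)) = ((-1 : ℂ) ^ m) • 1 := by
    rw [← map_mul, volumeElement_mul_self, map_smul, map_one, hexp, pow_add, pow_mul, neg_one_sq,
      one_pow, mul_one, ← Complex.coe_smul]
    simp
  rw [chirality, smul_mul_smul_comm, hvol, smul_smul, ← mul_pow, Complex.I_mul_I,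
    show (m + m) / 2 = m by omega, ← mul_pow, neg_one_mul, neg_neg, one_pow, one_smul]

theorem apply_mem_of_mem_adjoin (ρ : ClRep n V) {s : Set (Cl n)} {U : Submodule ℂ V}
    (hU : ∀ x ∈ s, ∀ ξ ∈ U, ρ x ξ ∈ U) {x : Cl n} (hx : x ∈ Algebra.adjoin ℝ s) :
    ∀ ξ ∈ U, ρ x ξ ∈ U := by
  induction hx using Algebra.adjoin_induction with
  | mem x hx => exact hU x hx
  | algebraMap r =>
    intro ξ hξ
    rw [AlgHom.commutes, Module.algebraMap_end_apply, ← Complex.coe_smul]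
    exact U.smul_mem _ hξ
  | add x y _ _ hx hy =>
    intro ξ hξ
    rw [map_add]
    exact U.add_mem (hx ξ hξ) (hy ξ hξ)
  | mul x y _ _ hx hy =>
    intro ξ hξ
    rw [map_mul]
    exact hx _ (hy ξ hξ)

theorem half_of_odd (ρ : ClRep n V) (hn : Odd n) (s : ℂ) : ρ.half s = ⊤ :=
  if_neg (Nat.not_even_iff_odd.2 hn)

theorem finrank_diagonal_of_odd (ρ : ClRep n V) (hn : Odd n) :
    Module.finrank ℂ ρ.diagonal = Module.finrank ℂ V := by
  have hmem : ∀ (s : ℂ) ξ, ξ ∈ ρ.half s := fun s ξ => by rw [ρ.half_of_odd hn]; trivial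
  let f : ρ.diagonal →ₗ[ℂ] V :=
    (ρ.half 1).subtype ∘ₗ LinearMap.fst ℂ _ _ ∘ₗ ρ.toProd.toLinearMap ∘ₗ ρ.diagonal.subtype
  have hf : ∀ ξ, f ξ = (ρ.toProd ξ.1).1 := fun _ => rfl
  refine LinearEquiv.finrank_eq (LinearEquiv.ofBijective f ⟨fun ξ η h => ?_, fun ξ => ?_⟩)
  · rw [hf, hf] at h
    refine Subtype.ext (ρ.toProd.injective (Prod.ext (Subtype.ext h) (Subtype.ext ?_)))
    exact (ξ.2.symm.trans h).trans η.2
  · refine ⟨⟨ρ.toProd.symm (⟨ξ, hmem _ ξ⟩, ⟨ξ, hmem _ ξ⟩), ?_⟩, ?_⟩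
    · change ((ρ.toProd _).1 : V) = (ρ.toProd _).2
      rw [LinearEquiv.apply_symm_apply]
    · rw [hf, LinearEquiv.apply_symm_apply]

section IsSpinorModule

variable [FiniteDimensional ℂ V] {ρ : ClRep n V}

theorem IsSpinorModule.exists_volume_eq_smul (hρ : ρ.IsSpinorModule) (hn : Odd n) :
    ∃ μ : ℂ, μ ≠ 0 ∧ ∀ ξ, ρ (volumeElement n) ξ = μ • ξ := by
  have := hρ.1
  have hirr : IsIrreducibleSet (Set.range ρ) :=
    ⟨hρ.1, fun U hU => hρ.2 U fun x => hU _ ⟨x, rfl⟩⟩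
  obtain ⟨μ, hμ⟩ := hirr.exists_eq_smul_of_commute (f := ρ (volumeElement n)) <| by
    rintro _ ⟨x, rfl⟩
    exact (commute_volume_of_odd hn x).map ρ
  refine ⟨μ, ?_, hμ⟩
  rintro rfl
  obtain ⟨ξ, hξ⟩ := exists_ne (0 : V)
  have h := LinearMap.congr_fun (congrArg ρ (volumeElement_mul_self n)) ξ
  rw [map_mul, Module.End.mul_apply, hμ, map_smul, map_one, zero_smul, LinearMap.smul_apply,
    Module.End.one_apply, eq_comm, smul_eq_zero] at h
  exact h.elim (pow_ne_zero _ (neg_ne_zero.2 one_ne_zero)) hξ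

theorem IsSpinorModule.isIrreducibleSet_pauliGen (hρ : ρ.IsSpinorModule) :
    IsIrreducibleSet (Set.range fun a => ρ (pauliGen n a)) := by
  refine ⟨hρ.1, fun U hU => hρ.2 U fun x => ρ.apply_mem_of_mem_adjoin (s := Set.range clE) ?_
    (adjoin_range_clE ▸ Algebra.mem_top)⟩
  have hadjoin : ∀ x ∈ Algebra.adjoin ℝ (Set.range (pauliGen n)), ∀ ξ ∈ U, ρ x ξ ∈ U :=
    fun x => ρ.apply_mem_of_mem_adjoin (by rintro _ ⟨a, rfl⟩; exact hU _ ⟨a, rfl⟩)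
  rintro _ ⟨a, rfl⟩ ξ hξ
  rcases Nat.even_or_odd n with hn | hn
  · exact hadjoin _ (clE_mem_adjoin_pauliGen hn a) ξ hξ
  · obtain ⟨μ, hμ0, hμ⟩ := hρ.exists_volume_eq_smul hn
    have h := hadjoin _ (mem_adjoin_pauliGen_of_mem_even (clE_mul_volumeElement_mem_even hn a)) ξ hξ
    rw [map_mul, Module.End.mul_apply, hμ, map_smul] at h
    exact (U.smul_mem_iff hμ0).1 h

theorem IsSpinorModule.finrank_eq (hρ : ρ.IsSpinorModule) : Module.finrank ℂ V = 2 ^ (n / 2) := by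
  have hsys := (isPauliSystem_pauliGen n).map (ρ : Cl n →+* Module.End ℂ V)
  have h := hsys.finrank_sq (isNondegenerateSign_classSign fun _ => by simp)
    hρ.isIrreducibleSet_pauliGen
  rw [Fintype.card_fin, mul_comm, pow_mul] at h
  exact Nat.pow_left_injective two_ne_zero h

theorem finrank_graded_of_even (ρ : ClRep n V) (hn : Even n) :
    Module.finrank ℂ ρ.Graded = Module.finrank ℂ V := by
  rw [ρ.toProd.finrank_eq, Module.finrank_prod]
  refine Submodule.finrank_add_eq_of_isCompl ?_
  rw [half, half, if_pos hn, if_pos hn]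
  exact isCompl_eigenspace_one_neg_one (ρ.chirality_mul_self hn)

theorem finrank_graded_of_odd (ρ : ClRep n V) (hn : Odd n) :
    Module.finrank ℂ ρ.Graded = 2 * Module.finrank ℂ V := by
  rw [ρ.toProd.finrank_eq, Module.finrank_prod, ρ.half_of_odd hn, ρ.half_of_odd hn, finrank_top,
    two_mul]

end IsSpinorModule

end ClRep

/-! ### The Clifford algebras of the blocks -/

theorem commute_of_mem_even {n m : ℕ} {B : Type*} [Ring B] [Algebra ℝ B] (f : Cl n →ₐ[ℝ] B)
    (g : Cl m →ₐ[ℝ] B)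
    (h : (∀ v w, f (clVec v) * g (clVec w) = g (clVec w) * f (clVec v)) ∨
      ∀ v w, f (clVec v) * g (clVec w) = -(g (clVec w) * f (clVec v)))
    {a : Cl n} (ha : a ∈ CliffordAlgebra.even (negEuclid n)) (b : Cl m) :
    Commute (f a) (g b) := by
  have hvec : ∀ v w u, Commute (f (clVec v * clVec w)) (g (clVec u)) := fun v w u => by
    rw [map_mul, commute_iff_eq]
    rcases h with h | h
    · rw [mul_assoc, h w u, ← mul_assoc, h v u, mul_assoc]
    · rw [mul_assoc, h w u, mul_neg, ← mul_assoc, h v u, neg_mul, neg_neg, mul_assoc]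
  have hmul : ∀ v w, Commute (f (clVec v * clVec w)) (g b) := fun v w => by
    induction b using CliffordAlgebra.induction with
    | algebraMap r => rw [AlgHom.commutes]; exact Algebra.commute_algebraMap_right r _
    | ι u => exact hvec v w u
    | mul x y hx hy => rw [map_mul g]; exact hx.mul_right hy
    | add x y hx hy => rw [map_add]; exact hx.add_right hy
  exact CliffordAlgebra.even_induction (Q := negEuclid n)
    (motive := fun a _ => Commute (f a) (g b))
    (fun r => by rw [AlgHom.commutes]; exact Algebra.commute_algebraMap_left r _)
    (fun x y _ _ hx hy => by rw [map_add]; exact hx.add_left hy)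
    (fun v w x _ hx => by rw [map_mul]; exact (hmul v w).mul_left hx) a ha

section Blocks

variable {N : ℕ} {D : Fin N → ℕ}

/-- The inclusion of `ℝ^(D i)` into `ℝ^(D 1 + ⋯ + D N)` as the block number `i`. -/
def blockVec (i : Fin N) : (Fin (D i) → ℝ) →ₗ[ℝ] (Fin (∑ i, D i) → ℝ) where
  toFun v k := (Pi.single i v : ∀ j, Fin (D j) → ℝ) (finSigmaFinEquiv.symm k).1
    (finSigmaFinEquiv.symm k).2
  map_add' v w := by ext k; simp [Pi.single_add]
  map_smul' r v := by ext k; simp [Pi.single_smul]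

theorem blockVec_apply (i j : Fin N) (v : Fin (D i) → ℝ) (a : Fin (D j)) :
    blockVec i v (finSigmaFinEquiv ⟨j, a⟩) = (Pi.single i v : ∀ j, Fin (D j) → ℝ) j a := by
  have h : ∀ p : Σ j, Fin (D j), p = ⟨j, a⟩ →
      (Pi.single i v : ∀ j, Fin (D j) → ℝ) p.1 p.2 = (Pi.single i v : ∀ j, Fin (D j) → ℝ) j a := by
    rintro _ rfl
    rfl
  exact h _ (Equiv.symm_apply_apply _ _)

theorem sum_block {A : Type*} [AddCommMonoid A] (f : Fin (∑ i, D i) → A) :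
    ∑ k, f k = ∑ i, ∑ a, f (finSigmaFinEquiv ⟨i, a⟩) := by
  rw [← Equiv.sum_comp finSigmaFinEquiv, Fintype.sum_sigma]

theorem blockVec_single (i : Fin N) (a : Fin (D i)) :
    blockVec i (Pi.single a 1) = Pi.single (finSigmaFinEquiv ⟨i, a⟩) 1 := by
  ext k
  obtain ⟨⟨j, b⟩, rfl⟩ := finSigmaFinEquiv.surjective k
  rw [blockVec_apply]
  by_cases hij : j = i
  · subst hij
    by_cases hab : b = a
    · subst hab; simp
    · simp [hab]
  · simp [hij]

/-- The inclusion of the block number `i`, as an isometry. -/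
def blockIsometry (i : Fin N) : negEuclid (D i) →qᵢ negEuclid (∑ i, D i) where
  toLinearMap := blockVec i
  map_app' v := by
    change negEuclid _ (blockVec i v) = _
    rw [negEuclid_apply, negEuclid_apply, sum_block, Finset.sum_eq_single i]
    · simp [blockVec_apply]
    · intro j _ hj
      simp [blockVec_apply, hj]
    · simp

/-- The inclusion of the Clifford algebra of the block number `i`. -/
def embCl (i : Fin N) : Cl (D i) →ₐ[ℝ] Cl (∑ i, D i) :=
  CliffordAlgebra.map (blockIsometry i)

theorem embCl_clVec (i : Fin N) (v : Fin (D i) → ℝ) :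
    embCl i (clVec v) = clVec (blockVec i v) :=
  CliffordAlgebra.map_apply_ι _ _

theorem embCl_clE (i : Fin N) (a : Fin (D i)) :
    embCl i (clE a) = clE (finSigmaFinEquiv ⟨i, a⟩) := by
  rw [embCl_clVec, blockVec_single]

theorem embCl_anticomm {i j : Fin N} (hij : i ≠ j) (v : Fin (D i) → ℝ) (w : Fin (D j) → ℝ) :
    embCl i (clVec v) * embCl j (clVec w) = -(embCl j (clVec w) * embCl i (clVec v)) := by
  have h : ∀ (a : Fin (D i)) (b : Fin (D j)),
      clE (finSigmaFinEquiv ⟨i, a⟩) * clE (finSigmaFinEquiv ⟨j, b⟩) =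
        -(clE (finSigmaFinEquiv ⟨j, b⟩) * clE (finSigmaFinEquiv ⟨i, a⟩)) := fun a b =>
    ClRep.clE_sq_swap _ _ fun h => hij (congrArg Sigma.fst (finSigmaFinEquiv.injective h))
  rw [clVec_eq_sum v, clVec_eq_sum w]
  simp only [map_sum, map_smul, embCl_clE, Finset.sum_mul, Finset.mul_sum, smul_mul_assoc,
    mul_smul_comm, Finset.smul_sum]
  rw [Finset.sum_comm, ← Finset.sum_neg_distrib]
  refine Finset.sum_congr rfl fun b _ => ?_
  rw [← Finset.sum_neg_distrib]
  refine Finset.sum_congr rfl fun a _ => ?_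
  rw [h, smul_neg, smul_neg, smul_comm]

theorem commute_embCl {i j : Fin N} (hij : i ≠ j) {a : Cl (D i)}
    (ha : a ∈ CliffordAlgebra.even (negEuclid (D i))) (b : Cl (D j)) :
    Commute (embCl i a) (embCl j b) :=
  commute_of_mem_even _ _ (Or.inr fun v w => embCl_anticomm hij v w) ha b

end Blocks

section BlockSystems

variable {N : ℕ} {D : Fin N → ℕ} {B : Type*} [Ring B] [Algebra ℝ B]

/-- Representations of Clifford algebras in the same algebra, such that vectors from different ones
either always commute or always anticommute, and anticommute if both dimensions are even. -/
structure IsBlockSystem (η : ∀ i, Cl (D i) →ₐ[ℝ] B) : Prop where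
  comm_or_anticomm : ∀ i j, i ≠ j →
    (∀ v w, η i (clVec v) * η j (clVec w) = η j (clVec w) * η i (clVec v)) ∨
      ∀ v w, η i (clVec v) * η j (clVec w) = -(η j (clVec w) * η i (clVec v))
  anticomm : ∀ i j, i ≠ j → Even (D i) → Even (D j) → ∀ v w,
    η i (clVec v) * η j (clVec w) = -(η j (clVec w) * η i (clVec v))

theorem isBlockSystem_comp_embCl (f : Cl (∑ i, D i) →ₐ[ℝ] B) :
    IsBlockSystem fun i => f.comp (embCl i) := by
  have h : ∀ i j, i ≠ j → ∀ (v : Fin (D i) → ℝ) (w : Fin (D j) → ℝ),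
      f.comp (embCl i) (clVec v) * f.comp (embCl j) (clVec w) =
        -(f.comp (embCl j) (clVec w) * f.comp (embCl i) (clVec v)) := by
    intro i j hij v w
    simp only [AlgHom.comp_apply]
    rw [← map_mul, embCl_anticomm hij, map_neg, map_mul]
  exact ⟨fun i j hij => Or.inr (h i j hij), fun i j hij _ _ => h i j hij⟩

/-- The class of the generators of the block number `i`: all even dimensional blocks are in one
class, and every odd dimensional block is a class of its own. Distinct generators `pauliGen`
anticommute if they are in the same class, and commute otherwise. -/
def blockClass (D : Fin N → ℕ) (i : Fin N) : Option (Fin N) :=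
  if Even (D i) then none else some i

theorem blockClass_eq_iff {i j : Fin N} (hij : i ≠ j) :
    blockClass D i = blockClass D j ↔ Even (D i) ∧ Even (D j) := by
  simp only [blockClass]
  split_ifs <;> simp_all

theorem IsBlockSystem.isPauliSystem {η : ∀ i, Cl (D i) →ₐ[ℝ] B} (h : IsBlockSystem η) :
    IsPauliSystem (fun s : Σ i, Fin (2 * (D i / 2)) => η s.1 (pauliGen _ s.2))
      (classSign fun s => blockClass D s.1) := by
  have hsys := fun i => (isPauliSystem_pauliGen (D i)).map (η i : Cl (D i) →+* B)
  refine ⟨fun s => (hsys s.1).mul_self s.2, ?_⟩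
  rintro ⟨i, a⟩ ⟨j, b⟩
  by_cases hij : i = j
  · subst hij
    simpa [classSign] using (hsys i).mul_swap a b
  have hne : (⟨i, a⟩ : Σ i, Fin (2 * (D i / 2))) ≠ ⟨j, b⟩ := fun h => hij (congrArg Sigma.fst h)
  simp only [classSign, blockClass_eq_iff hij, ne_eq, hne, not_false_eq_true, and_true]
  split_ifs with heven
  · rw [pauliGen_of_even heven.1, pauliGen_of_even heven.2, Units.neg_smul, one_smul]
    exact h.anticomm i j hij heven.1 heven.2 _ _
  · rw [one_smul]
    rcases not_and_or.1 heven with hi | hj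
    · exact commute_of_mem_even (η i) (η j) (h.comm_or_anticomm i j hij)
        (pauliGen_mem_even (Nat.not_even_iff_odd.1 hi) a) _
    · exact (commute_of_mem_even (η j) (η i) (h.comm_or_anticomm j i (Ne.symm hij))
        (pauliGen_mem_even (Nat.not_even_iff_odd.1 hj) b) _).symm

theorem even_card_blockClass (D : Fin N → ℕ) (o : Option (Fin N)) :
    Even (Finset.univ.filter
      fun s : Σ i, Fin (2 * (D i / 2)) => blockClass D s.1 = o).card := by
  have h : (Finset.univ.filter fun s : Σ i, Fin (2 * (D i / 2)) => blockClass D s.1 = o) =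
      (Finset.univ.filter fun i => blockClass D i = o).sigma fun _ => Finset.univ := by
    ext s
    simp
  rw [h, Finset.card_sigma]
  exact Finset.even_sum _ fun i _ => by simp

theorem IsBlockSystem.exists_intertwiner {Z Z' : Type*} [AddCommGroup Z] [AddCommGroup Z']
    [Module ℂ Z] [Module ℂ Z'] [FiniteDimensional ℂ Z] [FiniteDimensional ℂ Z']
    {η : ∀ i, Cl (D i) →ₐ[ℝ] Module.End ℂ Z} {η' : ∀ i, Cl (D i) →ₐ[ℝ] Module.End ℂ Z'}
    (h : IsBlockSystem η) (h' : IsBlockSystem η')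
    (hd : Module.finrank ℂ Z = Module.finrank ℂ Z') :
    ∃ Ψ : Z ≃ₗ[ℂ] Z', ∀ i, ∀ y ∈ CliffordAlgebra.even (negEuclid (D i)), ∀ ξ,
      Ψ (η i y ξ) = η' i y (Ψ ξ) := by
  obtain ⟨Ψ, hΨ⟩ := h.isPauliSystem.exists_intertwiner h'.isPauliSystem
    (isNondegenerateSign_classSign (even_card_blockClass D)) hd
  refine ⟨Ψ, fun i y hy => ?_⟩
  have hmem := mem_adjoin_pauliGen_of_mem_even hy
  clear hy
  induction hmem using Algebra.adjoin_induction with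
  | mem x hx =>
    obtain ⟨a, rfl⟩ := hx
    exact hΨ ⟨i, a⟩
  | algebraMap r =>
    intro ξ
    rw [AlgHom.commutes, AlgHom.commutes, Module.algebraMap_end_apply,
      Module.algebraMap_end_apply, ← Complex.coe_smul, map_smul, Complex.coe_smul]
  | add x y _ _ hx hy => intro ξ; simp [hx, hy]
  | mul x y _ _ hx hy => intro ξ; simp [hx, hy]

end BlockSystems

/-! ### Operators on tensor products -/

section Tensor

variable {ι 𝕜 : Type*} {s : ι → Type*} [∀ i, AddCommGroup (s i)]

theorem mapIncl_injective [Field 𝕜] [∀ i, Module 𝕜 (s i)] (p : ∀ i, Submodule 𝕜 (s i)) :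
    Function.Injective (PiTensorProduct.mapIncl p) := by
  choose r hr using fun i => (p i).subtype.exists_leftInverse_of_injective (p i).ker_subtype
  refine Function.LeftInverse.injective (g := PiTensorProduct.map r) fun t => ?_
  rw [PiTensorProduct.mapIncl, ← LinearMap.comp_apply, ← PiTensorProduct.map_comp]
  simp [hr]

theorem finrank_piTensorProduct [Field 𝕜] [∀ i, Module 𝕜 (s i)] [Fintype ι]
    [∀ i, FiniteDimensional 𝕜 (s i)] :
    Module.finrank 𝕜 (⨂[𝕜] i, s i) = ∏ i, Module.finrank 𝕜 (s i) := by
  classical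
  rw [Module.finrank_eq_card_basis (Basis.piTensorProduct fun i => Module.finBasis 𝕜 (s i)),
    Fintype.card_pi]
  simp

variable [CommRing 𝕜] [∀ i, Module 𝕜 (s i)]

theorem map_eq_smul_map {F G : ∀ j, Module.End 𝕜 (s j)} (i : ι) (c : 𝕜) (hi : F i = c • G i)
    (h : ∀ j, j ≠ i → F j = G j) : PiTensorProduct.map F = c • PiTensorProduct.map G := by
  classical
  have hF : F = Function.update G i (c • G i) := by
    funext j
    by_cases hj : j = i
    · subst hj; simp [hi]
    · simp [hj, h]
  rw [hF, PiTensorProduct.map_update_smul, Function.update_eq_self]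

variable [DecidableEq ι]

/-- The action of the endomorphisms of one factor on a tensor product. -/
def singleMap (i : ι) : Module.End 𝕜 (s i) →ₐ[𝕜] Module.End 𝕜 (⨂[𝕜] i, s i) :=
  AlgHom.ofLinearMap ((PiTensorProduct.mapMultilinear 𝕜 s s).toLinearMap 1 i)
    (by
      simp only [MultilinearMap.toLinearMap_apply, PiTensorProduct.mapMultilinear_apply]
      rw [show (1 : Module.End 𝕜 (s i)) = (1 : ∀ i, Module.End 𝕜 (s i)) i from rfl,
        Function.update_eq_self]
      exact PiTensorProduct.map_one)
    (fun f g => by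
      simp only [MultilinearMap.toLinearMap_apply, PiTensorProduct.mapMultilinear_apply]
      rw [← PiTensorProduct.map_mul]
      congr 1
      funext j
      by_cases hj : j = i
      · subst hj; simp
      · simp [hj])

theorem singleMap_apply (i : ι) (f : Module.End 𝕜 (s i)) :
    singleMap i f = PiTensorProduct.map (Function.update (fun _ => 1) i f) := rfl

theorem map_update_mul_map_update {b : ∀ j, Module.End 𝕜 (s j)} (hb : ∀ j, b j * b j = 1) (i : ι)
    (f g : Module.End 𝕜 (s i)) :
    (PiTensorProduct.map (Function.update b i f) * PiTensorProduct.map (Function.update b i g) :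
      Module.End 𝕜 (⨂[𝕜] i, s i)) = singleMap i (f * g) := by
  rw [singleMap_apply, ← PiTensorProduct.map_mul]
  congr 1
  funext j
  by_cases hj : j = i
  · subst hj; simp
  · simp [hj, hb]

theorem list_prod_singleMap (f : ∀ i, Module.End 𝕜 (s i)) {l : List ι} (hl : l.Nodup) :
    (l.map fun i => singleMap i (f i)).prod =
      PiTensorProduct.map fun i => if i ∈ l then f i else 1 := by
  induction l with
  | nil => simp [PiTensorProduct.map_one]
  | cons a l ih =>
    rw [List.nodup_cons] at hl
    rw [List.map_cons, List.prod_cons, ih hl.2, singleMap_apply, ← PiTensorProduct.map_mul]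
    congr 1
    funext j
    by_cases hj : j = a
    · subst hj; simp [hl.1]
    · simp [hj]

end Tensor

/-! ### The Clifford action on the standard fibres -/

namespace ClRep

variable {n : ℕ} {V : Type v} [NormedAddCommGroup V] [NormedSpace ℂ V] (ρ : ClRep n V)

variable {ρ} in
theorem graded_ext {ξ η : ρ.Graded} (h₁ : ((ρ.toProd ξ).1 : V) = (ρ.toProd η).1)
    (h₂ : ((ρ.toProd ξ).2 : V) = (ρ.toProd η).2) : ξ = η :=
  ρ.toProd.injective (Prod.ext (Subtype.ext h₁) (Subtype.ext h₂))

theorem gradedVec_fst (v : Fin n → ℝ) (ξ : ρ.Graded) :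
    ((ρ.toProd (ρ.gradedVec v ξ)).1 : V) = ρ (clVec v) (ρ.toProd ξ).2 := rfl

theorem gradedVec_snd (v : Fin n → ℝ) (ξ : ρ.Graded) :
    ((ρ.toProd (ρ.gradedVec v ξ)).2 : V) = ρ (clVec v) (ρ.toProd ξ).1 := rfl

theorem parity_fst (ξ : ρ.Graded) : ((ρ.toProd (ρ.parity ξ)).1 : V) = (ρ.toProd ξ).1 := rfl

theorem parity_snd (ξ : ρ.Graded) : ((ρ.toProd (ρ.parity ξ)).2 : V) = -(ρ.toProd ξ).2 := rfl

theorem toProd_neg (ξ : ρ.Graded) : ρ.toProd (-ξ) = -ρ.toProd ξ := map_neg _ _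

theorem parity_mul_self : (ρ.parity * ρ.parity : Module.End ℂ ρ.Graded) = 1 := by
  refine LinearMap.ext fun ξ => graded_ext ?_ ?_
  · rw [Module.End.mul_apply, parity_fst, parity_fst, Module.End.one_apply]
  · rw [Module.End.mul_apply, parity_snd, parity_snd, neg_neg, Module.End.one_apply]

theorem gradedVec_mul_parity (v : Fin n → ℝ) :
    (ρ.gradedVec v * ρ.parity : Module.End ℂ ρ.Graded) = -(ρ.parity * ρ.gradedVec v) := by
  refine LinearMap.ext fun ξ => graded_ext ?_ ?_
  · rw [LinearMap.neg_apply, toProd_neg, Prod.fst_neg, Submodule.coe_neg, Module.End.mul_apply,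
      Module.End.mul_apply, gradedVec_fst, parity_snd, parity_fst, gradedVec_fst, map_neg]
  · rw [LinearMap.neg_apply, toProd_neg, Prod.snd_neg, Submodule.coe_neg, Module.End.mul_apply,
      Module.End.mul_apply, gradedVec_snd, parity_fst, parity_snd, gradedVec_snd, neg_neg]

/-- The action of vectors on graded spinors, as a linear map in the vector. -/
def gradedLin : (Fin n → ℝ) →ₗ[ℝ] Module.End ℂ ρ.Graded where
  toFun := ρ.gradedVec
  map_add' v w := by
    refine LinearMap.ext fun ξ => graded_ext ?_ ?_ <;>
      simp [gradedVec_fst, gradedVec_snd, map_add]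
  map_smul' r v := by
    refine LinearMap.ext fun ξ => graded_ext ?_ ?_ <;>
      simp [gradedVec_fst, gradedVec_snd, map_smul, ← Complex.coe_smul]

theorem gradedLin_apply (v : Fin n → ℝ) : ρ.gradedLin v = ρ.gradedVec v := rfl

theorem gradedVec_mul_self (v : Fin n → ℝ) :
    (ρ.gradedVec v * ρ.gradedVec v : Module.End ℂ ρ.Graded) =
      algebraMap ℝ _ (negEuclid n v) := by
  have h : ∀ ξ, ρ (clVec v) (ρ (clVec v) ξ) = ((negEuclid n v : ℝ) : ℂ) • ξ := fun ξ => by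
    rw [← Module.End.mul_apply, ← map_mul, CliffordAlgebra.ι_sq_scalar, AlgHom.commutes,
      Module.algebraMap_end_apply, Complex.coe_smul]
  have hs : ∀ ξ : ρ.Graded, algebraMap ℝ (Module.End ℂ ρ.Graded) (negEuclid n v) ξ =
      ((negEuclid n v : ℝ) : ℂ) • ξ := fun ξ => by
    rw [Module.algebraMap_end_apply, Complex.coe_smul]
  refine LinearMap.ext fun ξ => graded_ext ?_ ?_
  · rw [Module.End.mul_apply, gradedVec_fst, gradedVec_snd, h, hs, map_smul, Prod.smul_fst,
      Submodule.coe_smul]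
  · rw [Module.End.mul_apply, gradedVec_snd, gradedVec_fst, h, hs, map_smul, Prod.smul_snd,
      Submodule.coe_smul]

/-- The representation of the Clifford algebra on the graded spinors, extending the action of the
vectors. -/
def gradedRep : Cl n →ₐ[ℝ] Module.End ℂ ρ.Graded :=
  CliffordAlgebra.lift (negEuclid n) ⟨ρ.gradedLin, ρ.gradedVec_mul_self⟩

theorem gradedRep_clVec (v : Fin n → ℝ) : ρ.gradedRep (clVec v) = ρ.gradedVec v :=
  CliffordAlgebra.lift_ι_apply _ _ _

theorem gradedRep_of_mem_even {a : Cl n} (ha : a ∈ CliffordAlgebra.even (negEuclid n))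
    (ξ : ρ.Graded) : ((ρ.toProd (ρ.gradedRep a ξ)).1 : V) = ρ a (ρ.toProd ξ).1 ∧
      ((ρ.toProd (ρ.gradedRep a ξ)).2 : V) = ρ a (ρ.toProd ξ).2 := by
  refine CliffordAlgebra.even_induction (Q := negEuclid n)
    (motive := fun a _ => ((ρ.toProd (ρ.gradedRep a ξ)).1 : V) = ρ a (ρ.toProd ξ).1 ∧
      ((ρ.toProd (ρ.gradedRep a ξ)).2 : V) = ρ a (ρ.toProd ξ).2) ?_ ?_ ?_ a ha
  · intro r
    rw [AlgHom.commutes, AlgHom.commutes, Module.algebraMap_end_apply,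
      ← Complex.coe_smul, map_smul]
    exact ⟨rfl, rfl⟩
  · intro x y _ _ hx hy
    simp only [map_add, LinearMap.add_apply, Prod.fst_add, Prod.snd_add, Submodule.coe_add, hx, hy,
      and_self]
  · intro v w x _ hx
    change _ = ρ (clVec v * clVec w * x) _ ∧ _ = ρ (clVec v * clVec w * x) _
    rw [show CliffordAlgebra.ι (negEuclid n) v * CliffordAlgebra.ι (negEuclid n) w * x =
      clVec v * clVec w * x from rfl]
    simp only [map_mul, Module.End.mul_apply, gradedRep_clVec, gradedVec_fst, gradedVec_snd, hx,
      and_self]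

theorem gradedVec_mem_diagonal (v : Fin n → ℝ) {ξ : ρ.Graded} (hξ : ξ ∈ ρ.diagonal) :
    ρ.gradedVec v ξ ∈ ρ.diagonal := by
  change ((ρ.toProd _).1 : V) = (ρ.toProd _).2
  rw [gradedVec_fst, gradedVec_snd, show ((ρ.toProd ξ).1 : V) = (ρ.toProd ξ).2 from hξ]

end ClRep

section FiberS

variable {N : ℕ} {D : Fin N → ℕ} {V : Fin N → Type v} [∀ i, NormedAddCommGroup (V i)]
  [∀ i, NormedSpace ℂ (V i)] (ρ : ∀ i, ClRep (D i) (V i))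

/-- The sign operator on the factor number `j` in the action of the vectors of the block number `i`.
In contrast to the multiplication in `W`, the parities of the odd dimensional factors, which do not
preserve the diagonals, are left out. -/
def evenParity (i j : Fin N) : Module.End ℂ (ρ j).Graded :=
  if j < i ∧ Even (D j) then (ρ j).parity else 1

theorem evenParity_mul_self (i j : Fin N) : evenParity ρ i j * evenParity ρ i j = 1 := by
  rw [evenParity]
  split_ifs
  · exact (ρ j).parity_mul_self
  · exact one_mul 1

theorem evenParity_comm (i j k : Fin N) :
    evenParity ρ i k * evenParity ρ j k = evenParity ρ j k * evenParity ρ i k := by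
  rw [evenParity, evenParity]
  split_ifs <;> simp

/-- The action of the vectors of the block number `i`, with signs from the parities of the even
dimensional factors in front. -/
def blockAction (i : Fin N) (v : Fin (D i) → ℝ) : Module.End ℂ (⨂[ℂ] i, (ρ i).Graded) :=
  PiTensorProduct.map (Function.update (evenParity ρ i) i ((ρ i).gradedVec v))

theorem blockAction_mul (i : Fin N) (v w : Fin (D i) → ℝ) :
    blockAction ρ i v * blockAction ρ i w =
      singleMap i ((ρ i).gradedVec v * (ρ i).gradedVec w) :=
  map_update_mul_map_update (evenParity_mul_self ρ i) i _ _

theorem blockAction_mul_blockAction_of_lt {i j : Fin N} (hij : i < j) (v : Fin (D i) → ℝ)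
    (w : Fin (D j) → ℝ) :
    blockAction ρ i v * blockAction ρ j w =
      (if Even (D i) then (-1 : ℂ) else 1) • (blockAction ρ j w * blockAction ρ i v) := by
  have hj : evenParity ρ i j = 1 := if_neg fun h => absurd (h.1.trans hij) (lt_irrefl _)
  simp only [blockAction]
  rw [← PiTensorProduct.map_mul, ← PiTensorProduct.map_mul]
  refine map_eq_smul_map i _ ?_ fun k hk => ?_
  · rw [Function.update_self, Function.update_of_ne hij.ne, evenParity]
    by_cases hi : Even (D i)
    · rw [if_pos ⟨hij, hi⟩, if_pos hi, neg_one_smul, (ρ i).gradedVec_mul_parity v]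
    · rw [if_neg fun h => hi h.2, if_neg hi, one_smul, one_mul, mul_one]
  · rw [Function.update_of_ne hk]
    by_cases hkj : k = j
    · subst hkj
      rw [hj, Function.update_self, one_mul, mul_one]
    · rw [Function.update_of_ne hkj, evenParity_comm]

variable {K : Finset (Fin N)} (hK : K ⊆ Finset.univ.filter fun i => Odd (D i))
include hK

theorem blockAction_mem_fiberS (i : Fin N) (v : Fin (D i) → ℝ) :
    ∀ t ∈ fiberS ρ K, blockAction ρ i v t ∈ fiberS ρ K := by
  suffices h : fiberS ρ K ≤ (fiberS ρ K).comap (blockAction ρ i v) from fun t ht => h ht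
  refine Submodule.span_le.2 ?_
  rintro _ ⟨ξ, hξ, rfl⟩
  refine Submodule.subset_span ⟨fun j => Function.update (evenParity ρ i) i ((ρ i).gradedVec v) j
    (ξ j), fun k hk => ?_, (PiTensorProduct.map_tprod _ _).symm⟩
  by_cases hki : k = i
  · subst hki
    simp only [Function.update_self]
    exact (ρ k).gradedVec_mem_diagonal v (hξ k hk)
  · have hodd : ¬ Even (D k) := Nat.not_even_iff_odd.2 (Finset.mem_filter.1 (hK hk)).2
    simp only [Function.update_of_ne hki, evenParity, if_neg fun h : k < i ∧ Even (D k) => hodd h.2]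
    exact hξ k hk

/-- The action of the vectors of the block number `i` on the standard fibre of `S`. -/
def fiberSLin (i : Fin N) : (Fin (D i) → ℝ) →ₗ[ℝ] Module.End ℂ (fiberS ρ K) where
  toFun v := (blockAction ρ i v).restrict (blockAction_mem_fiberS ρ hK i v)
  map_add' v w := by
    refine LinearMap.ext fun t => Subtype.ext ?_
    change blockAction ρ i (v + w) t = blockAction ρ i v t + blockAction ρ i w t
    rw [← LinearMap.add_apply, blockAction, blockAction, blockAction, ← (ρ i).gradedLin_apply,
      map_add, PiTensorProduct.map_update_add]
    rfl
  map_smul' r v := by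
    refine LinearMap.ext fun t => Subtype.ext ?_
    have h : (ρ i).gradedVec (r • v) = (r : ℂ) • (ρ i).gradedVec v := by
      rw [← (ρ i).gradedLin_apply, map_smul, Complex.coe_smul]
      rfl
    change blockAction ρ i (r • v) t = (r : ℂ) • blockAction ρ i v t
    rw [blockAction, h, PiTensorProduct.map_update_smul]
    rfl

theorem fiberSLin_coe (i : Fin N) (v : Fin (D i) → ℝ) (t : fiberS ρ K) :
    (fiberSLin ρ hK i v t : ⨂[ℂ] i, (ρ i).Graded) = blockAction ρ i v t := rfl

/-- The representation of the Clifford algebra of the block number `i` on the standard fibre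
of `S`. -/
def fiberSRep (i : Fin N) : Cl (D i) →ₐ[ℝ] Module.End ℂ (fiberS ρ K) :=
  CliffordAlgebra.lift (negEuclid (D i)) ⟨fiberSLin ρ hK i, fun v => by
    refine LinearMap.ext fun t => Subtype.ext ?_
    rw [Module.End.mul_apply, fiberSLin_coe, fiberSLin_coe, ← Module.End.mul_apply,
      blockAction_mul, (ρ i).gradedVec_mul_self, Module.algebraMap_end_apply,
      Algebra.algebraMap_eq_smul_one, ← Complex.coe_smul, map_smul, map_one,
      ← Complex.coe_smul]
    rfl⟩

theorem fiberSRep_clVec (i : Fin N) (v : Fin (D i) → ℝ) :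
    fiberSRep ρ hK i (clVec v) = fiberSLin ρ hK i v :=
  CliffordAlgebra.lift_ι_apply _ _ _

theorem fiberSRep_coe_of_mem_even (i : Fin N) {a : Cl (D i)}
    (ha : a ∈ CliffordAlgebra.even (negEuclid (D i))) (t : fiberS ρ K) :
    (fiberSRep ρ hK i a t : ⨂[ℂ] i, (ρ i).Graded) = singleMap i ((ρ i).gradedRep a) t := by
  refine CliffordAlgebra.even_induction (Q := negEuclid (D i))
    (motive := fun a _ => ∀ t : fiberS ρ K, (fiberSRep ρ hK i a t : ⨂[ℂ] i, (ρ i).Graded) =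
      singleMap i ((ρ i).gradedRep a) t) ?_ ?_ ?_ a ha t
  · intro r t
    rw [AlgHom.commutes, AlgHom.commutes, Module.algebraMap_end_apply,
      Algebra.algebraMap_eq_smul_one, ← Complex.coe_smul, ← Complex.coe_smul, map_smul, map_one]
    rfl
  · intro x y _ _ hx hy t
    simp only [map_add, LinearMap.add_apply, Submodule.coe_add, hx, hy]
  · intro v w x _ hx t
    change (fiberSRep ρ hK i (clVec v * clVec w * x) t : ⨂[ℂ] i, (ρ i).Graded) =
      singleMap i ((ρ i).gradedRep (clVec v * clVec w * x)) t
    rw [map_mul, map_mul, fiberSRep_clVec, fiberSRep_clVec, Module.End.mul_apply,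
      Module.End.mul_apply, fiberSLin_coe, fiberSLin_coe, hx,
      ← Module.End.mul_apply (blockAction ρ i v), blockAction_mul,
      map_mul (ρ i).gradedRep, map_mul (ρ i).gradedRep, (ρ i).gradedRep_clVec,
      (ρ i).gradedRep_clVec, map_mul (singleMap i) (_ * _), Module.End.mul_apply]

theorem isBlockSystem_fiberSRep :
    IsBlockSystem (B := Module.End ℂ (fiberS ρ K)) (fiberSRep ρ hK) := by
  have key : ∀ {i j : Fin N} (_ : i < j) (v : Fin (D i) → ℝ) (w : Fin (D j) → ℝ),
      fiberSRep ρ hK i (clVec v) * fiberSRep ρ hK j (clVec w) =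
        (if Even (D i) then (-1 : ℂ) else 1) •
          (fiberSRep ρ hK j (clVec w) * fiberSRep ρ hK i (clVec v)) := by
    intro i j hij v w
    rw [fiberSRep_clVec, fiberSRep_clVec]
    exact LinearMap.ext fun t => Subtype.ext
      (LinearMap.congr_fun (blockAction_mul_blockAction_of_lt ρ hij v w) t.1)
  have neg : ∀ {a b : Module.End ℂ (fiberS ρ K)}, a = (-1 : ℂ) • b → a = -b :=
    fun {_ b} h => h.trans (LinearMap.ext fun t => neg_one_smul ℂ (b t))
  have neg' : ∀ {a b : Module.End ℂ (fiberS ρ K)}, b = (-1 : ℂ) • a → a = -b :=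
    fun h => neg (by rw [h, smul_smul, neg_one_mul, neg_neg, one_smul])
  refine ⟨fun i j hij => ?_, fun i j hij hi hj v w => ?_⟩
  · rcases lt_or_gt_of_ne hij with h | h
    · by_cases hi : Even (D i)
      · exact Or.inr fun v w => neg (by rw [key h, if_pos hi])
      · exact Or.inl fun v w => by rw [key h, if_neg hi, one_smul]
    · by_cases hj : Even (D j)
      · exact Or.inr fun v w => neg' (by rw [key h, if_pos hj])
      · exact Or.inl fun v w => by rw [key h w v, if_neg hj, one_smul]
  · rcases lt_or_gt_of_ne hij with h | h
    · exact neg (by rw [key h, if_pos hi])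
    · exact neg' (by rw [key h, if_pos hj])

omit hK in
/-- The factors of the standard fibre of `S`. -/
def factorS (K : Finset (Fin N)) (i : Fin N) : Submodule ℂ (ρ i).Graded :=
  if i ∈ K then (ρ i).diagonal else ⊤

omit hK in
theorem fiberS_eq_range :
    fiberS ρ K = LinearMap.range (PiTensorProduct.mapIncl (factorS ρ K)) := by
  rw [PiTensorProduct.mapIncl, PiTensorProduct.map_range_eq_span_tprod, fiberS]
  congr 1
  ext t
  constructor
  · rintro ⟨ξ, hξ, rfl⟩
    refine ⟨fun i => ⟨ξ i, ?_⟩, rfl⟩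
    rw [factorS]
    split_ifs with h
    · exact hξ i h
    · trivial
  · rintro ⟨ξ, rfl⟩
    refine ⟨fun i => (ξ i : (ρ i).Graded), fun k hk => ?_, rfl⟩
    have := (ξ k).2
    simp only [factorS, if_pos hk] at this
    exact this

omit hK in
theorem sum_eq_two_mul_sum_div_two_add_card_odd {ι : Type*} [Fintype ι] (D : ι → ℕ) :
    ∑ i, D i = 2 * ∑ i, D i / 2 + (Finset.univ.filter fun i => Odd (D i)).card := by
  rw [Finset.card_filter, Finset.mul_sum, ← Finset.sum_add_distrib]
  refine Finset.sum_congr rfl fun i _ => ?_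
  split_ifs with h
  · have := Nat.odd_iff.1 h
    omega
  · have := Nat.even_iff.1 (Nat.not_odd_iff_even.1 h)
    omega

variable [∀ i, FiniteDimensional ℂ (V i)] (hρ : ∀ i, (ρ i).IsSpinorModule)
include hρ

theorem finrank_factorS (i : Fin N) :
    Module.finrank ℂ (factorS ρ K i) =
      2 ^ (D i / 2 + if i ∈ (Finset.univ.filter fun i => Odd (D i)) \ K then 1 else 0) := by
  rw [factorS]
  by_cases hi : i ∈ K
  · rw [if_pos hi, (ρ i).finrank_diagonal_of_odd (Finset.mem_filter.1 (hK hi)).2,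
      (hρ i).finrank_eq, if_neg (by simp [hi]), add_zero]
  · rw [if_neg hi, finrank_top]
    by_cases hodd : Odd (D i)
    · rw [(ρ i).finrank_graded_of_odd hodd, (hρ i).finrank_eq, if_pos (by simp [hi, hodd]),
        pow_succ, mul_comm]
    · rw [(ρ i).finrank_graded_of_even (Nat.not_odd_iff_even.1 hodd), (hρ i).finrank_eq,
        if_neg (by simp [hodd]), add_zero]

variable (hKcard : K.card = (Finset.univ.filter fun i => Odd (D i)).card -
  (Finset.univ.filter fun i => Odd (D i)).card / 2)
include hKcard

theorem finrank_fiberS : Module.finrank ℂ (fiberS ρ K) = 2 ^ ((∑ i, D i) / 2) := by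
  rw [fiberS_eq_range, LinearMap.finrank_range_of_inj (mapIncl_injective _),
    finrank_piTensorProduct, Finset.prod_congr rfl fun i _ => finrank_factorS ρ hK hρ i,
    Finset.prod_pow_eq_pow_sum, Finset.sum_add_distrib]
  have hcard := Finset.card_sdiff_of_subset hK
  have hsum := sum_eq_two_mul_sum_div_two_add_card_odd D
  rw [← Finset.card_filter, Finset.filter_mem_eq_inter, Finset.univ_inter, hcard, hKcard]
  congr 1
  omega

theorem exists_fiberS_equiv {V' : Type w} [NormedAddCommGroup V'] [NormedSpace ℂ V']
    [FiniteDimensional ℂ V'] (ρ' : ClRep (∑ i, D i) V') (hρ' : ρ'.IsSpinorModule) :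
    ∃ Ψ : V' ≃ₗ[ℂ] fiberS ρ K, ∀ i, ∀ a ∈ CliffordAlgebra.even (negEuclid (D i)), ∀ ξ,
      (Ψ (ρ' (embCl i a) ξ) : ⨂[ℂ] i, (ρ i).Graded) =
        singleMap i ((ρ i).gradedRep a) (Ψ ξ : ⨂[ℂ] i, (ρ i).Graded) := by
  obtain ⟨Ψ, hΨ⟩ := (isBlockSystem_comp_embCl ρ').exists_intertwiner
    (isBlockSystem_fiberSRep ρ hK)
    (hρ'.finrank_eq.trans (finrank_fiberS ρ hK hρ hKcard).symm)
  refine ⟨Ψ, fun i a ha ξ => ?_⟩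
  rw [← fiberSRep_coe_of_mem_even ρ hK i ha, ← hΨ i a ha ξ, AlgHom.comp_apply]

end FiberS

/-! ### Twisted lifts of orthogonal maps -/

section Twisted

variable {n : ℕ}

open CliffordAlgebra (involute)
open InnerProductSpace

/-- The element `s` of the Clifford algebra covers the map that sends the standard basis vectors to
the elements `w a`, for the twisted adjoint representation. -/
def IsTwistedLift (w : Fin n → Cl n) (s : Cl n) : Prop :=
  ∀ a, s * clE a = w a * involute s

/-- The operator whose fixed points are the `s` with `s * clE a = w a * involute s`. -/
def twistOp (w : Fin n → Cl n) (a : Fin n) : Module.End ℝ (Cl n) :=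
  -(LinearMap.mulRight ℝ (clE a) ∘ₗ LinearMap.mulLeft ℝ (w a) ∘ₗ
    (involute (Q := negEuclid n)).toLinearMap)

theorem twistOp_apply (w : Fin n → Cl n) (a : Fin n) (y : Cl n) :
    twistOp w a y = -(w a * involute y * clE a) := rfl

/-- If there are twisted lifts for `w`, the projection of the Clifford algebra to the line that they
span. As it is polynomial in `w`, it selects lifts that depend smoothly on `w`. -/
def twistAvg (w : Fin n → Cl n) : Module.End ℝ (Cl n) :=
  signAverage ℝ (twistOp w) (List.finRange n)

theorem twistOp_clE_finsetWord (a : Fin n) (I : Finset (Fin n)) :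
    twistOp clE a (finsetWord clE I) = (if a ∈ I then -1 else 1 : ℤˣ) • finsetWord clE I := by
  have hinv : involute (finsetWord clE I : Cl n) = ((-1 : ℤˣ) ^ I.card) • finsetWord clE I := by
    have h : (I.toList.map (clE : Fin n → Cl n)) =
        (I.toList.map fun a => (Pi.single a 1 : Fin n → ℝ)).map
          (CliffordAlgebra.ι (negEuclid n)) := by
      rw [List.map_map]; rfl
    rw [finsetWord, h, CliffordAlgebra.involute_prod_map_ι, List.length_map, Finset.length_toList]
    rcases Nat.even_or_odd I.card with hI | hI <;> simp [hI.neg_one_pow, Units.neg_smul]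
  have hsign : (-1 : ℤˣ) ^ I.card * ∏ s ∈ I, classSign (fun _ => ()) a s =
      if a ∈ I then -1 else 1 := by
    rw [← Finset.prod_const, ← Finset.prod_mul_distrib, ← Finset.prod_ite_eq I a fun _ => (-1 : ℤˣ)]
    refine Finset.prod_congr rfl fun s _ => ?_
    by_cases h : a = s <;> simp [classSign, h]
  rw [twistOp_apply, hinv, mul_smul_comm, isPauliSystem_clE.mul_finsetWord, smul_smul, hsign,
    smul_mul_assoc, mul_assoc, clE_mul_self, mul_neg_one, smul_neg, neg_neg]

theorem exists_twistAvg_clE_eq_algebraMap (z : Cl n) :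
    ∃ r : ℝ, twistAvg clE z = algebraMap ℝ (Cl n) r := by
  have hz : z ∈ Submodule.span ℝ (Set.range (finsetWord clE)) := by
    rw [isPauliSystem_clE.span_finsetWord_eq_top adjoin_range_clE]
    trivial
  induction hz using Submodule.span_induction with
  | mem x hx =>
    obtain ⟨I, rfl⟩ := hx
    rcases I.eq_empty_or_nonempty with rfl | ⟨a, ha⟩
    · refine ⟨1, ?_⟩
      rw [map_one, twistAvg, finsetWord_empty]
      exact signAverage_eq_self fun a _ => by simpa using twistOp_clE_finsetWord a ∅
    · refine ⟨0, ?_⟩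
      rw [map_zero, twistAvg]
      refine signAverage_eq_zero (fun b _ => ?_) ⟨a, List.mem_finRange a, ?_⟩
      · rw [twistOp_clE_finsetWord]
        split_ifs <;> simp
      · rw [twistOp_clE_finsetWord, if_pos ha, Units.neg_smul, one_smul]
  | zero => exact ⟨0, by simp⟩
  | add x y _ _ hx hy =>
    obtain ⟨⟨r, hr⟩, r', hr'⟩ := And.intro hx hy
    exact ⟨r + r', by rw [map_add, hr, hr', map_add]⟩
  | smul r x _ hx =>
    obtain ⟨r', hr'⟩ := hx
    exact ⟨r * r', by rw [map_smul, hr', map_mul, Algebra.smul_def]⟩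

namespace IsTwistedLift

variable {w : Fin n → Cl n} {s s' : Cl n}

theorem twistAvg_mul (hs : IsTwistedLift w s) (z : Cl n) :
    twistAvg w (s * z) = s * twistAvg clE z := by
  have hop : ∀ a z, twistOp w a (s * z) = s * twistOp clE a z := fun a z => by
    rw [twistOp_apply, twistOp_apply, map_mul, ← mul_assoc (w a), ← hs a, mul_neg]
    simp only [mul_assoc]
  simp only [twistAvg]
  induction List.finRange n with
  | nil => simp [signAverage]
  | cons a l ih => rw [signAverage_cons, signAverage_cons, ih, hop, mul_smul_comm, mul_add]

theorem twistAvg_self (hs : IsTwistedLift w s) : twistAvg w s = s :=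
  signAverage_eq_self fun a _ => by
    rw [twistOp_apply, ← hs a, mul_assoc, clE_mul_self, mul_neg_one, neg_neg]

end IsTwistedLift

/-- A twisted lift which is a unit with inverse its image under the involution `star`, that is, an
element of the group `Pin n` that covers `w`. -/
structure IsUnitLift (w : Fin n → Cl n) (s : Cl n) : Prop where
  mul_star : s * star s = 1
  star_mul : star s * s = 1
  lift : IsTwistedLift w s

namespace IsUnitLift

variable {w : Fin n → Cl n} {s s' : Cl n}

theorem neg (h : IsUnitLift w s) : IsUnitLift w (-s) where
  mul_star := by rw [star_neg, neg_mul_neg, h.mul_star]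
  star_mul := by rw [star_neg, neg_mul_neg, h.star_mul]
  lift a := by rw [neg_mul, map_neg, mul_neg, h.lift a]

theorem exists_twistAvg_eq_smul (h : IsUnitLift w s) (y : Cl n) :
    ∃ r : ℝ, twistAvg w y = r • s := by
  obtain ⟨r, hr⟩ := exists_twistAvg_clE_eq_algebraMap (star s * y)
  refine ⟨r, ?_⟩
  have := h.lift.twistAvg_mul (star s * y)
  rwa [← mul_assoc, h.mul_star, one_mul, hr, ← Algebra.commutes, ← Algebra.smul_def] at this

theorem eq_or_eq_neg (h : IsUnitLift w s) (h' : IsUnitLift w s') : s' = s ∨ s' = -s := by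
  obtain ⟨r, hr⟩ := h.exists_twistAvg_eq_smul s'
  rw [h'.lift.twistAvg_self] at hr
  have : algebraMap ℝ (Cl n) (r * r) = algebraMap ℝ (Cl n) 1 := by
    have h1 := h'.star_mul
    rw [hr, CliffordAlgebra.star_smul, smul_mul_smul_comm, h.star_mul, Algebra.smul_def,
      mul_one] at h1
    rw [h1, map_one]
  rcases mul_self_eq_one_iff.1 ((algebraMap ℝ (Cl n)).injective this) with e | e
  · exact Or.inl (by rw [hr, e, one_smul])
  · exact Or.inr (by rw [hr, e, neg_one_smul])

end IsUnitLift

theorem clVec_mul_clVec_add_swap (v w : Fin n → ℝ) :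
    clVec v * clVec w + clVec w * clVec v = algebraMap ℝ (Cl n) (-2 * ∑ a, v a * w a) := by
  rw [CliffordAlgebra.ι_mul_ι_add_swap, QuadraticMap.polar, negEuclid_apply, negEuclid_apply,
    negEuclid_apply]
  congr 1
  simp only [Pi.add_apply, Finset.mul_sum, ← Finset.sum_neg_distrib, ← Finset.sum_sub_distrib]
  exact Finset.sum_congr rfl fun a _ => by ring

theorem clVec_mul_clVec_mul_clVec (u v : Fin n → ℝ) :
    clVec u * clVec v * clVec u =
      clVec ((∑ a, u a * u a) • v - (2 * ∑ a, u a * v a) • u) := by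
  rw [eq_sub_of_add_eq (clVec_mul_clVec_add_swap u v), sub_mul, mul_assoc, clVec_mul_self,
    ← Algebra.commutes, ← Algebra.smul_def, ← Algebra.smul_def]
  simp only [clVec, map_sub, map_smul, neg_mul, neg_smul]
  abel

theorem exists_twistedLift_reflection (u : EuclideanSpace ℝ (Fin n)) :
    ∃ t : Cl n, t * star t = 1 ∧ star t * t = 1 ∧ ∀ v, t * clVec (WithLp.ofLp v) =
      clVec (WithLp.ofLp ((ℝ ∙ u)ᗮ.reflection v)) * involute t := by
  by_cases hu : u = 0
  · refine ⟨1, by simp, by simp, fun v => ?_⟩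
    rw [Submodule.reflection_mem_subspace_eq_self, map_one, one_mul, mul_one]
    simp [hu]
  wlog hnorm : ‖u‖ = 1 generalizing u
  · have := this (‖u‖⁻¹ • u) (by simp [hu]) (norm_smul_inv_norm hu)
    have hspan : (ℝ ∙ (‖u‖⁻¹ • u)) = ℝ ∙ u :=
      Submodule.span_singleton_smul_eq (by simp [hu]) u
    simpa only [hspan] using this
  have hone : ∑ a, u a * u a = 1 := by
    rw [← one_mul (1 : ℝ), ← hnorm, ← real_inner_self_eq_norm_mul_norm, PiLp.inner_apply]
    rfl
  have hsq : clVec (WithLp.ofLp u) * clVec (WithLp.ofLp u) = -1 := by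
    rw [clVec_mul_self, hone, map_neg, map_one]
  refine ⟨clVec (WithLp.ofLp u), ?_, ?_, fun v => ?_⟩
  · rw [CliffordAlgebra.star_ι, mul_neg, hsq, neg_neg]
  · rw [CliffordAlgebra.star_ι, neg_mul, hsq, neg_neg]
  · have hrefl : (ℝ ∙ u)ᗮ.reflection v = v - (2 * ∑ a, u a * v a) • u := by
      rw [Submodule.reflection_orthogonal_apply, Submodule.reflection_singleton_apply, neg_sub,
        hnorm, ← Nat.cast_smul_eq_nsmul ℝ, smul_smul, PiLp.inner_apply]
      simp [mul_comm]
    have h := clVec_mul_clVec_mul_clVec (WithLp.ofLp u) (WithLp.ofLp v)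
    rw [hone, one_smul] at h
    rw [hrefl, WithLp.ofLp_sub, WithLp.ofLp_smul, ← h, CliffordAlgebra.involute_ι, mul_assoc,
      mul_neg, hsq, neg_neg, mul_one]

theorem exists_twistedLift_linearIsometryEquiv
    (φ : EuclideanSpace ℝ (Fin n) ≃ₗᵢ[ℝ] EuclideanSpace ℝ (Fin n)) :
    ∃ s : Cl n, s * star s = 1 ∧ star s * s = 1 ∧
      ∀ v, s * clVec (WithLp.ofLp v) = clVec (WithLp.ofLp (φ v)) * involute s := by
  obtain ⟨l, -, rfl⟩ := φ.reflections_generate_dim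
  induction l with
  | nil => exact ⟨1, by simp, by simp, fun v => by simp⟩
  | cons u l ih =>
    obtain ⟨s, h1, h2, hs⟩ := ih
    obtain ⟨t, h1', h2', ht⟩ := exists_twistedLift_reflection u
    refine ⟨t * s, ?_, ?_, fun v => ?_⟩
    · rw [star_mul, mul_assoc, ← mul_assoc s, h1, one_mul, h1']
    · rw [star_mul, mul_assoc, ← mul_assoc (star t), h2', one_mul, h2]
    · rw [mul_assoc, hs, ← mul_assoc, ht, List.map_cons, List.prod_cons, map_mul, mul_assoc]
      rfl

theorem exists_isUnitLift (R : Fin n → Fin n → ℝ)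
    (hR : ∀ a b, ∑ k, R a k * R b k = if a = b then 1 else 0) :
    ∃ s : Cl n, IsUnitLift (fun a => clVec (R a)) s := by
  let r : Fin n → EuclideanSpace ℝ (Fin n) := fun a => WithLp.toLp 2 (R a)
  have hr : Orthonormal ℝ r := by
    rw [orthonormal_iff_ite]
    intro a b
    rw [← hR a b, PiLp.inner_apply]
    simp [r, mul_comm]
  have hspan : ⊤ ≤ Submodule.span ℝ (Set.range r) :=
    (hr.linearIndependent.span_eq_top_of_card_eq_finrank' (by simp)).ge
  let b := OrthonormalBasis.mk hr hspan
  let φ := (EuclideanSpace.basisFun (Fin n) ℝ).equiv b (Equiv.refl _)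
  obtain ⟨s, h1, h2, hs⟩ := exists_twistedLift_linearIsometryEquiv φ
  refine ⟨s, h1, h2, fun a => ?_⟩
  have hφ : φ (EuclideanSpace.basisFun (Fin n) ℝ a) = r a := by
    simp only [φ, OrthonormalBasis.equiv_apply_basis]
    simp [b]
  have := hs (EuclideanSpace.basisFun (Fin n) ℝ a)
  rw [hφ] at this
  simpa [r] using this

end Twisted

/-! ### Smooth maps into finite dimensional spaces without a norm -/

section WeakSmooth

variable {E : Type*} [NormedAddCommGroup E] [NormedSpace ℝ E] {H : Type*} [TopologicalSpace H]
  (I : ModelWithCorners ℝ E H) {M : Type*} [TopologicalSpace M] [ChartedSpace H M]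
  {F G P : Type*} [AddCommGroup F] [Module ℝ F] [AddCommGroup G] [Module ℝ G]
  [AddCommGroup P] [Module ℝ P]

/-- A map into a finite dimensional space is smooth at a point if its composites with all linear
functionals are. -/
def WeakSmoothAt (f : M → F) (x : M) : Prop :=
  ∀ φ : F →ₗ[ℝ] ℝ, ContMDiffAt I 𝓘(ℝ, ℝ) ∞ (fun y => φ (f y)) x

variable {I} {x : M}

namespace WeakSmoothAt

theorem congr {f f' : M → F} (h : WeakSmoothAt I f x) (hf : f' =ᶠ[𝓝 x] f) :
    WeakSmoothAt I f' x :=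
  fun φ => (h φ).congr_of_eventuallyEq (hf.fun_comp φ)

theorem const (c : F) : WeakSmoothAt I (fun _ : M => c) x := fun _ => contMDiffAt_const

theorem sum {κ : Type*} (s : Finset κ) {f : κ → M → F} (h : ∀ k ∈ s, WeakSmoothAt I (f k) x) :
    WeakSmoothAt I (fun y => ∑ k ∈ s, f k y) x := fun φ => by
  simp only [map_sum]
  exact ContMDiffAt.sum fun k hk => h k hk φ

theorem linear (L : F →ₗ[ℝ] G) {f : M → F} (h : WeakSmoothAt I f x) :
    WeakSmoothAt I (fun y => L (f y)) x := fun φ => h (φ ∘ₗ L)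

theorem smul {r : M → ℝ} {f : M → F} (hr : ContMDiffAt I 𝓘(ℝ, ℝ) ∞ r x)
    (h : WeakSmoothAt I f x) : WeakSmoothAt I (fun y => r y • f y) x := fun φ => by
  simp only [map_smul]
  exact hr.mul (h φ)

theorem sub {f f' : M → F} (h : WeakSmoothAt I f x) (h' : WeakSmoothAt I f' x) :
    WeakSmoothAt I (fun y => f y - f' y) x := fun φ => by
  simp only [map_sub]
  exact (h φ).sub (h' φ)

theorem bilinear [Module.Finite ℝ F] (B : F →ₗ[ℝ] G →ₗ[ℝ] P) {f : M → F} {f' : M → G}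
    (h : WeakSmoothAt I f x) (h' : WeakSmoothAt I f' x) :
    WeakSmoothAt I (fun y => B (f y) (f' y)) x := by
  let b := Module.finBasis ℝ F
  have : (fun y => B (f y) (f' y)) = fun y => ∑ k, b.coord k (f y) • B (b k) (f' y) := by
    funext y
    conv_lhs => rw [← b.sum_repr (f y)]
    rw [map_sum, LinearMap.sum_apply]
    exact Finset.sum_congr rfl fun k _ => by rw [map_smul, LinearMap.smul_apply, b.coord_apply]
  rw [this]
  exact sum _ fun k _ => smul (h _) (h'.linear _)

theorem mul {R : Type*} [Ring R] [Algebra ℝ R] [Module.Finite ℝ R] {f f' : M → R}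
    (h : WeakSmoothAt I f x) (h' : WeakSmoothAt I f' x) :
    WeakSmoothAt I (fun y => f y * f' y) x :=
  bilinear (LinearMap.mul ℝ R) h h'

theorem contMDiffAt {F : Type*} [NormedAddCommGroup F] [NormedSpace ℝ F] [FiniteDimensional ℝ F]
    {f : M → F} (h : WeakSmoothAt I f x) : ContMDiffAt I 𝓘(ℝ, F) ∞ f x := by
  let b := Module.finBasis ℝ F
  have : f = fun y => ∑ k, b.coord k (f y) • b k := by
    funext y
    exact (b.sum_repr (f y)).symm
  rw [this]
  exact ContMDiffAt.sum fun k _ => (h _).smul contMDiffAt_const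

theorem of_contMDiffAt {F : Type*} [NormedAddCommGroup F] [NormedSpace ℝ F]
    [FiniteDimensional ℝ F] {f : M → F} (h : ContMDiffAt I 𝓘(ℝ, F) ∞ f x) :
    WeakSmoothAt I f x := fun φ =>
  (LinearMap.toContinuousLinearMap φ).contMDiff.contMDiffAt.comp x h

end WeakSmoothAt

end WeakSmooth

/-! ### Smooth local lifts -/

section LocalLift

variable {n : ℕ}

/-- A linear functional on the Clifford algebra with value `1` at the unit; it reads off the scalar
by which a multiple of the unit differs from the unit. -/
def unitFunctional (n : ℕ) : Cl n →ₗ[ℝ] ℝ :=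
  Classical.choose (LinearMap.exists_leftInverse_of_injective (Algebra.linearMap ℝ (Cl n))
    (LinearMap.ker_eq_bot.2 (algebraMap ℝ (Cl n)).injective))

theorem unitFunctional_algebraMap (r : ℝ) : unitFunctional n (algebraMap ℝ (Cl n) r) = r :=
  LinearMap.congr_fun (Classical.choose_spec
    (LinearMap.exists_leftInverse_of_injective (Algebra.linearMap ℝ (Cl n))
      (LinearMap.ker_eq_bot.2 (algebraMap ℝ (Cl n)).injective))) r

theorem unitFunctional_one : unitFunctional n 1 = 1 := by
  simpa using unitFunctional_algebraMap (n := n) 1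

/-- The involution `star` of the Clifford algebra as a linear map. -/
def clStar (n : ℕ) : Cl n →ₗ[ℝ] Cl n where
  toFun := star
  map_add' := star_add
  map_smul' r x := CliffordAlgebra.star_smul r x

variable {w : Fin n → Cl n} {s s' : Cl n}

theorem IsUnitLift.inv_sqrt_smul (h : IsUnitLift w s) {T : Cl n} {r : ℝ} (hT : T = r • s)
    (hpos : 0 < unitFunctional n (T * star T)) :
    IsUnitLift w ((√(unitFunctional n (T * star T)))⁻¹ • T) := by
  have hν : unitFunctional n (T * star T) = r * r := by
    rw [hT, CliffordAlgebra.star_smul, smul_mul_smul_comm, h.mul_star,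
      ← Algebra.algebraMap_eq_smul_one, unitFunctional_algebraMap]
  have hr : r ≠ 0 := by
    rintro rfl
    simp [hν] at hpos
  rw [hν, Real.sqrt_mul_self_eq_abs, hT, smul_smul]
  rcases lt_or_gt_of_ne hr with hr' | hr'
  · rw [abs_of_neg hr', inv_neg, neg_mul, inv_mul_cancel₀ hr, neg_one_smul]
    exact h.neg
  · rw [abs_of_pos hr', inv_mul_cancel₀ hr, one_smul]
    exact h

theorem IsUnitLift.eq_and_one_or_eq_neg_and_neg_one (h : IsUnitLift w s) (h' : IsUnitLift w s') :
    (s' = s ∧ unitFunctional n (star s * s') = 1) ∨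
      (s' = -s ∧ unitFunctional n (star s * s') = -1) := by
  rcases h.eq_or_eq_neg h' with e | e
  · exact Or.inl ⟨e, by rw [e, h.star_mul, unitFunctional_one]⟩
  · exact Or.inr ⟨e, by rw [e, mul_neg, h.star_mul, map_neg, unitFunctional_one]⟩

theorem IsUnitLift.eq_of_unitFunctional_pos (h : IsUnitLift w s) (h' : IsUnitLift w s')
    (hpos : 0 < unitFunctional n (star s * s')) : s' = s := by
  rcases h.eq_and_one_or_eq_neg_and_neg_one h' with ⟨e, -⟩ | ⟨-, e⟩
  · exact e
  · rw [e] at hpos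
    norm_num at hpos

namespace IsUnitLift

theorem ne_zero (hs : IsUnitLift w s) : s ≠ 0 := by
  rintro rfl
  simpa using hs.mul_star

theorem sign_eq (hs : IsUnitLift w s) {ε ε' : ℤˣ} (h : ε • s = ε' • s) : ε = ε' := by
  by_contra hne
  rw [Int.units_ne_iff_eq_neg.1 hne, Units.neg_smul, neg_eq_iff_add_eq_zero, ← two_smul ℝ,
    smul_eq_zero_iff_right two_ne_zero, Units.smul_def] at h
  rcases Int.units_eq_one_or ε' with rfl | rfl
  · exact hs.ne_zero (by simpa using h)
  · exact hs.ne_zero (by simpa using h)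

theorem exists_sign (hs : IsUnitLift w s) (hs' : IsUnitLift w s') : ∃ ε : ℤˣ, s' = ε • s := by
  rcases hs.eq_or_eq_neg hs' with h | h
  · exact ⟨1, by rw [h, one_smul]⟩
  · exact ⟨-1, by rw [h, Units.neg_smul, one_smul]⟩

theorem sign_smul (hs : IsUnitLift w s) (ε : ℤˣ) : IsUnitLift w (ε • s) := by
  rcases Int.units_eq_one_or ε with rfl | rfl
  · rwa [one_smul]
  · rw [Units.neg_smul, one_smul]
    exact hs.neg

end IsUnitLift

variable {E : Type*} [NormedAddCommGroup E] [NormedSpace ℝ E] {H : Type*} [TopologicalSpace H]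
  {I : ModelWithCorners ℝ E H} {M : Type*} [TopologicalSpace M] [ChartedSpace H M]

theorem WeakSmoothAt.clStar {f : M → Cl n} {x : M} (h : WeakSmoothAt I f x) :
    WeakSmoothAt I (fun y => star (f y)) x :=
  h.linear (_root_.clStar n)

theorem WeakSmoothAt.twistAvg {w : M → Fin n → Cl n} {x : M}
    (hw : ∀ a, WeakSmoothAt I (fun y => w y a) x) (s : Cl n) :
    WeakSmoothAt I (fun y => twistAvg (w y) s) x := by
  simp only [_root_.twistAvg]
  induction List.finRange n with
  | nil => exact WeakSmoothAt.const s
  | cons a l ih =>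
    simp only [signAverage_cons, twistOp_apply, ← sub_eq_add_neg]
    exact .smul contMDiffAt_const (ih.sub (((hw a).mul
      (ih.linear (CliffordAlgebra.involute (Q := negEuclid n)).toLinearMap)).mul (.const _)))

theorem exists_weakSmooth_isUnitLift {U : Set M} (hU : IsOpen U) {x₀ : M} (hx₀ : x₀ ∈ U)
    (w : M → Fin n → Cl n) (hw : ∀ x ∈ U, ∀ a, WeakSmoothAt I (fun y => w y a) x)
    (hlift : ∀ x ∈ U, ∃ s, IsUnitLift (w x) s) :
    ∃ (U' : Set M) (s : M → Cl n), IsOpen U' ∧ x₀ ∈ U' ∧ U' ⊆ U ∧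
      (∀ x ∈ U', WeakSmoothAt I s x) ∧ ∀ x ∈ U', IsUnitLift (w x) (s x) := by
  obtain ⟨s₀, hs₀⟩ := hlift x₀ hx₀
  let T : M → Cl n := fun x => twistAvg (w x) s₀
  let ν : M → ℝ := fun x => unitFunctional n (T x * star (T x))
  have hT : ∀ x ∈ U, WeakSmoothAt I T x := fun x hx => WeakSmoothAt.twistAvg (hw x hx) s₀
  have hν : ∀ x ∈ U, ContMDiffAt I 𝓘(ℝ, ℝ) ∞ ν x := fun x hx =>
    ((hT x hx).mul (hT x hx).clStar) _
  have hνc : ContinuousOn ν U := fun x hx => (hν x hx).continuousAt.continuousWithinAt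
  have hν₀ : ν x₀ = 1 := by
    simp only [ν, T]
    rw [hs₀.lift.twistAvg_self, hs₀.mul_star, unitFunctional_one]
  refine ⟨U ∩ ν ⁻¹' Set.Ioi 0, fun x => (√(ν x))⁻¹ • T x,
    hνc.isOpen_inter_preimage hU isOpen_Ioi, ⟨hx₀, by simp [hν₀]⟩, Set.inter_subset_left, ?_, ?_⟩
  · rintro x ⟨hx, hpos⟩
    have hsqrt : ContDiffAt ℝ ∞ (fun r : ℝ => (√r)⁻¹) (ν x) :=
      (Real.contDiffAt_sqrt (ne_of_gt hpos)).inv (Real.sqrt_pos.2 hpos).ne'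
    exact WeakSmoothAt.smul (hsqrt.contMDiffAt.comp x (hν x hx)) (hT x hx)
  · rintro x ⟨hx, hpos⟩
    obtain ⟨s, hs⟩ := hlift x hx
    obtain ⟨r, hr⟩ := hs.exists_twistAvg_eq_smul s₀
    exact hs.inv_sqrt_smul hr hpos

theorem eventually_eq_or_eq_neg_of_isUnitLift {w : M → Fin n → Cl n} {s s' : M → Cl n} {x : M}
    (hs : WeakSmoothAt I s x) (hs' : WeakSmoothAt I s' x)
    (hsw : ∀ᶠ y in 𝓝 x, IsUnitLift (w y) (s y)) (hsw' : ∀ᶠ y in 𝓝 x, IsUnitLift (w y) (s' y)) :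
    (∀ᶠ y in 𝓝 x, s' y = s y) ∨ ∀ᶠ y in 𝓝 x, s' y = -s y := by
  have hc : ContinuousAt (fun y => unitFunctional n (star (s y) * s' y)) x :=
    ((hs.clStar.mul hs') _).continuousAt
  rcases hsw.self_of_nhds.eq_and_one_or_eq_neg_and_neg_one hsw'.self_of_nhds with
    ⟨-, e⟩ | ⟨-, e⟩
  · left
    filter_upwards [hsw, hsw', hc.eventually_mem (Ioi_mem_nhds (e ▸ one_pos))] with y h h' hy
    exact h.eq_of_unitFunctional_pos h' hy
  · right
    filter_upwards [hsw, hsw', hc.eventually_mem (Iio_mem_nhds (e ▸ neg_one_lt_zero))]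
      with y h h' hy
    refine h.neg.eq_of_unitFunctional_pos h' ?_
    rw [star_neg, neg_mul, map_neg]
    exact neg_pos.2 hy

theorem exists_continuousOn_sign {W : Set M} (hW : IsOpen W) {w : M → Fin n → Cl n}
    {s s' : M → Cl n} (hs : ∀ y ∈ W, WeakSmoothAt I s y) (hs' : ∀ y ∈ W, WeakSmoothAt I s' y)
    (hsw : ∀ y ∈ W, IsUnitLift (w y) (s y)) (hsw' : ∀ y ∈ W, IsUnitLift (w y) (s' y)) :
    ∃ ε : M → ℤˣ, ContinuousOn ε W ∧ ∀ y ∈ W, s' y = ε y • s y := by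
  have hex : ∀ y, ∃ ε : ℤˣ, y ∈ W → s' y = ε • s y := fun y => by
    by_cases hy : y ∈ W
    · exact ((hsw y hy).exists_sign (hsw' y hy)).imp fun ε h _ => h
    · exact ⟨1, fun h => absurd h hy⟩
  choose ε hε using hex
  refine ⟨ε, fun y hy => ContinuousAt.continuousWithinAt ?_, hε⟩
  have hconst : ∀ c : ℤˣ, (∀ᶠ z in 𝓝 y, s' z = c • s z) → ContinuousAt ε y := fun c hc => by
    refine (continuousAt_const (y := c)).congr ?_
    filter_upwards [hW.mem_nhds hy, hc] with z hz hz'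
    exact (hsw z hz).sign_eq (hz'.symm.trans (hε z hz))
  rcases eventually_eq_or_eq_neg_of_isUnitLift (hs y hy) (hs' y hy)
    (Filter.eventually_of_mem (hW.mem_nhds hy) hsw)
    (Filter.eventually_of_mem (hW.mem_nhds hy) hsw') with h | h
  · exact hconst 1 (h.mono fun z hz => by rw [hz, one_smul])
  · exact hconst (-1) (h.mono fun z hz => by rw [hz, Units.neg_smul, one_smul])

end LocalLift

section SignCocycle

variable {X ι : Type*} [TopologicalSpace X]

/-- The two-fold covering defined by a locally constant cocycle of signs. -/
def signBundle (U : ι → Set X) (hU : ∀ j, IsOpen (U j)) (k : X → ι) (hk : ∀ x, x ∈ U (k x))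
    (ε : ι → ι → X → ℤˣ) (hε : ∀ i j, ContinuousOn (ε i j) (U i ∩ U j))
    (hcoc : ∀ i j l, ∀ x ∈ U i ∩ U j ∩ U l, ε i j x * ε j l x = ε i l x) :
    FiberBundleCore ι X ℤˣ where
  baseSet := U
  isOpen_baseSet := hU
  indexAt := k
  mem_baseSet_at := hk
  coordChange i j x v := ε i j x * v
  coordChange_self i x hx v := by
    rw [mul_eq_left.1 (hcoc i i i x ⟨⟨hx, hx⟩, hx⟩), one_mul]
  continuousOn_coordChange i j :=
    ((hε i j).comp continuousOn_fst fun _ h => h.1).mul continuousOn_snd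
  coordChange_comp i j l x hx v := by
    rw [← hcoc i j l x hx, mul_comm (ε i j x) (ε j l x), mul_assoc]

theorem exists_sign_coboundary [SimplyConnectedSpace X] [LocallyPathConnectedSpace X]
    (U : ι → Set X) (hU : ∀ j, IsOpen (U j)) (k : X → ι) (hk : ∀ x, x ∈ U (k x))
    (ε : ι → ι → X → ℤˣ) (hε : ∀ i j, ContinuousOn (ε i j) (U i ∩ U j))
    (hcoc : ∀ i j l, ∀ x ∈ U i ∩ U j ∩ U l, ε i j x * ε j l x = ε i l x) :
    ∃ η : ι → X → ℤˣ, (∀ j, ContinuousOn (η j) (U j)) ∧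
      ∀ i j, ∀ x ∈ U i ∩ U j, η j x = ε i j x * η i x := by
  let Z := signBundle U hU k hk ε hε hcoc
  have hcov : IsCoveringMap (π ℤˣ Z.Fiber) := FiberBundle.isCoveringMap
  obtain ⟨x₀⟩ : Nonempty X := inferInstance
  obtain ⟨t, ⟨-, ht⟩, -⟩ := hcov.existsUnique_continuousMap_lifts (ContinuousMap.id X) x₀
    (⟨x₀, (1 : ℤˣ)⟩ : TotalSpace ℤˣ Z.Fiber) rfl
  have hproj : ∀ x, (t x).1 = x := fun x => congrFun ht x
  refine ⟨fun j x => (Z.localTriv j (t x)).2, fun j => ?_, fun i j x hx => ?_⟩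
  · have h1 : ContinuousOn (Z.localTriv j) (Z.localTriv j).source := (Z.localTriv j).continuousOn
    refine continuous_snd.comp_continuousOn (h1.comp t.continuous.continuousOn fun x hx => ?_)
    rw [Z.mem_localTriv_source, ← Z.baseSet_at, hproj]
    exact hx
  · have h := Z.coordChange_comp (Z.indexAt (t x).1) i j (t x).1
      (by rw [hproj]; exact ⟨⟨hk x, hx.1⟩, hx.2⟩) (t x).2
    change Z.coordChange (Z.indexAt (t x).1) j (t x).1 (t x).2 =
      ε i j x * Z.coordChange (Z.indexAt (t x).1) i (t x).1 (t x).2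
    rw [← h]
    change ε i j (t x).1 * _ = _
    rw [hproj]

end SignCocycle

/-! ### Comparison of orthonormal frames -/

section Frames

variable {E : Type*} [NormedAddCommGroup E] [NormedSpace ℝ E] {H : Type*} [TopologicalSpace H]
  {I : ModelWithCorners ℝ E H} {M : Type u} [TopologicalSpace M] [ChartedSpace H M]
  [IsManifold I ∞ M] (g : SmoothMetric I M)

theorem contMDiffAt_metric {E' : Type*} [NormedAddCommGroup E'] [NormedSpace ℝ E'] {H' : Type*}
    [TopologicalSpace H'] {I' : ModelWithCorners ℝ E' H'} {M' : Type*} [TopologicalSpace M']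
    [ChartedSpace H' M'] {b : M' → M} {v w : ∀ m, TangentSpace I (b m)} {x : M'}
    (hv : ContMDiffAt I' I.tangent ∞ (fun m => (⟨b m, v m⟩ : TangentBundle I M)) x)
    (hw : ContMDiffAt I' I.tangent ∞ (fun m => (⟨b m, w m⟩ : TangentBundle I M)) x) :
    ContMDiffAt I' 𝓘(ℝ, ℝ) ∞ (fun m => g.inner (b m) (v m) (w m)) x := by
  have hb : ContMDiffAt I' I ∞ b x := (Bundle.contMDiffAt_totalSpace.1 hv).1
  have : ContMDiffAt I' (I.prod 𝓘(ℝ, ℝ)) ∞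
      (fun m ↦ TotalSpace.mk' ℝ (E := Bundle.Trivial M ℝ) (b m) (g.inner (b m) (v m) (w m))) x := by
    apply ContMDiffAt.clm_bundle_apply₂ (F₁ := E) (F₂ := E)
    · exact ContMDiffAt.comp x g.contMDiff.contMDiffAt hb
    · exact hv
    · exact hw
  exact (Bundle.contMDiffAt_totalSpace.1 this).2

variable {g} {n : ℕ}

/-- An orthonormal basis of a tangent space. -/
structure IsOrthoFrame (g : SmoothMetric I M) {x : M} (f : Fin n → TangentSpace I x) : Prop where
  inner_eq : ∀ a b, g.inner x (f a) (f b) = if a = b then 1 else 0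
  span_eq : ⊤ ≤ Submodule.span ℝ (Set.range f)

theorem IsOrthoFrame.sum_inner_smul {x : M} {f : Fin n → TangentSpace I x}
    (hf : IsOrthoFrame g f) (v : TangentSpace I x) : ∑ a, g.inner x (f a) v • f a = v := by
  obtain ⟨c, rfl⟩ :=
    (Submodule.mem_span_range_iff_exists_fun ℝ).1 (hf.span_eq (Submodule.mem_top (x := v)))
  refine Finset.sum_congr rfl fun a _ => ?_
  congr 1
  simp [hf.inner_eq]

theorem IsOrthoFrame.sum_inner_mul_inner {x : M} {f : Fin n → TangentSpace I x}
    (hf : IsOrthoFrame g f) (v w : TangentSpace I x) :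
    ∑ a, g.inner x (f a) v * g.inner x (f a) w = g.inner x v w := by
  conv_rhs => rw [← hf.sum_inner_smul w]
  rw [map_sum]
  refine Finset.sum_congr rfl fun a _ => ?_
  rw [map_smul, g.symm x v, smul_eq_mul, mul_comm]

/-- The coordinates of a frame with respect to another one, in the Clifford algebra. -/
def frameChange (g : SmoothMetric I M) {x : M} (f f' : Fin n → TangentSpace I x) (a : Fin n) :
    Cl n :=
  ∑ b, g.inner x (f' b) (f a) • clE b

theorem frameChange_eq {x : M} (f f' : Fin n → TangentSpace I x) (a : Fin n) :
    frameChange g f f' a = clVec fun b => g.inner x (f' b) (f a) := by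
  rw [clVec_eq_sum]
  rfl

theorem exists_isUnitLift_frameChange {x : M} {f f' : Fin n → TangentSpace I x}
    (hf : IsOrthoFrame g f) (hf' : IsOrthoFrame g f') :
    ∃ s, IsUnitLift (frameChange g f f') s := by
  rw [funext (frameChange_eq f f')]
  exact exists_isUnitLift _ fun a b => by rw [hf'.sum_inner_mul_inner, hf.inner_eq]

theorem IsTwistedLift.mul_clVec {w : Fin n → Cl n} {s : Cl n} (hs : IsTwistedLift w s)
    (v : Fin n → ℝ) : s * clVec v = (∑ a, v a • w a) * CliffordAlgebra.involute s := by
  rw [clVec_eq_sum, Finset.mul_sum, Finset.sum_mul]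
  exact Finset.sum_congr rfl fun a _ => by rw [mul_smul_comm, hs a, smul_mul_assoc]

theorem IsUnitLift.trans {x : M} {f f' f'' : Fin n → TangentSpace I x}
    (hf' : IsOrthoFrame g f') {s t : Cl n} (hs : IsUnitLift (frameChange g f f') s)
    (ht : IsUnitLift (frameChange g f' f'') t) : IsUnitLift (frameChange g f f'') (t * s) where
  mul_star := by rw [StarMul.star_mul, mul_assoc, ← mul_assoc s, hs.mul_star, one_mul, ht.mul_star]
  star_mul := by
    rw [StarMul.star_mul, mul_assoc, ← mul_assoc (star t), ht.star_mul, one_mul, hs.star_mul]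
  lift a := by
    rw [mul_assoc, hs.lift a, frameChange_eq, ← mul_assoc, ht.lift.mul_clVec, map_mul, mul_assoc]
    congr 1
    simp only [frameChange, Finset.smul_sum, smul_smul]
    rw [Finset.sum_comm]
    refine Finset.sum_congr rfl fun c _ => ?_
    rw [← Finset.sum_smul, ← hf'.sum_inner_mul_inner]
    congr 1
    exact Finset.sum_congr rfl fun b _ => by rw [g.symm x (f'' c), mul_comm]

theorem frameChange_weakSmoothAt {f f' : Fin n → (x : M) → TangentSpace I x} {x : M}
    (hf : ∀ a, ContMDiffAt I I.tangent ∞ (fun y => (⟨y, f a y⟩ : TangentBundle I M)) x)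
    (hf' : ∀ a, ContMDiffAt I I.tangent ∞ (fun y => (⟨y, f' a y⟩ : TangentBundle I M)) x)
    (a : Fin n) :
    WeakSmoothAt I (fun y => frameChange g (fun b => f b y) (fun b => f' b y) a) x :=
  WeakSmoothAt.sum _ fun b _ =>
    WeakSmoothAt.smul (contMDiffAt_metric g (hf' b) (hf a)) (WeakSmoothAt.const _)

namespace SpinStructure

variable (σ σ' : SpinStructure I g n)

theorem isOrthoFrame (α : σ.Index) {x : M} (hx : x ∈ σ.baseSet α) :
    IsOrthoFrame g fun a => σ.frame α a x where
  inner_eq := σ.orthonormal α x hx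
  span_eq := (σ.isLocalFrameOn α).generating hx

theorem contMDiffAt_frame (α : σ.Index) {x : M} (hx : x ∈ σ.baseSet α) (a : Fin n) :
    ContMDiffAt I I.tangent ∞ (fun y => (⟨y, σ.frame α a y⟩ : TangentBundle I M)) x :=
  (σ.isLocalFrameOn α).contMDiffAt (σ.isOpen_baseSet α) hx a

theorem isUnitLift_lift (α β : σ.Index) {x : M} (hx : x ∈ σ.baseSet α ∩ σ.baseSet β) :
    IsUnitLift (frameChange g (fun a => σ.frame β a x) fun a => σ.frame α a x)
      (σ.lift α β x : Cl n) where
  mul_star := spinGroup.mul_star_self_of_mem (σ.lift α β x).2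
  star_mul := spinGroup.star_mul_self_of_mem (σ.lift α β x).2
  lift b := by
    have h := σ.lift_covers α β x hx b
    rw [spinGroup.involute_eq (σ.lift α β x).2, frameChange, ← h, mul_assoc,
      ← spinGroup.star_eq_inv, spinGroup.coe_star, spinGroup.coe_star_mul_self, mul_one]

theorem weakSmoothAt_lift (α β : σ.Index) {x : M} (hx : x ∈ σ.baseSet α ∩ σ.baseSet β) :
    WeakSmoothAt I (fun y => (σ.lift α β y : Cl n)) x := fun φ =>
  (σ.lift_smooth α β φ).contMDiffAt
    (((σ.isOpen_baseSet α).inter (σ.isOpen_baseSet β)).mem_nhds hx)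

theorem lift_mul_lift (α β γ : σ.Index) {x : M} (hα : x ∈ σ.baseSet α) (hβ : x ∈ σ.baseSet β)
    (hγ : x ∈ σ.baseSet γ) : (σ.lift α β x : Cl n) * σ.lift β γ x = σ.lift α γ x :=
  congrArg Subtype.val (σ.lift_cocycle α β γ x ⟨⟨hα, hβ⟩, hγ⟩)

/-- The local expression `s` of a map between the spin structures at `x`, for the sections with
number `α`, `α'`, becomes `transport s` for the sections with number `β`, `β'`. -/
def transport (α β : σ.Index) (α' β' : σ'.Index) (x : M) (s : Cl n) : Cl n :=
  σ'.lift β' α' x * s * σ.lift α β x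

variable {σ σ'}

theorem transport_transport {α β γ : σ.Index} {α' β' γ' : σ'.Index} {x : M}
    (hα : x ∈ σ.baseSet α ∩ σ'.baseSet α') (hβ : x ∈ σ.baseSet β ∩ σ'.baseSet β')
    (hγ : x ∈ σ.baseSet γ ∩ σ'.baseSet γ') (s : Cl n) :
    transport σ σ' β γ β' γ' x (transport σ σ' α β α' β' x s) =
      transport σ σ' α γ α' γ' x s := by
  simp only [transport]
  rw [← σ.lift_mul_lift α β γ hα.1 hβ.1 hγ.1, ← σ'.lift_mul_lift γ' β' α' hγ.2 hβ.2 hα.2]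
  simp only [mul_assoc]

theorem transport_smul {α β : σ.Index} {α' β' : σ'.Index} {x : M} (ε : ℤˣ) (s : Cl n) :
    transport σ σ' α β α' β' x (ε • s) = ε • transport σ σ' α β α' β' x s := by
  simp only [transport, Units.smul_def, mul_smul_comm, smul_mul_assoc]

theorem isUnitLift_transport {α β : σ.Index} {α' β' : σ'.Index} {x : M}
    (hα : x ∈ σ.baseSet α ∩ σ'.baseSet α') (hβ : x ∈ σ.baseSet β ∩ σ'.baseSet β') {s : Cl n}
    (hs : IsUnitLift (frameChange g (fun a => σ.frame α a x) fun a => σ'.frame α' a x) s) :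
    IsUnitLift (frameChange g (fun a => σ.frame β a x) fun a => σ'.frame β' a x)
      (transport σ σ' α β α' β' x s) :=
  (σ.isUnitLift_lift α β ⟨hα.1, hβ.1⟩).trans (σ.isOrthoFrame α hα.1)
    (hs.trans (σ'.isOrthoFrame α' hα.2) (σ'.isUnitLift_lift β' α' ⟨hβ.2, hα.2⟩))

theorem weakSmoothAt_transport {α β : σ.Index} {α' β' : σ'.Index} {x : M}
    (hα : x ∈ σ.baseSet α ∩ σ'.baseSet α') (hβ : x ∈ σ.baseSet β ∩ σ'.baseSet β') {s : M → Cl n}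
    (hs : WeakSmoothAt I s x) :
    WeakSmoothAt I (fun y => transport σ σ' α β α' β' y (s y)) x :=
  ((σ'.weakSmoothAt_lift β' α' ⟨hβ.2, hα.2⟩).mul hs).mul
    (σ.weakSmoothAt_lift α β ⟨hα.1, hβ.1⟩)

end SpinStructure

namespace SpinStructure

/-- A smooth family of elements of the group `Pin n` over the open set `U` that lifts the change
from the frame of `σ` with number `α` to the frame of `σ'` with number `α'`. -/
structure IsLocalLift (σ σ' : SpinStructure I g n) (α : σ.Index) (α' : σ'.Index) (U : Set M)
    (s : M → Cl n) : Prop where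
  isOpen : IsOpen U
  subset : U ⊆ σ.baseSet α ∩ σ'.baseSet α'
  weakSmoothAt : ∀ x ∈ U, WeakSmoothAt I s x
  isUnitLift : ∀ x ∈ U,
    IsUnitLift (frameChange g (fun a => σ.frame α a x) fun a => σ'.frame α' a x) (s x)

theorem exists_isLocalLift (σ σ' : SpinStructure I g n) (x₀ : M) :
    ∃ U s, x₀ ∈ U ∧ IsLocalLift σ σ' (σ.indexAt x₀) (σ'.indexAt x₀) U s := by
  obtain ⟨U, s, hUo, hxU, hU, hsm, hs⟩ := exists_weakSmooth_isUnitLift (I := I)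
    ((σ.isOpen_baseSet _).inter (σ'.isOpen_baseSet _))
    ⟨σ.mem_baseSet_at x₀, σ'.mem_baseSet_at x₀⟩
    (fun x => frameChange g (fun a => σ.frame (σ.indexAt x₀) a x)
      fun a => σ'.frame (σ'.indexAt x₀) a x)
    (fun x hx a => frameChange_weakSmoothAt (fun b => σ.contMDiffAt_frame _ hx.1 b)
      (fun b => σ'.contMDiffAt_frame _ hx.2 b) a)
    fun x hx => exists_isUnitLift_frameChange (σ.isOrthoFrame _ hx.1) (σ'.isOrthoFrame _ hx.2)
  exact ⟨U, s, hxU, hUo, hU, hsm, hs⟩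

variable {σ σ' : SpinStructure I g n} {α β γ : σ.Index} {α' β' γ' : σ'.Index} {U V W : Set M}
  {s t u : M → Cl n}

theorem IsLocalLift.exists_continuousOn_sign (hs : IsLocalLift σ σ' α α' U s)
    (ht : IsLocalLift σ σ' β β' V t) :
    ∃ ε : M → ℤˣ, ContinuousOn ε (U ∩ V) ∧
      ∀ y ∈ U ∩ V, t y = ε y • transport σ σ' α β α' β' y (s y) :=
  _root_.exists_continuousOn_sign (hs.isOpen.inter ht.isOpen)
    (fun y hy => weakSmoothAt_transport (hs.subset hy.1) (ht.subset hy.2)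
      (hs.weakSmoothAt y hy.1))
    (fun y hy => ht.weakSmoothAt y hy.2)
    (fun y hy => isUnitLift_transport (hs.subset hy.1) (ht.subset hy.2) (hs.isUnitLift y hy.1))
    fun y hy => ht.isUnitLift y hy.2

theorem IsLocalLift.sign_mul_sign (hs : IsLocalLift σ σ' α α' U s)
    (ht : IsLocalLift σ σ' β β' V t) (hu : IsLocalLift σ σ' γ γ' W u) {y : M}
    (hy : y ∈ U ∩ V ∩ W) {ε ε' ε'' : ℤˣ} (hε : t y = ε • transport σ σ' α β α' β' y (s y))
    (hε' : u y = ε' • transport σ σ' β γ β' γ' y (t y))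
    (hε'' : u y = ε'' • transport σ σ' α γ α' γ' y (s y)) : ε * ε' = ε'' := by
  obtain ⟨⟨hU, hV⟩, hW⟩ := hy
  refine (isUnitLift_transport (hs.subset hU) (hu.subset hW) (hs.isUnitLift y hU)).sign_eq ?_
  rw [← hε'', hε', hε, transport_smul,
    transport_transport (hs.subset hU) (ht.subset hV) (hu.subset hW), smul_smul, mul_comm]

theorem exists_global_lift [SimplyConnectedSpace M] [LocallyPathConnectedSpace M]
    (σ σ' : SpinStructure I g n) :
    ∃ s : M → Cl n,
      (∀ x, IsUnitLift (frameChange g (fun a => σ.frame (σ.indexAt x) a x)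
        fun a => σ'.frame (σ'.indexAt x) a x) (s x)) ∧
      ∀ x₀, WeakSmoothAt I (fun y => transport σ σ' (σ.indexAt y) (σ.indexAt x₀) (σ'.indexAt y)
        (σ'.indexAt x₀) y (s y)) x₀ := by
  choose U s hxU hs using exists_isLocalLift σ σ'
  choose ε hεc hε using fun i j => (hs i).exists_continuousOn_sign (hs j)
  obtain ⟨η, hη, hηε⟩ := exists_sign_coboundary U (fun i => (hs i).isOpen) id hxU ε hεc
    fun i j l y hy => (hs i).sign_mul_sign (hs j) (hs l) hy (hε i j y hy.1)
      (hε j l y ⟨hy.1.2, hy.2⟩) (hε i l y ⟨hy.1.1, hy.2⟩)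
  refine ⟨fun x => η x x • s x x, fun x => ((hs x).isUnitLift x (hxU x)).sign_smul _,
    fun x₀ => ?_⟩
  have hU : U x₀ ∈ 𝓝 x₀ := (hs x₀).isOpen.mem_nhds (hxU x₀)
  have hηconst : ∀ᶠ y in 𝓝 x₀, η x₀ y = η x₀ x₀ :=
    ((hη x₀).continuousAt hU).eventually_mem ((isOpen_discrete {η x₀ x₀}).mem_nhds rfl)
  have hsmooth : WeakSmoothAt I (fun y => η x₀ x₀ • s x₀ y) x₀ := by
    simp only [Units.smul_def]
    exact ((hs x₀).weakSmoothAt x₀ (hxU x₀)).linear (((η x₀ x₀ : ℤˣ) : ℤ) • LinearMap.id)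
  refine hsmooth.congr ?_
  filter_upwards [hηconst, hU] with y hy hyU
  rw [← hy, transport_smul, hηε y x₀ y ⟨hxU y, hyU⟩, hε y x₀ y ⟨hxU y, hyU⟩, smul_smul,
    mul_right_comm, Int.units_mul_self, one_mul]

end SpinStructure

end Frames

/-! ### Products of simply connected manifolds -/

theorem simplyConnectedSpace_pi {ι : Type*} {X : ι → Type*} [∀ i, TopologicalSpace (X i)]
    [∀ i, SimplyConnectedSpace (X i)] : SimplyConnectedSpace (∀ i, X i) := by
  rw [simply_connected_iff_paths_homotopic]
  refine ⟨inferInstance, fun x y => ⟨fun p q => ?_⟩⟩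
  rw [← Path.Homotopic.pi_proj p, ← Path.Homotopic.pi_proj q]
  congr 1
  funext i
  have : Subsingleton (Path.Homotopic.Quotient (x i) (y i)) :=
    (simply_connected_iff_paths_homotopic.1 inferInstance).2 _ _
  exact Subsingleton.elim _ _

theorem locallyPathConnectedSpace_pi {N : ℕ} {D : Fin N → ℕ} (M : Fin N → Type*)
    [∀ i, TopologicalSpace (M i)] [∀ i, ChartedSpace (EuclideanSpace ℝ (Fin (D i))) (M i)] :
    LocallyPathConnectedSpace (∀ i, M i) := by
  have : LocallyPathConnectedSpace (ModelPi fun i => EuclideanSpace ℝ (Fin (D i))) :=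
    inferInstanceAs (LocallyPathConnectedSpace (∀ i, EuclideanSpace ℝ (Fin (D i))))
  exact ChartedSpace.locallyPathConnectedSpace (ModelPi fun i => EuclideanSpace ℝ (Fin (D i))) _

/-! ### The homomorphism from the product of spin groups -/

section CliffordMap

variable {R V₁ V₂ : Type*} [CommRing R] [AddCommGroup V₁] [Module R V₁] [AddCommGroup V₂]
  [Module R V₂] {Q₁ : QuadraticForm R V₁} {Q₂ : QuadraticForm R V₂} (f : Q₁ →qᵢ Q₂)

theorem cliffordMap_involute (a : CliffordAlgebra Q₁) :
    CliffordAlgebra.map f (CliffordAlgebra.involute a) =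
      CliffordAlgebra.involute (CliffordAlgebra.map f a) := by
  induction a using CliffordAlgebra.induction with
  | algebraMap r => simp
  | ι v => simp
  | mul a b ha hb => simp only [map_mul, ha, hb]
  | add a b ha hb => simp only [map_add, ha, hb]

theorem cliffordMap_reverse (a : CliffordAlgebra Q₁) :
    CliffordAlgebra.map f (CliffordAlgebra.reverse a) =
      CliffordAlgebra.reverse (CliffordAlgebra.map f a) := by
  induction a using CliffordAlgebra.induction with
  | algebraMap r => simp
  | ι v => simp
  | mul a b ha hb => simp only [CliffordAlgebra.reverse.map_mul, map_mul, ha, hb]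
  | add a b ha hb => simp only [map_add, ha, hb]

theorem cliffordMap_star (a : CliffordAlgebra Q₁) :
    CliffordAlgebra.map f (star a) = star (CliffordAlgebra.map f a) := by
  rw [CliffordAlgebra.star_def, CliffordAlgebra.star_def, cliffordMap_reverse,
    cliffordMap_involute]

theorem cliffordMap_mem_even {a : CliffordAlgebra Q₁} (ha : a ∈ CliffordAlgebra.even Q₁) :
    CliffordAlgebra.map f a ∈ CliffordAlgebra.even Q₂ := by
  refine CliffordAlgebra.even_induction (Q := Q₁)
    (motive := fun a _ => CliffordAlgebra.map f a ∈ CliffordAlgebra.even Q₂) ?_ ?_ ?_ a ha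
  · intro r
    rw [AlgHom.commutes]
    exact Subalgebra.algebraMap_mem _ r
  · intro x y _ _ hx hy
    rw [map_add]
    exact add_mem hx hy
  · intro v w x _ hx
    rw [map_mul, map_mul, CliffordAlgebra.map_apply_ι, CliffordAlgebra.map_apply_ι]
    exact mul_mem (CliffordAlgebra.ι_mul_ι_mem_evenOdd_zero _ _ _) hx

theorem cliffordMap_mem_spinGroup {a : CliffordAlgebra Q₁} (ha : a ∈ spinGroup Q₁) :
    CliffordAlgebra.map f a ∈ spinGroup Q₂ := by
  refine spinGroup.mem_iff.2
    ⟨pinGroup.mem_iff.2 ⟨?_, ?_⟩, cliffordMap_mem_even f (spinGroup.mem_even ha)⟩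
  · let F := (CliffordAlgebra.map f : CliffordAlgebra Q₁ →* CliffordAlgebra Q₂)
    obtain ⟨x, hx, rfl⟩ := pinGroup.mem_lipschitzGroup (spinGroup.mem_pin ha)
    have hle : lipschitzGroup Q₁ ≤ (lipschitzGroup Q₂).comap (Units.map F) := by
      refine (Subgroup.closure_le _).2 ?_
      rintro y ⟨v, hv⟩
      refine Subgroup.subset_closure ⟨f v, ?_⟩
      exact (CliffordAlgebra.map_apply_ι f v).symm.trans (congrArg (CliffordAlgebra.map f) hv)
    exact ⟨Units.map F x, hle hx, rfl⟩
  · rw [Unitary.mem_iff, ← cliffordMap_star, ← map_mul, ← map_mul,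
      spinGroup.star_mul_self_of_mem ha, spinGroup.mul_star_self_of_mem ha, map_one]
    exact ⟨rfl, rfl⟩

end CliffordMap

theorem list_prod_map_mul_of_commute {ι G : Type*} [Monoid G] (f f' : ι → G)
    (h : ∀ i j, i ≠ j → Commute (f i) (f' j)) (l : List ι) (hl : l.Nodup) :
    (l.map fun i => f i * f' i).prod = (l.map f).prod * (l.map f').prod := by
  induction l with
  | nil => simp
  | cons a l ih =>
    rw [List.nodup_cons] at hl
    have hc : Commute (f' a) (l.map f).prod := Commute.list_prod_right _ _ fun y hy => by
      obtain ⟨i, hi, rfl⟩ := List.mem_map.1 hy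
      exact (h i a fun e => hl.1 (e ▸ hi)).symm
    rw [List.map_cons, List.prod_cons, ih hl.2, List.map_cons, List.map_cons, List.prod_cons,
      List.prod_cons, mul_assoc, mul_assoc, ← mul_assoc (f' a), hc.eq, mul_assoc]

section SpinProduct

variable {N : ℕ} {D : Fin N → ℕ}

/-- The inclusion of the spin group of the block number `i`. -/
def embSpin (i : Fin N) (a : Spin (D i)) : Spin (∑ i, D i) :=
  ⟨embCl i a, cliffordMap_mem_spinGroup (blockIsometry i) a.2⟩

/-- The homomorphism from the product of the groups `Spin(D i)` to `Spin(∑ i, D i)`. -/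
def spinProd (s : ∀ i, Spin (D i)) : Spin (∑ i, D i) :=
  ((List.finRange N).map fun i => embSpin i (s i)).prod

theorem coe_spinProd (s : ∀ i, Spin (D i)) :
    (spinProd s : Cl (∑ i, D i)) =
      ((List.finRange N).map fun i => embCl i (s i : Cl (D i))).prod := by
  rw [spinProd, SubmonoidClass.coe_list_prod, List.map_map]
  rfl

theorem spinProd_mul (s t : ∀ i, Spin (D i)) :
    spinProd (fun i => s i * t i) = spinProd s * spinProd t := by
  rw [spinProd, spinProd, spinProd, ← list_prod_map_mul_of_commute]
  · congr 1
    refine List.map_congr_left fun i _ => Subtype.ext ?_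
    exact map_mul (embCl i) _ _
  · exact fun i j hij => Subtype.ext (commute_embCl hij (spinGroup.mem_even (s i).2) _)
  · exact List.nodup_finRange N

theorem spinProd_mul_embCl (s : ∀ i, Spin (D i)) (i : Fin N) (a : Cl (D i)) :
    (spinProd s : Cl (∑ i, D i)) * embCl i a =
      embCl i ((s i : Cl (D i)) * a * star (s i : Cl (D i))) * (spinProd s : Cl (∑ i, D i)) := by
  rw [coe_spinProd]
  have hprod : ∀ l : List (Fin N), l.Nodup →
      (l.map fun i => embCl i (s i : Cl (D i))).prod * embCl i a =
      embCl i (if i ∈ l then (s i : Cl (D i)) * a * star (s i : Cl (D i)) else a) *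
        (l.map fun i => embCl i (s i : Cl (D i))).prod := by
    intro l hl
    induction l with
    | nil => simp
    | cons j l ih =>
      rw [List.nodup_cons] at hl
      rw [List.map_cons, List.prod_cons, mul_assoc, ih hl.2, ← mul_assoc, ← mul_assoc]
      congr 1
      by_cases hij : j = i
      · subst hij
        rw [if_neg hl.1, if_pos List.mem_cons_self, ← map_mul, ← map_mul, mul_assoc, mul_assoc,
          spinGroup.star_mul_self_of_mem (s j).2, mul_one]
      · rw [(commute_embCl hij (spinGroup.mem_even (s j).2) _).eq]
        congr 2
        simp [Ne.symm hij]
  rw [hprod _ (List.nodup_finRange N), if_pos (List.mem_finRange i)]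

variable {E : Type*} [NormedAddCommGroup E] [NormedSpace ℝ E] {H : Type*} [TopologicalSpace H]
  {I : ModelWithCorners ℝ E H} {M : Type*} [TopologicalSpace M] [ChartedSpace H M]

theorem weakSmoothAt_spinProd {s : M → ∀ i, Spin (D i)} {x : M}
    (hs : ∀ i, WeakSmoothAt I (fun y => (s y i : Cl (D i))) x) :
    WeakSmoothAt I (fun y => (spinProd (s y) : Cl (∑ i, D i))) x := by
  simp only [coe_spinProd]
  induction List.finRange N with
  | nil => simpa using WeakSmoothAt.const (1 : Cl (∑ i, D i))
  | cons i l ih =>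
    simp only [List.map_cons, List.prod_cons]
    exact ((hs i).linear (embCl i).toLinearMap).mul ih

end SpinProduct

/-! ### Smoothness of inverse matrices -/

section MatrixInverse

variable {E : Type*} [NormedAddCommGroup E] [NormedSpace ℝ E] {H : Type*} [TopologicalSpace H]
  {I : ModelWithCorners ℝ E H} {M : Type*} [TopologicalSpace M] [ChartedSpace H M] {n : ℕ} {x : M}

theorem contMDiffAt_det {T : M → Matrix (Fin n) (Fin n) ℝ}
    (hT : ∀ k l, ContMDiffAt I 𝓘(ℝ, ℝ) ∞ (fun y => T y k l) x) :
    ContMDiffAt I 𝓘(ℝ, ℝ) ∞ (fun y => (T y).det) x := by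
  simp only [Matrix.det_apply']
  exact ContMDiffAt.sum fun p _ => contMDiffAt_const.mul (contMDiffAt_finsetProd fun k _ => hT _ _)

theorem contMDiffAt_inv {T : M → Matrix (Fin n) (Fin n) ℝ}
    (hT : ∀ k l, ContMDiffAt I 𝓘(ℝ, ℝ) ∞ (fun y => T y k l) x) (hx : (T x).det ≠ 0)
    (k l : Fin n) : ContMDiffAt I 𝓘(ℝ, ℝ) ∞ (fun y => (T y)⁻¹ k l) x := by
  have h : ∀ y, (T y)⁻¹ k l = ((T y).det)⁻¹ * (T y).adjugate k l := fun y => by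
    rw [Matrix.inv_def, Ring.inverse_eq_inv', Matrix.smul_apply, smul_eq_mul]
  simp only [h]
  have h1 : ContDiffAt ℝ ∞ (fun r : ℝ => r⁻¹) (T x).det := contDiffAt_inv ℝ hx
  refine ContMDiffAt.mul (h1.contMDiffAt.comp x (contMDiffAt_det hT)) ?_
  simp only [Matrix.adjugate_apply]
  refine contMDiffAt_det fun a b => ?_
  simp only [Matrix.updateRow_apply]
  split_ifs
  · exact contMDiffAt_const
  · exact hT _ _

end MatrixInverse

/-! ### The spin structure of the product -/

section Coframe

variable {E : Type*} [NormedAddCommGroup E] [NormedSpace ℝ E] [FiniteDimensional ℝ E] {H : Type*}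
  [TopologicalSpace H] {I : ModelWithCorners ℝ E H} {M : Type*} [TopologicalSpace M]
  [ChartedSpace H M] [IsManifold I ∞ M] {n : ℕ}

theorem contMDiffAt_of_injective_coframe (hn : Module.finrank ℝ E = n) {x : M} {U : Set M}
    (hU : U ∈ 𝓝 x) {c : ∀ y : M, TangentSpace I y →ₗ[ℝ] (Fin n → ℝ)}
    (hinj : ∀ y ∈ U, Function.Injective (c y))
    (hc : ∀ X : ∀ y, TangentSpace I y,
      ContMDiffAt I I.tangent ∞ (fun y => (⟨y, X y⟩ : TangentBundle I M)) x →
        ∀ k, ContMDiffAt I 𝓘(ℝ, ℝ) ∞ (fun y => c y (X y) k) x)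
    {f : ∀ y, TangentSpace I y} (hf : ∀ k, ContMDiffAt I 𝓘(ℝ, ℝ) ∞ (fun y => c y (f y) k) x) :
    ContMDiffAt I I.tangent ∞ (fun y => (⟨y, f y⟩ : TangentBundle I M)) x := by
  let e := trivializationAt E (TangentSpace I (M := M)) x
  let b : Module.Basis (Fin n) ℝ E := Module.finBasisOfFinrankEq ℝ E hn
  have hxe : x ∈ e.baseSet := FiberBundle.mem_baseSet_trivializationAt' x
  have hloc := e.isLocalFrameOn_localFrame_baseSet I ∞ b
  have hframe : ∀ l, ContMDiffAt I I.tangent ∞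
      (fun y => (⟨y, e.localFrame b l y⟩ : TangentBundle I M)) x := fun l =>
    hloc.contMDiffAt e.open_baseSet hxe l
  let T : M → Matrix (Fin n) (Fin n) ℝ := fun y => Matrix.of fun k l => c y (e.localFrame b l y) k
  have hTv : ∀ y (v : Fin n → ℝ), c y (∑ l, v l • e.localFrame b l y) = (T y).mulVec v := by
    intro y v
    ext k
    simp [T, Matrix.mulVec, dotProduct, mul_comm]
  have hdet : ∀ y ∈ U, y ∈ e.baseSet → IsUnit (T y) := fun y hy hye => by
    refine Matrix.mulVec_injective_iff_isUnit.1 fun v v' hvv' => ?_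
    rw [← hTv, ← hTv] at hvv'
    exact (hloc.linearIndependent hye).fintypeLinearCombination_injective (hinj y hy hvv')
  have hcoeff : ∀ l, ContMDiffAt I 𝓘(ℝ, ℝ) ∞ (fun y => (T y)⁻¹.mulVec (c y (f y)) l) x := by
    intro l
    simp only [Matrix.mulVec, dotProduct]
    exact ContMDiffAt.sum fun k _ => (contMDiffAt_inv (fun k l => hc _ (hframe l) k)
      ((Matrix.isUnit_iff_isUnit_det _).1 (hdet x (mem_of_mem_nhds hU) hxe)).ne_zero l k).mul (hf k)
  have hsum : ContMDiffAt I I.tangent ∞ (fun y =>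
      (⟨y, ∑ l, ((T y)⁻¹.mulVec (c y (f y))) l • e.localFrame b l y⟩ : TangentBundle I M)) x :=
    ContMDiffAt.sum_section fun l _ => (hcoeff l).smul_section (hframe l)
  refine hsum.congr_of_eventuallyEq ?_
  filter_upwards [hU, e.open_baseSet.mem_nhds hxe] with y hy hye
  refine congrArg (TotalSpace.mk y) (hinj y hy ?_)
  rw [hTv, Matrix.mulVec_mulVec, Matrix.mul_nonsing_inv _
    ((Matrix.isUnit_iff_isUnit_det _).1 (hdet y hy hye)), Matrix.one_mulVec]

end Coframe

theorem finrank_tangentSpace_pi {N : ℕ} {D : Fin N → ℕ} {M : Fin N → Type u}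
    [∀ i, TopologicalSpace (M i)] [∀ i, ChartedSpace (EuclideanSpace ℝ (Fin (D i))) (M i)]
    (x : ∀ i, M i) : Module.finrank ℝ (TangentSpace (prodModel D) x) = ∑ i, D i := by
  change Module.finrank ℝ (∀ i, EuclideanSpace ℝ (Fin (D i))) = _
  rw [Module.finrank_pi_fintype]
  simp

section ProductSpin

variable {N : ℕ} {D : Fin N → ℕ} {M : Fin N → Type u} [∀ i, TopologicalSpace (M i)]
  [∀ i, ChartedSpace (EuclideanSpace ℝ (Fin (D i))) (M i)]
  [∀ i, IsManifold (𝓡 (D i)) ∞ (M i)] {g : ∀ i, SmoothMetric (𝓡 (D i)) (M i)}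
  (σ : ∀ i, SpinStructure (𝓡 (D i)) (g i) (D i))
  {gM : SmoothMetric (prodModel D) (∀ i, M i)}
  (A : ∀ i, ∀ x : (∀ i, M i), TangentSpace (𝓡 (D i)) (x i) →L[ℝ] TangentSpace (𝓡 (D i)) (x i))

/-- The set on which the product of local sections is defined. -/
def prodBase (α : ∀ i, (σ i).Index) : Set (∀ i, M i) :=
  Set.univ.pi fun i => (σ i).baseSet (α i)

theorem isOpen_prodBase (α : ∀ i, (σ i).Index) : IsOpen (prodBase σ α) :=
  isOpen_set_pi Set.finite_univ fun i _ => (σ i).isOpen_baseSet (α i)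

/-- The coordinates of `Aᵢ Xᵢ` in the frames of the factors. -/
def prodCoframe (α : ∀ i, (σ i).Index) (x : ∀ i, M i) :
    TangentSpace (prodModel D) x →ₗ[ℝ] (Fin (∑ i, D i) → ℝ) where
  toFun X k := (g (finSigmaFinEquiv.symm k).1).inner (x (finSigmaFinEquiv.symm k).1)
    ((σ (finSigmaFinEquiv.symm k).1).frame (α (finSigmaFinEquiv.symm k).1)
      (finSigmaFinEquiv.symm k).2 (x (finSigmaFinEquiv.symm k).1))
    (A (finSigmaFinEquiv.symm k).1 x (tangentProj x (finSigmaFinEquiv.symm k).1 X))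
  map_add' X Y := by ext k; simp
  map_smul' r X := by ext k; simp

theorem prodCoframe_apply (α : ∀ i, (σ i).Index) (x : ∀ i, M i)
    (X : TangentSpace (prodModel D) x) (i : Fin N) (a : Fin (D i)) :
    prodCoframe σ A α x X (finSigmaFinEquiv ⟨i, a⟩) =
      (g i).inner (x i) ((σ i).frame (α i) a (x i)) (A i x (tangentProj x i X)) := by
  have h : ∀ p : Σ j, Fin (D j), p = ⟨i, a⟩ →
      (g p.1).inner (x p.1) ((σ p.1).frame (α p.1) p.2 (x p.1)) (A p.1 x (tangentProj x p.1 X)) =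
      (g i).inner (x i) ((σ i).frame (α i) a (x i)) (A i x (tangentProj x i X)) := by
    rintro _ rfl
    rfl
  exact h _ (Equiv.symm_apply_apply _ _)

variable (gM) (g)

/-- The metric on the product comes from the metrics on the factors through the smooth maps `A`. -/
structure IsProductMetric : Prop where
  smooth : ∀ i, ContMDiff (prodModel D).tangent (𝓡 (D i)).tangent ∞
    fun p : TangentBundle (prodModel D) (∀ i, M i) =>
      (⟨p.1 i, A i p.1 (tangentProj p.1 i p.2)⟩ : TangentBundle (𝓡 (D i)) (M i))
  inner_eq : ∀ (x : ∀ i, M i) (X Y : TangentSpace (prodModel D) x),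
    gM.inner x X Y =
      ∑ i, (g i).inner (x i) (A i x (tangentProj x i X)) (A i x (tangentProj x i Y))

variable {gM} {g} {A}

theorem IsProductMetric.contMDiff_apply (h : IsProductMetric g gM A) (i : Fin N) :
    ContMDiff (prodModel D) (𝓡 (D i)) ∞ fun x : ∀ i, M i => x i :=
  (Bundle.contMDiff_proj (TangentSpace (𝓡 (D i)))).comp ((h.smooth i).comp
    (Bundle.contMDiff_zeroSection ℝ (TangentSpace (prodModel D) (M := ∀ i, M i))))

theorem IsProductMetric.sum_prodCoframe_mul (h : IsProductMetric g gM A) {α : ∀ i, (σ i).Index}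
    {x : ∀ i, M i} (hx : x ∈ prodBase σ α) (X Y : TangentSpace (prodModel D) x) :
    ∑ k, prodCoframe σ A α x X k * prodCoframe σ A α x Y k = gM.inner x X Y := by
  rw [sum_block, h.inner_eq]
  refine Finset.sum_congr rfl fun i _ => ?_
  simp only [prodCoframe_apply]
  exact ((σ i).isOrthoFrame (α i) (hx i trivial)).sum_inner_mul_inner _ _

theorem IsProductMetric.prodCoframe_injective (h : IsProductMetric g gM A)
    {α : ∀ i, (σ i).Index} {x : ∀ i, M i} (hx : x ∈ prodBase σ α) :
    Function.Injective (prodCoframe σ A α x) := by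
  refine (injective_iff_map_eq_zero _).2 fun X hX => ?_
  by_contra hX0
  have h1 := gM.pos x X hX0
  rw [← h.sum_prodCoframe_mul σ hx, hX] at h1
  simp at h1

/-- The coordinates given by `prodCoframe`, as an isomorphism of the tangent space with `ℝ ^ D`. -/
def prodCoordEquiv (h : IsProductMetric g gM A) {α : ∀ i, (σ i).Index} {x : ∀ i, M i}
    (hx : x ∈ prodBase σ α) :
    TangentSpace (prodModel D) x ≃ₗ[ℝ] (Fin (∑ i, D i) → ℝ) :=
  have : FiniteDimensional ℝ (TangentSpace (prodModel D) x) :=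
    inferInstanceAs (FiniteDimensional ℝ (∀ i, EuclideanSpace ℝ (Fin (D i))))
  LinearMap.linearEquivOfInjective _ (h.prodCoframe_injective σ hx)
    (by rw [finrank_tangentSpace_pi, Module.finrank_fin_fun])

theorem prodCoordEquiv_apply (h : IsProductMetric g gM A) {α : ∀ i, (σ i).Index} {x : ∀ i, M i}
    (hx : x ∈ prodBase σ α) (X : TangentSpace (prodModel D) x) :
    prodCoordEquiv σ h hx X = prodCoframe σ A α x X := rfl

open Classical in
/-- The orthonormal frame of the product that is dual to the coframe. -/
def prodFrame (h : IsProductMetric g gM A) (α : ∀ i, (σ i).Index) (k : Fin (∑ i, D i))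
    (x : ∀ i, M i) : TangentSpace (prodModel D) x :=
  if hx : x ∈ prodBase σ α then (prodCoordEquiv σ h hx).symm (Pi.single k 1) else 0

theorem prodFrame_eq (h : IsProductMetric g gM A) {α : ∀ i, (σ i).Index} {x : ∀ i, M i}
    (hx : x ∈ prodBase σ α) (k : Fin (∑ i, D i)) :
    prodFrame σ h α k x = (prodCoordEquiv σ h hx).symm (Pi.single k 1) :=
  dif_pos hx

theorem prodCoframe_prodFrame (h : IsProductMetric g gM A) {α : ∀ i, (σ i).Index} {x : ∀ i, M i}
    (hx : x ∈ prodBase σ α) (k : Fin (∑ i, D i)) :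
    prodCoframe σ A α x (prodFrame σ h α k x) = Pi.single k 1 := by
  rw [prodFrame_eq σ h hx, ← prodCoordEquiv_apply σ h hx, LinearEquiv.apply_symm_apply]

theorem inner_prodFrame (h : IsProductMetric g gM A) {α : ∀ i, (σ i).Index} {x : ∀ i, M i}
    (hx : x ∈ prodBase σ α) (k : Fin (∑ i, D i)) (Y : TangentSpace (prodModel D) x) :
    gM.inner x (prodFrame σ h α k x) Y = prodCoframe σ A α x Y k := by
  rw [← h.sum_prodCoframe_mul σ hx, prodCoframe_prodFrame σ h hx]
  simp [Pi.single_apply]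

theorem contMDiffAt_prodCoframe (h : IsProductMetric g gM A) {α : ∀ i, (σ i).Index}
    {x : ∀ i, M i} (hx : x ∈ prodBase σ α) {X : ∀ x : (∀ i, M i), TangentSpace (prodModel D) x}
    (hX : ContMDiffAt (prodModel D) (prodModel D).tangent ∞
      (fun y => (⟨y, X y⟩ : TangentBundle (prodModel D) (∀ i, M i))) x) (k : Fin (∑ i, D i)) :
    ContMDiffAt (prodModel D) 𝓘(ℝ, ℝ) ∞ (fun y => prodCoframe σ A α y (X y) k) x := by
  obtain ⟨⟨i, a⟩, rfl⟩ := finSigmaFinEquiv.surjective k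
  simp only [prodCoframe_apply]
  refine contMDiffAt_metric (g i) (b := fun y : ∀ i, M i => y i) ?_ ?_
  · exact ((σ i).contMDiffAt_frame (α i) (hx i trivial) a).comp x (h.contMDiff_apply i x)
  · exact ((h.smooth i).contMDiffAt).comp x hX

theorem contMDiffAt_prodFrame (h : IsProductMetric g gM A) {α : ∀ i, (σ i).Index}
    {x : ∀ i, M i} (hx : x ∈ prodBase σ α) (k : Fin (∑ i, D i)) :
    ContMDiffAt (prodModel D) (prodModel D).tangent ∞
      (fun y => (⟨y, prodFrame σ h α k y⟩ : TangentBundle (prodModel D) (∀ i, M i))) x := by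
  have hU : prodBase σ α ∈ 𝓝 x := (isOpen_prodBase σ α).mem_nhds hx
  refine contMDiffAt_of_injective_coframe (finrank_tangentSpace_pi x) hU
    (fun y hy => h.prodCoframe_injective σ hy)
    (fun X hX => contMDiffAt_prodCoframe σ h hx hX) fun m => ?_
  refine (contMDiffAt_const (c := (Pi.single k 1 : Fin (∑ i, D i) → ℝ) m)).congr_of_eventuallyEq ?_
  filter_upwards [hU] with y hy
  rw [prodCoframe_prodFrame σ h hy]

theorem prodFrame_eq_basis (h : IsProductMetric g gM A) {α : ∀ i, (σ i).Index} {x : ∀ i, M i}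
    (hx : x ∈ prodBase σ α) :
    (prodFrame σ h α · x) = (Pi.basisFun ℝ _).map (prodCoordEquiv σ h hx).symm := by
  funext k
  simp [prodFrame_eq σ h hx]

theorem isLocalFrameOn_prodFrame (h : IsProductMetric g gM A) (α : ∀ i, (σ i).Index) :
    IsLocalFrameOn (prodModel D) (∀ i, EuclideanSpace ℝ (Fin (D i))) ∞ (prodFrame σ h α)
      (prodBase σ α) where
  linearIndependent {x} hx := by
    rw [prodFrame_eq_basis σ h hx]
    exact Module.Basis.linearIndependent _
  generating {x} hx := by
    rw [prodFrame_eq_basis σ h hx]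
    exact (Module.Basis.span_eq _).ge
  contMDiffOn k x hx := (contMDiffAt_prodFrame σ h hx k).contMDiffWithinAt

theorem prodCoframe_prodFrame_block (h : IsProductMetric g gM A) {α β : ∀ i, (σ i).Index}
    {x : ∀ i, M i} (hβ : x ∈ prodBase σ β) (j : Fin N) (b : Fin (D j)) :
    prodCoframe σ A α x (prodFrame σ h β (finSigmaFinEquiv ⟨j, b⟩) x) =
      blockVec j fun a => (g j).inner (x j) ((σ j).frame (α j) a (x j))
        ((σ j).frame (β j) b (x j)) := by
  ext k
  obtain ⟨⟨i, a⟩, rfl⟩ := finSigmaFinEquiv.surjective k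
  rw [prodCoframe_apply, blockVec_apply]
  have h1 : ∀ c, (g i).inner (x i) ((σ i).frame (β i) c (x i)) (A i x (tangentProj x i
      (prodFrame σ h β (finSigmaFinEquiv ⟨j, b⟩) x))) =
      if (⟨i, c⟩ : Σ i, Fin (D i)) = ⟨j, b⟩ then 1 else 0 := fun c => by
    rw [← prodCoframe_apply, prodCoframe_prodFrame σ h hβ, Pi.single_apply]
    simp only [EmbeddingLike.apply_eq_iff_eq]
  rw [← ((σ i).isOrthoFrame (β i) (hβ i trivial)).sum_inner_mul_inner]
  simp only [h1]
  by_cases hij : i = j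
  · subst hij
    simp [(g i).symm (x i)]
  · simp [hij]

/-- The spin structure of the product, with the products of the local sections of the factors as
local sections. -/
def prodSpinStructure (h : IsProductMetric g gM A) :
    SpinStructure (prodModel D) gM (∑ i, D i) where
  Index := ∀ i, (σ i).Index
  baseSet := prodBase σ
  isOpen_baseSet := isOpen_prodBase σ
  indexAt x i := (σ i).indexAt (x i)
  mem_baseSet_at x i _ := (σ i).mem_baseSet_at (x i)
  frame := prodFrame σ h
  isLocalFrameOn := isLocalFrameOn_prodFrame σ h
  orthonormal α x hx a b := by
    rw [inner_prodFrame σ h hx, prodCoframe_prodFrame σ h hx, Pi.single_apply]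
  lift α β x := spinProd fun i => (σ i).lift (α i) (β i) (x i)
  lift_smooth α β φ x hx := ContMDiffAt.contMDiffWithinAt <|
    weakSmoothAt_spinProd (I := prodModel D)
      (s := fun (y : ∀ i, M i) i => (σ i).lift (α i) (β i) (y i)) (fun i ψ =>
        ContMDiffAt.comp x (g := fun z => ψ ((σ i).lift (α i) (β i) z)) (f := fun y => y i)
          ((σ i).weakSmoothAt_lift (α i) (β i) ⟨hx.1 i trivial, hx.2 i trivial⟩ ψ)
          (h.contMDiff_apply i x)) φ
  lift_cocycle α β γ x hx := by
    rw [← spinProd_mul]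
    congr 1
    funext i
    exact (σ i).lift_cocycle _ _ _ _ ⟨⟨hx.1.1 i trivial, hx.1.2 i trivial⟩, hx.2 i trivial⟩
  lift_covers α β x hx k := by
    obtain ⟨⟨j, b⟩, rfl⟩ := finSigmaFinEquiv.surjective k
    simp only [inner_prodFrame σ h hx.1]
    rw [← clVec_eq_sum, prodCoframe_prodFrame_block σ h hx.2, ← embCl_clVec, ← embCl_clE,
      spinProd_mul_embCl, mul_assoc, ← spinGroup.star_eq_inv, spinGroup.coe_star,
      spinGroup.mul_star_self_of_mem (spinProd _).2, mul_one]
    congr 1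
    have := (σ j).lift_covers (α j) (β j) (x j) ⟨hx.1 j trivial, hx.2 j trivial⟩ b
    rw [← spinGroup.star_eq_inv, spinGroup.coe_star] at this
    rw [this, clVec_eq_sum]

end ProductSpin

/-! ### Isomorphisms of spinor bundles -/

section Clifford

variable {E : Type*} [NormedAddCommGroup E] [NormedSpace ℝ E] {H : Type*} [TopologicalSpace H]
  {I : ModelWithCorners ℝ E H} {M : Type*} [TopologicalSpace M] [ChartedSpace H M]
  [IsManifold I ∞ M] {g : SmoothMetric I M} {n : ℕ}

namespace IsUnitLift

theorem mul_clVec_inner {x : M} {f f' : Fin n → TangentSpace I x} (hf : IsOrthoFrame g f)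
    {s : Cl n} (hs : IsUnitLift (frameChange g f f') s) (X : TangentSpace I x) :
    s * clVec (fun a => g.inner x (f a) X) =
      clVec (fun a => g.inner x (f' a) X) * CliffordAlgebra.involute s := by
  rw [hs.lift.mul_clVec, clVec_eq_sum fun a => g.inner x (f' a) X]
  congr 1
  simp only [frameChange, Finset.smul_sum, smul_smul]
  rw [Finset.sum_comm]
  refine Finset.sum_congr rfl fun c _ => ?_
  rw [← Finset.sum_smul, ← hf.sum_inner_mul_inner]
  congr 1
  exact Finset.sum_congr rfl fun b _ => by rw [g.symm x (f' c), mul_comm]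

theorem mul_clVec_mul_clVec {x : M} {f f' : Fin n → TangentSpace I x} (hf : IsOrthoFrame g f)
    {s : Cl n} (hs : IsUnitLift (frameChange g f f') s) (X Y : TangentSpace I x) :
    s * (clVec (fun a => g.inner x (f a) X) * clVec fun a => g.inner x (f a) Y) =
      (clVec (fun a => g.inner x (f' a) X) * clVec fun a => g.inner x (f' a) Y) * s := by
  have h : CliffordAlgebra.involute s * clVec (fun a => g.inner x (f a) Y) =
      clVec (fun a => g.inner x (f' a) Y) * s := by
    have := congrArg CliffordAlgebra.involute (hs.mul_clVec_inner hf Y)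
    rwa [map_mul, map_mul, CliffordAlgebra.involute_involute, CliffordAlgebra.involute_ι,
      CliffordAlgebra.involute_ι, mul_neg, neg_mul, neg_inj] at this
  rw [← mul_assoc, hs.mul_clVec_inner hf, mul_assoc, h, mul_assoc]

/-- The isomorphism by which an element of `Pin n` acts on a Clifford module. -/
def action {V : Type v} [NormedAddCommGroup V] [NormedSpace ℂ V] {w : Fin n → Cl n} {s : Cl n}
    (hs : IsUnitLift w s) (ρ : ClRep n V) : V ≃ₗ[ℂ] V :=
  LinearEquiv.ofLinearMap (ρ s) (ρ (star s))
    (by rw [← Module.End.mul_eq_comp, ← map_mul, hs.mul_star, map_one]; rfl)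
    (by rw [← Module.End.mul_eq_comp, ← map_mul, hs.star_mul, map_one]; rfl)

end IsUnitLift

end Clifford

section BundleHom

variable {E : Type*} [NormedAddCommGroup E] [NormedSpace ℝ E] {H : Type*} [TopologicalSpace H]
  {I : ModelWithCorners ℝ E H} {B : Type*} [TopologicalSpace B] [ChartedSpace H B]

theorem WeakSmoothAt.comp {E' : Type*} [NormedAddCommGroup E'] [NormedSpace ℝ E'] {H' : Type*}
    [TopologicalSpace H'] {I' : ModelWithCorners ℝ E' H'} {B' : Type*} [TopologicalSpace B']
    [ChartedSpace H' B'] {F : Type*} [AddCommGroup F] [Module ℝ F] {f : B → F} {h : B' → B} (x : B')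
    (hf : WeakSmoothAt I f (h x)) (hh : ContMDiffAt I' I ∞ h x) :
    WeakSmoothAt I' (fun y => f (h y)) x := fun φ =>
  ContMDiffAt.comp x (g := fun z => φ (f z)) (hf φ) hh

variable {F F' F'' : Type*} [NormedAddCommGroup F] [NormedSpace ℂ F] [NormedAddCommGroup F']
  [NormedSpace ℂ F'] [NormedAddCommGroup F''] [NormedSpace ℂ F''] {ι ι' ι'' : Type*}

/-- The composition of two isomorphisms of vector bundles. -/
def SmoothBundleIso.trans {Z : VectorBundleCore ℂ B F ι} {Z' : VectorBundleCore ℂ B F' ι'}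
    {Z'' : VectorBundleCore ℂ B F'' ι''} (Φ : SmoothBundleIso I Z Z')
    (Φ' : SmoothBundleIso I Z' Z'') : SmoothBundleIso I Z Z'' where
  fiberEquiv x := (Φ.fiberEquiv x).trans (Φ'.fiberEquiv x)
  smooth := Φ'.smooth.comp Φ.smooth
  smooth_symm := Φ.smooth_symm.comp Φ'.smooth_symm

theorem contMDiff_bundleHom [FiniteDimensional ℂ F] [FiniteDimensional ℂ F']
    (Z : VectorBundleCore ℂ B F ι) (Z' : VectorBundleCore ℂ B F' ι')
    (Φ : ∀ x, Z.Fiber x → Z'.Fiber x)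
    (hΦ : ∀ x₀, ∃ L : B → F →ₗ[ℝ] F', WeakSmoothAt I L x₀ ∧ ∀ᶠ y in 𝓝 x₀, ∀ ψ : Z.Fiber y,
      Z'.coordChange (Z'.indexAt y) (Z'.indexAt x₀) y (Φ y ψ) =
        L y (Z.coordChange (Z.indexAt y) (Z.indexAt x₀) y ψ)) :
    ContMDiff (I.prod 𝓘(ℝ, F)) (I.prod 𝓘(ℝ, F')) ∞
      fun p : TotalSpace F Z.Fiber => TotalSpace.mk' F' (E := Z'.Fiber) p.1 (Φ p.1 p.2) := by
  have : FiniteDimensional ℝ F := FiniteDimensional.complexToReal F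
  have : FiniteDimensional ℝ F' := FiniteDimensional.complexToReal F'
  intro p₀
  obtain ⟨L, hL, hLΦ⟩ := hΦ p₀.1
  have hproj : ContMDiffAt (I.prod 𝓘(ℝ, F)) I ∞ (fun p : TotalSpace F Z.Fiber => p.1) p₀ :=
    Bundle.contMDiffAt_proj Z.Fiber
  have hcoord := (Bundle.contMDiffAt_totalSpace.1
    (contMDiffAt_id (I := I.prod 𝓘(ℝ, F)) (n := ∞) (x := p₀))).2
  refine Bundle.contMDiffAt_totalSpace.2 ⟨hproj, ?_⟩
  have hlocal : WeakSmoothAt (I.prod 𝓘(ℝ, F)) (fun p : TotalSpace F Z.Fiber =>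
      L p.1 (Z.coordChange (Z.indexAt p.1) (Z.indexAt p₀.1) p.1 p.2)) p₀ :=
    WeakSmoothAt.bilinear LinearMap.id (hL.comp p₀ hproj) (WeakSmoothAt.of_contMDiffAt hcoord)
  refine hlocal.contMDiffAt.congr_of_eventuallyEq ?_
  filter_upwards [hproj.continuousAt.eventually hLΦ] with p hp
  exact hp p.2

end BundleHom

namespace SpinStructure

variable {E : Type*} [NormedAddCommGroup E] [NormedSpace ℝ E] {H : Type*} [TopologicalSpace H]
  {I : ModelWithCorners ℝ E H} {M : Type*} [TopologicalSpace M] [ChartedSpace H M]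
  [IsManifold I ∞ M] {g : SmoothMetric I M} {n : ℕ} {V : Type v}
  [NormedAddCommGroup V] [NormedSpace ℂ V] [FiniteDimensional ℂ V]

theorem coordChange_rep_transport {σ σ' : SpinStructure I g n} (ρ : ClRep n V) {α β : σ.Index}
    (α' β' : σ'.Index) {x : M} (hα : x ∈ σ.baseSet α) (hβ : x ∈ σ.baseSet β) (s : Cl n) (ψ : V) :
    (σ'.spinorBundle ρ).coordChange α' β' x (ρ s ψ) =
      ρ (transport σ σ' α β α' β' x s) ((σ.spinorBundle ρ).coordChange α β x ψ) := by
  change ρ _ (ρ s ψ) = ρ _ (ρ (σ.lift β α x : Cl n) ψ)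
  rw [← Module.End.mul_apply, ← Module.End.mul_apply, ← map_mul, ← map_mul, transport,
    mul_assoc _ _ (σ.lift β α x : Cl n), σ.lift_mul_lift _ _ _ hα hβ hα, σ.lift_self _ _ hα]
  simp

theorem exists_spinorBundle_iso [FiniteDimensional ℝ E] [SimplyConnectedSpace M]
    [LocallyPathConnectedSpace M] (σ σ' : SpinStructure I g n) (ρ : ClRep n V) :
    ∃ Φ : SmoothBundleIso I (σ.spinorBundle ρ) (σ'.spinorBundle ρ),
      ∀ x X Y ψ, Φ.fiberEquiv x (σ.cliffordMul ρ x X (σ.cliffordMul ρ x Y ψ)) =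
        σ'.cliffordMul ρ x X (σ'.cliffordMul ρ x Y (Φ.fiberEquiv x ψ)) := by
  obtain ⟨s, hs, hsm⟩ := σ.exists_global_lift σ'
  let Φ : ∀ _ : M, V ≃ₗ[ℂ] V := fun x => (hs x).action ρ
  let S : M → M → Cl n := fun x₀ y =>
    transport σ σ' (σ.indexAt y) (σ.indexAt x₀) (σ'.indexAt y) (σ'.indexAt x₀) y (s y)
  let R : Cl n →ₗ[ℝ] V →ₗ[ℝ] V := (LinearMap.restrictScalarsₗ ℝ ℂ V V ℝ).comp ρ.toLinearMap
  have hbase : ∀ x₀, ∀ᶠ y in 𝓝 x₀, y ∈ σ.baseSet (σ.indexAt x₀) ∧ y ∈ σ'.baseSet (σ'.indexAt x₀) :=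
    fun x₀ => (((σ.isOpen_baseSet _).inter (σ'.isOpen_baseSet _)).mem_nhds
      ⟨σ.mem_baseSet_at x₀, σ'.mem_baseSet_at x₀⟩)
  have hΦ : ∀ x₀ y, y ∈ σ.baseSet (σ.indexAt x₀) → ∀ ψ : V,
      (σ'.spinorBundle ρ).coordChange (σ'.indexAt y) (σ'.indexAt x₀) y (Φ y ψ) =
        ρ (S x₀ y) ((σ.spinorBundle ρ).coordChange (σ.indexAt y) (σ.indexAt x₀) y ψ) :=
    fun x₀ y hy ψ => coordChange_rep_transport ρ _ _ (σ.mem_baseSet_at y) hy (s y) ψ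
  refine ⟨⟨Φ, ?_, ?_⟩, fun x X Y ψ => ?_⟩
  · refine contMDiff_bundleHom _ _ (fun x => Φ x) fun x₀ =>
      ⟨fun y => R (S x₀ y), (hsm x₀).linear R, ?_⟩
    filter_upwards [hbase x₀] with y hy ψ
    exact hΦ x₀ y hy.1 ψ
  · refine contMDiff_bundleHom _ _ (fun x => (Φ x).symm) fun x₀ =>
      ⟨fun y => R (star (S x₀ y)), (hsm x₀).clStar.linear R, ?_⟩
    filter_upwards [hbase x₀] with y hy η
    obtain ⟨ψ, rfl⟩ := (Φ y).surjective η
    refine Eq.trans ?_ (congrArg (ρ (star (S x₀ y))) (hΦ x₀ y hy.1 ψ)).symm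
    have hS : star (S x₀ y) * S x₀ y = 1 :=
      (isUnitLift_transport ⟨σ.mem_baseSet_at y, σ'.mem_baseSet_at y⟩ hy (hs y)).star_mul
    rw [LinearEquiv.symm_apply_apply, ← Module.End.mul_apply, ← map_mul, hS, map_one]
    rfl
  · have h := congrArg (fun a => ρ a ψ)
      ((hs x).mul_clVec_mul_clVec (σ.isOrthoFrame _ (σ.mem_baseSet_at x)) X Y)
    simp only [map_mul] at h
    exact h

end SpinStructure

/-! ### The spinor bundle of the product -/

theorem fiberS_equiv_spinProd {N : ℕ} {D : Fin N → ℕ} {V : Fin N → Type v}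
    [∀ i, NormedAddCommGroup (V i)] [∀ i, NormedSpace ℂ (V i)] {ρ : ∀ i, ClRep (D i) (V i)}
    {K : Finset (Fin N)} {V' : Type w} [NormedAddCommGroup V'] [NormedSpace ℂ V']
    {ρ' : ClRep (∑ i, D i) V'} {Ψ : V' ≃ₗ[ℂ] fiberS ρ K}
    (hΨ : ∀ i, ∀ a ∈ CliffordAlgebra.even (negEuclid (D i)), ∀ ξ,
      (Ψ (ρ' (embCl i a) ξ) : ⨂[ℂ] i, (ρ i).Graded) =
        singleMap i ((ρ i).gradedRep a) (Ψ ξ : ⨂[ℂ] i, (ρ i).Graded))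
    (s : ∀ i, Spin (D i)) (ξ : V') :
    (Ψ (ρ' (spinProd s : Cl (∑ i, D i)) ξ) : ⨂[ℂ] i, (ρ i).Graded) =
      PiTensorProduct.map (fun i => (ρ i).gradedRep (s i : Cl (D i)))
        (Ψ ξ : ⨂[ℂ] i, (ρ i).Graded) := by
  have hlist : ∀ l : List (Fin N), ∀ ξ,
      (Ψ (ρ' (l.map fun i => embCl i (s i : Cl (D i))).prod ξ) : ⨂[ℂ] i, (ρ i).Graded) =
        (l.map fun i => singleMap i ((ρ i).gradedRep (s i : Cl (D i)))).prod
          (Ψ ξ : ⨂[ℂ] i, (ρ i).Graded) := by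
    intro l
    induction l with
    | nil => simp
    | cons i l ih =>
      intro ξ
      rw [List.map_cons, List.prod_cons, map_mul, Module.End.mul_apply,
        hΨ i _ (spinGroup.mem_even (s i).2), ih, List.map_cons, List.prod_cons,
        Module.End.mul_apply]
  rw [coe_spinProd, hlist, list_prod_singleMap _ (List.nodup_finRange N)]
  simp

theorem ClRep.gradedVec_zero {n : ℕ} {V : Type v} [NormedAddCommGroup V] [NormedSpace ℂ V]
    (ρ : ClRep n V) : ρ.gradedVec 0 = 0 :=
  map_zero ρ.gradedLin

section ProductBundle

variable {N : ℕ} {D : Fin N → ℕ} {M : Fin N → Type u} [∀ i, TopologicalSpace (M i)]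
  [∀ i, ChartedSpace (EuclideanSpace ℝ (Fin (D i))) (M i)]
  [∀ i, IsManifold (𝓡 (D i)) ∞ (M i)] {g : ∀ i, SmoothMetric (𝓡 (D i)) (M i)}
  (σ : ∀ i, SpinStructure (𝓡 (D i)) (g i) (D i))
  {V : Fin N → Type v} [∀ i, NormedAddCommGroup (V i)] [∀ i, NormedSpace ℂ (V i)]
  [∀ i, FiniteDimensional ℂ (V i)] {ρ : ∀ i, ClRep (D i) (V i)}

theorem coordChange_bundleS (K : Finset (Fin N)) (α β : ∀ i, (σ i).Index) (x : ∀ i, M i)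
    (t : fiberS ρ K) :
    ((bundleS σ ρ K).coordChange α β x t : ⨂[ℂ] i, (ρ i).Graded) =
      PiTensorProduct.map (fun i => (ρ i).gradedRep ((σ i).lift (β i) (α i) (x i) : Cl (D i)))
        (t : ⨂[ℂ] i, (ρ i).Graded) := by
  change PiTensorProduct.map (fun i => (((σ i).gradedSpinorBundle (ρ i)).coordChange (α i) (β i)
    (x i)).toLinearMap) (t : ⨂[ℂ] i, (ρ i).Graded) = _
  congr 2
  funext i
  refine LinearMap.ext fun ξ => ?_
  have h := (ρ i).gradedRep_of_mem_even (spinGroup.mem_even ((σ i).lift (β i) (α i) (x i)).2) ξ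
  exact ClRep.graded_ext h.1.symm h.2.symm

variable
  {A : ∀ i, ∀ x : (∀ i, M i), TangentSpace (𝓡 (D i)) (x i) →L[ℝ] TangentSpace (𝓡 (D i)) (x i)}

theorem cliffordMulW_of_factor {x : ∀ i, M i} {i : Fin N} {X : TangentSpace (prodModel D) x}
    (hX : ∀ j, j ≠ i → tangentProj x j X = 0) :
    cliffordMulW σ ρ A x X = PiTensorProduct.map (Function.update
      (fun j => if j < i then (ρ j).parity else 1) i
      ((ρ i).gradedVec ((σ i).frameCoord (x i) (A i x (tangentProj x i X))))) := by
  unfold cliffordMulW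
  refine (Finset.sum_eq_single i (fun k _ hk => ?_) (by simp)).trans ?_
  · refine PiTensorProduct.ext (MultilinearMap.ext fun ξ => ?_)
    simp only [LinearMap.compMultilinearMap_apply, PiTensorProduct.map_tprod]
    refine MultilinearMap.map_coord_zero _ k ?_
    have hcoord : (σ k).frameCoord (x k) (A k x (tangentProj x k X)) = 0 := by
      funext a
      simp [SpinStructure.frameCoord, hX k hk]
    simp [hcoord, ClRep.gradedVec_zero]
  · congr 1
    funext j
    by_cases hj : j = i
    · subst hj
      simp
    · simp only [if_neg hj, Function.update_of_ne hj]
      rfl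

theorem cliffordMulW_cliffordMulW_of_factor {x : ∀ i, M i} {i : Fin N}
    {X Y : TangentSpace (prodModel D) x} (hX : ∀ j, j ≠ i → tangentProj x j X = 0)
    (hY : ∀ j, j ≠ i → tangentProj x j Y = 0) (t : ⨂[ℂ] i, (ρ i).Graded) :
    cliffordMulW σ ρ A x X (cliffordMulW σ ρ A x Y t) =
      singleMap i ((ρ i).gradedRep
        (clVec ((σ i).frameCoord (x i) (A i x (tangentProj x i X))) *
          clVec ((σ i).frameCoord (x i) (A i x (tangentProj x i Y))))) t := by
  rw [map_mul, ClRep.gradedRep_clVec, ClRep.gradedRep_clVec,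
    ← map_update_mul_map_update (b := fun j => if j < i then (ρ j).parity else 1),
    cliffordMulW_of_factor σ hX, cliffordMulW_of_factor σ hY]
  · rfl
  · intro j
    split_ifs
    · exact (ρ j).parity_mul_self
    · exact one_mul 1

theorem prodCoframe_of_factor {α : ∀ i, (σ i).Index} {x : ∀ i, M i} {i : Fin N}
    {X : TangentSpace (prodModel D) x} (hX : ∀ j, j ≠ i → tangentProj x j X = 0) :
    prodCoframe σ A α x X = blockVec i fun a =>
      (g i).inner (x i) ((σ i).frame (α i) a (x i)) (A i x (tangentProj x i X)) := by
  ext k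
  obtain ⟨⟨j, b⟩, rfl⟩ := finSigmaFinEquiv.surjective k
  rw [prodCoframe_apply, blockVec_apply]
  by_cases hj : j = i
  · subst hj
    simp
  · simp [hj, hX j hj]

variable {gM : SmoothMetric (prodModel D) (∀ i, M i)}

theorem clVec_frameCoord_prodSpinStructure (h : IsProductMetric g gM A) {x : ∀ i, M i} {i : Fin N}
    {X : TangentSpace (prodModel D) x} (hX : ∀ j, j ≠ i → tangentProj x j X = 0) :
    clVec ((prodSpinStructure σ h).frameCoord x X) =
      embCl i (clVec ((σ i).frameCoord (x i) (A i x (tangentProj x i X)))) := by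
  rw [embCl_clVec]
  refine congrArg clVec (Eq.trans (funext fun a => ?_)
    (prodCoframe_of_factor σ (α := (prodSpinStructure σ h).indexAt x) hX))
  exact inner_prodFrame σ h ((prodSpinStructure σ h).mem_baseSet_at x) a X

theorem exists_prodSpinStructure_spinorBundle_iso (h : IsProductMetric g gM A) {V' : Type w}
    [NormedAddCommGroup V'] [NormedSpace ℂ V'] [FiniteDimensional ℂ V']
    {ρ' : ClRep (∑ i, D i) V'} {K : Finset (Fin N)} {Ψ : V' ≃ₗ[ℂ] fiberS ρ K}
    (hΨ : ∀ i, ∀ a ∈ CliffordAlgebra.even (negEuclid (D i)), ∀ ξ,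
      (Ψ (ρ' (embCl i a) ξ) : ⨂[ℂ] i, (ρ i).Graded) =
        singleMap i ((ρ i).gradedRep a) (Ψ ξ : ⨂[ℂ] i, (ρ i).Graded)) :
    ∃ Φ : SmoothBundleIso (prodModel D) ((prodSpinStructure σ h).spinorBundle ρ') (bundleS σ ρ K),
      ∀ (x : ∀ i, M i) (i : Fin N) (X Y : TangentSpace (prodModel D) x),
        (∀ j, j ≠ i → tangentProj x j X = 0) → (∀ j, j ≠ i → tangentProj x j Y = 0) →
        ∀ ψ, inclS σ ρ K x (Φ.fiberEquiv x ((prodSpinStructure σ h).cliffordMul ρ' x X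
            ((prodSpinStructure σ h).cliffordMul ρ' x Y ψ))) =
          cliffordMulW σ ρ A x X (cliffordMulW σ ρ A x Y (inclS σ ρ K x (Φ.fiberEquiv x ψ))) := by
  let Φ : ∀ _ : ∀ i, M i, V' ≃ₗ[ℂ] fiberS ρ K := fun _ => Ψ
  have hcoord : ∀ α β x (ξ : V'), (bundleS σ ρ K).coordChange α β x (Ψ ξ) =
      Ψ (((prodSpinStructure σ h).spinorBundle ρ').coordChange α β x ξ) :=
    fun α β x ξ => Subtype.ext <| by
      rw [coordChange_bundleS]
      exact (fiberS_equiv_spinProd hΨ _ ξ).symm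
  refine ⟨⟨Φ, ?_, ?_⟩, fun x i X Y hX hY ψ => ?_⟩
  · refine contMDiff_bundleHom _ _ (fun x => Φ x) fun x₀ =>
      ⟨fun _ => Ψ.toLinearMap.restrictScalars ℝ, WeakSmoothAt.const _, ?_⟩
    exact Filter.Eventually.of_forall fun y ψ => hcoord _ _ y ψ
  · refine contMDiff_bundleHom _ _ (fun x => (Φ x).symm) fun x₀ =>
      ⟨fun _ => Ψ.symm.toLinearMap.restrictScalars ℝ, WeakSmoothAt.const _, ?_⟩
    refine Filter.Eventually.of_forall fun y η => ?_
    obtain ⟨ψ, rfl⟩ := Ψ.surjective η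
    exact (congrArg _ (Ψ.symm_apply_apply ψ)).trans ((Ψ.symm_apply_apply _).symm.trans
      (congrArg Ψ.symm (hcoord _ _ y ψ).symm))
  · refine Eq.trans ?_ (cliffordMulW_cliffordMulW_of_factor σ hX hY _).symm
    refine Eq.trans ?_ (hΨ i _ (CliffordAlgebra.ι_mul_ι_mem_evenOdd_zero _ _ _) ψ)
    rw [map_mul (embCl i), map_mul ρ', ← clVec_frameCoord_prodSpinStructure σ h hX,
      ← clVec_frameCoord_prodSpinStructure σ h hY]
    rfl

end ProductBundle

theorem theorem3_general {N : ℕ} {D : Fin N → ℕ} (M : Fin N → Type u)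
    [∀ i, TopologicalSpace (M i)] [∀ i, ChartedSpace (EuclideanSpace ℝ (Fin (D i))) (M i)]
    [∀ i, IsManifold (𝓡 (D i)) ∞ (M i)] (g : ∀ i, SmoothMetric (𝓡 (D i)) (M i))
    (σ : ∀ i, SpinStructure (𝓡 (D i)) (g i) (D i))
    {V : Fin N → Type v} [∀ i, NormedAddCommGroup (V i)] [∀ i, NormedSpace ℂ (V i)]
    [∀ i, FiniteDimensional ℂ (V i)] (ρ : ∀ i, ClRep (D i) (V i))
    (hρ : ∀ i, (ρ i).IsSpinorModule) (gM : SmoothMetric (prodModel D) (∀ i, M i))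
    (A : ∀ i, ∀ x : (∀ i, M i), TangentSpace (𝓡 (D i)) (x i) →L[ℝ] TangentSpace (𝓡 (D i)) (x i))
    (h : IsProductMetric g gM A)
    (K : Finset (Fin N)) (hK : K ⊆ Finset.univ.filter fun i => Odd (D i))
    (hKcard : K.card = (Finset.univ.filter fun i => Odd (D i)).card -
      (Finset.univ.filter fun i => Odd (D i)).card / 2) :
    Nonempty (SpinStructure (prodModel D) gM (∑ i, D i)) ∧
      ∀ [∀ i, SimplyConnectedSpace (M i)] (τ : SpinStructure (prodModel D) gM (∑ i, D i))
        {V' : Type w} [NormedAddCommGroup V'] [NormedSpace ℂ V'] [FiniteDimensional ℂ V']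
        (ρ' : ClRep (∑ i, D i) V'), ρ'.IsSpinorModule →
        ∃ Φ : SmoothBundleIso (prodModel D) (τ.spinorBundle ρ') (bundleS σ ρ K),
          ∀ (x : ∀ i, M i) (i : Fin N) (X Y : TangentSpace (prodModel D) x),
            (∀ j, j ≠ i → tangentProj x j X = 0) → (∀ j, j ≠ i → tangentProj x j Y = 0) →
            ∀ ψ : (τ.spinorBundle ρ').Fiber x,
              inclS σ ρ K x (Φ.fiberEquiv x (τ.cliffordMul ρ' x X (τ.cliffordMul ρ' x Y ψ))) =
                cliffordMulW σ ρ A x X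
                  (cliffordMulW σ ρ A x Y (inclS σ ρ K x (Φ.fiberEquiv x ψ))) := by
  refine ⟨⟨prodSpinStructure σ h⟩, fun τ V' _ _ _ ρ' hρ' => ?_⟩
  have := simplyConnectedSpace_pi (X := M)
  have := locallyPathConnectedSpace_pi (D := D) M
  obtain ⟨Ψ, hΨ⟩ := exists_fiberS_equiv ρ hK hρ hKcard ρ' hρ'
  obtain ⟨Θ, hΘ⟩ := τ.exists_spinorBundle_iso (prodSpinStructure σ h) ρ'
  obtain ⟨Φ, hΦ⟩ := exists_prodSpinStructure_spinorBundle_iso σ h hΨ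
  refine ⟨Θ.trans Φ, fun x i X Y hX hY ψ => ?_⟩
  refine Eq.trans ?_ (hΦ x i X Y hX hY (Θ.fiberEquiv x ψ))
  exact congrArg (fun ξ => inclS σ ρ K x (Φ.fiberEquiv x ξ)) (hΘ x X Y ψ)

end

theorem theorem3 {N : ℕ} {D : Fin N → ℕ}
    -- the simply connected manifolds `M i` of dimension `D i`, with metrics and spin structures
    (M : Fin N → Type u) [∀ i, TopologicalSpace (M i)]
    [∀ i, T2Space (M i)] [∀ i, SecondCountableTopology (M i)]
    [∀ i, ChartedSpace (EuclideanSpace ℝ (Fin (D i))) (M i)]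
    [∀ i, IsManifold (𝓡 (D i)) ∞ (M i)] [∀ i, SimplyConnectedSpace (M i)]
    (g : ∀ i, SmoothMetric (𝓡 (D i)) (M i))
    (σ : ∀ i, SpinStructure (𝓡 (D i)) (g i) (D i))
    -- the spinor modules that define the spinor bundles of the factors
    {V : Fin N → Type v} [∀ i, NormedAddCommGroup (V i)] [∀ i, NormedSpace ℂ (V i)]
    [∀ i, FiniteDimensional ℂ (V i)] (ρ : ∀ i, ClRep (D i) (V i))
    (hρ : ∀ i, (ρ i).IsSpinorModule)
    -- the metric on the product, related to the `g i` by the smooth maps `A i`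
    (gM : SmoothMetric (prodModel D) (∀ i, M i))
    (A : ∀ i, ∀ x : (∀ i, M i), TangentSpace (𝓡 (D i)) (x i) →L[ℝ] TangentSpace (𝓡 (D i)) (x i))
    (hA : ∀ i, ContMDiff (prodModel D).tangent (𝓡 (D i)).tangent ∞
      fun p : TangentBundle (prodModel D) (∀ i, M i) =>
        (⟨p.1 i, A i p.1 (tangentProj p.1 i p.2)⟩ : TangentBundle (𝓡 (D i)) (M i)))
    (hgM : ∀ (x : ∀ i, M i) (X Y : TangentSpace (prodModel D) x),
      gM.inner x X Y =
        ∑ i, (g i).inner (x i) (A i x (tangentProj x i X)) (A i x (tangentProj x i Y)))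
    -- the choice of the odd dimensional factors that are diagonalized
    (K : Finset (Fin N)) (hK : K ⊆ Finset.univ.filter fun i => Odd (D i))
    (hKcard : K.card = (Finset.univ.filter fun i => Odd (D i)).card -
      (Finset.univ.filter fun i => Odd (D i)).card / 2) :
    Nonempty (SpinStructure (prodModel D) gM (∑ i, D i)) ∧
      ∀ (τ : SpinStructure (prodModel D) gM (∑ i, D i))
        {V' : Type w} [NormedAddCommGroup V'] [NormedSpace ℂ V'] [FiniteDimensional ℂ V']
        (ρ' : ClRep (∑ i, D i) V'), ρ'.IsSpinorModule →
        ∃ Φ : SmoothBundleIso (prodModel D) (τ.spinorBundle ρ') (bundleS σ ρ K),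
          ∀ (x : ∀ i, M i) (i : Fin N) (X Y : TangentSpace (prodModel D) x),
            (∀ j, j ≠ i → tangentProj x j X = 0) → (∀ j, j ≠ i → tangentProj x j Y = 0) →
            ∀ ψ : (τ.spinorBundle ρ').Fiber x,
              inclS σ ρ K x (Φ.fiberEquiv x (τ.cliffordMul ρ' x X (τ.cliffordMul ρ' x Y ψ))) =
                cliffordMulW σ ρ A x X
                  (cliffordMulW σ ρ A x Y (inclS σ ρ K x (Φ.fiberEquiv x ψ))) := by
  obtain ⟨hspin, hiso⟩ := theorem3_general M g σ ρ hρ gM A ⟨hA, hgM⟩ K hK hKcard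
  exact ⟨hspin, hiso⟩
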